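/- **Generation of bosonic semigroups.** Let $\mathcal H$ be a complex Hilbert space (e.g. $L^2(\mathbb R)$) with an orthonormal (Fock) basis $(|n\rangle)_{n\ge 0}$, let $\mathcal H_f$ be the span of the vectors $|n\rangle$, and let $a|n\rangle=\sqrt n\,|n-1\rangle$, $a^\dagger|n\rangle=\sqrt{n+1}\,|n+1\rangle$, $N=a^\dagger a$. Let $\mathcal T_{1,\mathrm{sa}}$ be the real Banach space of self-adjoint trace-class operators with the trace norm $\|x\|_1=\mathrm{tr}|x|$, and $\mathcal T_f\subset\mathcal T_{1,\mathrm{sa}}$ the subspace of self-adjoint finite linear combinations of the operators $|n\rangle\langle m|$. For real $k\ge 0$ the bosonic Sobolev space is $$W^{k,1}=\{(N+1)^{-k/4}\,y\,(N+1)^{-k/4} : y\in\mathcal T_{1,\mathrm{sa}}\},\qquad \|x\|_{W^{k,1}}=\|(N+1)^{k/4}\,x\,(N+1)^{k/4}\|_1,$$ so that $W^{0,1}=\mathcal T_{1,\mathrm{sa}}$. Let $K\in\mathbb N$ and let $H=p_H(a,a^\dagger)$ and $L_j=p_j(a,a^\dagger)$, $j=1,\dots,K$, be polynomials (with complex coefficients,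 in non-commuting variables) of $a$ and $a^\dagger$, with $H$ symmetric on $\mathcal H_f$. Define $\mathcal L:\mathcal T_f\to\mathcal T_f$ by $$\mathcal L(x)=-i[H,x]+\sum_{j=1}^K\Big(L_jxL_j^\dagger-\tfrac12\{L_j^\dagger L_j,x\}\Big).$$ Assume that there are a sequence $(k_r)_{r\in\mathbb N}$ in $[0,\infty)$ with $k_r\to\infty$ and numbers $\omega_{k_r}\ge 0$ such that, for all $r$ and all positive semi-definite $x\in\mathcal T_f$, $$\mathrm{tr}\big[\mathcal L(x)(N+1)^{k_r/2}\big]\le\omega_{k_r}\,\mathrm{tr}\big[x(N+1)^{k_r/2}\big].$$ Then for every real $k\ge 0$ the operator $(\mathcal L,\mathcal T_f)$ is closable on $W^{k,1}$, and its closure generates a strongly continuous, positivity-preserving semigroup $(\mathcal P_t)_{t\ge 0}$ on $W^{k,1}$; the semigroups obtained for different $k$ agree wherever they are both defined. They satisfy $$\|\mathcal P_t\|_{W^{k,1}\to W^{k,1}}\le e^{\omega_k t}\quad\text{for all } t\ge 0,\qquad \omega_k=\frac{\kappa_1-k}{\kappa_1-\kappa_0}\,\omega_{\kappa_0}+\frac{k-\kappa_0}{\kappa_1-\kappa_0}\,\omega_{\kappa_1},$$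 for every pair $\kappa_0\le k<\kappa_1$ with $\kappa_1=k_{r_1}$ a member of the sequence, and with either $\kappa_0=k_{r_0}$ a member of the sequence, or $\kappa_0=0$ and $\omega_{\kappa_0}=0$. Finally, for $k=0$ the semigroup is contractive, $\|\mathcal P_t\|_{W^{0,1}\to W^{0,1}}\le 1$, and trace-preserving, $\mathrm{tr}[\mathcal P_t(x)]=\mathrm{tr}[x]$ for all $x\in\mathcal T_{1,\mathrm{sa}}$ and $t\ge0$. -/

import Mathlib

open scoped InnerProductSpace ENNReal NNReal

namespace Bosonic
noncomputable section
set_option linter.unusedSectionVars false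
section TraceNorm
variable {H : Type*} [NormedAddCommGroup H] [InnerProductSpace ℂ H] [CompleteSpace H]

/-- The trace `∑ₙ ⟨n|A|n⟩ ∈ [0,∞]` of a positive bounded operator, in the orthonormal basis `b`. -/
def posTrace (b : HilbertBasis ℕ ℂ H) (A : H →L[ℂ] H) : ℝ≥0∞ :=
  ∑' n, ENNReal.ofReal (⟪b n, A (b n)⟫_ℂ).re

/-- The trace norm `‖A‖₁ = tr |A| ∈ [0,∞]`, where `|A| = √(A†A)`. -/
def traceNorm (b : HilbertBasis ℕ ℂ H) (A : H →L[ℂ] H) : ℝ≥0∞ :=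
  posTrace b (CFC.abs A)

/-- The squared Hilbert-Schmidt norm, used in the proof of the triangle inequality for `‖·‖₁`. -/
def hsSq (b : HilbertBasis ℕ ℂ H) (A : H →L[ℂ] H) : ℝ≥0∞ := ∑' n, ‖A (b n)‖ₑ ^ 2

theorem enorm_sq_eq_tsum (b : HilbertBasis ℕ ℂ H) (x : H) :
    ‖x‖ₑ ^ 2 = ∑' m, ‖⟪b m, x⟫_ℂ‖ₑ ^ 2 := by
  have h := b.hasSum_inner_mul_inner x x
  have h2 : HasSum (fun m => ‖⟪b m, x⟫_ℂ‖ ^ 2) (‖x‖ ^ 2) := by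
    have := (Complex.hasSum_re h)
    convert this using 1
    · ext m
      rw [← inner_conj_symm x (b m), mul_comm, Complex.mul_conj, Complex.normSq_eq_norm_sq,
        Complex.ofReal_re]
    · rw [inner_self_eq_norm_sq_to_K]; norm_cast
  have h3 : ‖x‖ₑ ^ 2 = ENNReal.ofReal (‖x‖ ^ 2) := by
    rw [← ofReal_norm, ENNReal.ofReal_pow (norm_nonneg _)]
  rw [h3, ← h2.tsum_eq, ENNReal.ofReal_tsum_of_nonneg (fun _ => by positivity) h2.summable]
  refine tsum_congr fun m => ?_
  rw [← ofReal_norm, ENNReal.ofReal_pow (norm_nonneg _)]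

theorem hsSq_adjoint (b : HilbertBasis ℕ ℂ H) (A : H →L[ℂ] H) :
    hsSq b (star A) = hsSq b A := by
  unfold hsSq
  simp_rw [enorm_sq_eq_tsum b]
  rw [ENNReal.tsum_comm]
  refine tsum_congr fun m => tsum_congr fun n => ?_
  rw [ContinuousLinearMap.star_eq_adjoint, ContinuousLinearMap.adjoint_inner_right,
    ← inner_conj_symm]
  congr 1
  rw [← ofReal_norm, ← ofReal_norm, RCLike.norm_conj]

theorem hsSq_mul_le (b : HilbertBasis ℕ ℂ H) (E A : H →L[ℂ] H) (hE : ∀ x, ‖E x‖ ≤ ‖x‖) :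
    hsSq b (E * A) ≤ hsSq b A := by
  refine ENNReal.tsum_le_tsum fun n => ?_
  gcongr
  rw [← ofReal_norm, ← ofReal_norm]
  exact ENNReal.ofReal_le_ofReal (hE _)

theorem posTrace_conj (b : HilbertBasis ℕ ℂ H) (A E : H →L[ℂ] H) (hA : 0 ≤ A)
    (hE : IsSelfAdjoint E) :
    posTrace b (E * A * E) = hsSq b (CFC.sqrt A * E) := by
  refine tsum_congr fun n => ?_
  have hs : IsSelfAdjoint (CFC.sqrt A) := IsSelfAdjoint.of_nonneg (CFC.sqrt_nonneg A)
  have h1 : E * A * E = star (CFC.sqrt A * E) * (CFC.sqrt A * E) := by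
    rw [star_mul, hs.star_eq, hE.star_eq]
    nth_rewrite 1 [← CFC.sqrt_mul_sqrt_self A hA]
    simp only [mul_assoc]
  rw [h1, mul_apply_eq_comp, ContinuousLinearMap.star_eq_adjoint,
    ContinuousLinearMap.adjoint_inner_right, inner_self_eq_norm_sq_to_K, ← ofReal_norm,
    ← ENNReal.ofReal_pow (norm_nonneg _)]
  norm_cast

theorem posTrace_eq_hsSq (b : HilbertBasis ℕ ℂ H) (A : H →L[ℂ] H) (hA : 0 ≤ A) :
    posTrace b A = hsSq b (CFC.sqrt A) := by
  simpa using posTrace_conj b A 1 hA (IsSelfAdjoint.one _)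

theorem posTrace_conj_le (b : HilbertBasis ℕ ℂ H) (A E : H →L[ℂ] H) (hA : 0 ≤ A)
    (hE : IsSelfAdjoint E) (hE1 : ∀ x, ‖E x‖ ≤ ‖x‖) :
    posTrace b (E * A * E) ≤ posTrace b A := by
  have hs : IsSelfAdjoint (CFC.sqrt A) := IsSelfAdjoint.of_nonneg (CFC.sqrt_nonneg A)
  rw [posTrace_conj b A E hA hE, posTrace_eq_hsSq b A hA, ← hsSq_adjoint, star_mul, hs.star_eq,
    hE.star_eq]
  exact hsSq_mul_le b _ _ hE1

theorem re_inner_nonneg {A : H →L[ℂ] H} (hA : 0 ≤ A) (x : H) : 0 ≤ (⟪x, A x⟫_ℂ).re :=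
  ((ContinuousLinearMap.nonneg_iff_isPositive A).1 hA).re_inner_nonneg_right x

theorem posTrace_add (b : HilbertBasis ℕ ℂ H) {A B : H →L[ℂ] H} (hA : 0 ≤ A) (hB : 0 ≤ B) :
    posTrace b (A + B) = posTrace b A + posTrace b B := by
  unfold posTrace
  rw [← ENNReal.tsum_add]
  refine tsum_congr fun n => ?_
  rw [← ENNReal.ofReal_add (re_inner_nonneg hA _) (re_inner_nonneg hB _)]
  simp

theorem posTrace_posPart_le (b : HilbertBasis ℕ ℂ H) {T P Q : H →L[ℂ] H} (hT : IsSelfAdjoint T)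
    (hP : 0 ≤ P) (hQ : 0 ≤ Q) (h : T = P - Q) : posTrace b T⁺ ≤ posTrace b P := by
  set S : Submodule ℂ H := (LinearMap.range (T⁺ : H →L[ℂ] H).toLinearMap).topologicalClosure
    with hS
  have : CompleteSpace S :=
    (Submodule.isClosed_topologicalClosure _).completeSpace_coe
  set E : H →L[ℂ] H := S.starProjection with hEdef
  have hE : IsSelfAdjoint E := isSelfAdjoint_starProjection S
  have hE1 : ∀ x, ‖E x‖ ≤ ‖x‖ := fun x => S.norm_starProjection_apply_le x
  have hTp : IsSelfAdjoint (T⁺) := IsSelfAdjoint.of_nonneg (CFC.posPart_nonneg T)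
  have hTn : IsSelfAdjoint (T⁻) := IsSelfAdjoint.of_nonneg (CFC.negPart_nonneg T)
  have e1 : E * T⁺ = T⁺ := by
    ext x
    exact Submodule.starProjection_eq_self_iff.2
      (Submodule.le_topologicalClosure _ ⟨x, rfl⟩)
  have e2 : T⁺ * E = T⁺ := by
    have := congrArg star e1
    rwa [star_mul, hE.star_eq, hTp.star_eq] at this
  have e3 : T⁻ * E = 0 := by
    have hle : S ≤ LinearMap.ker (T⁻ : H →L[ℂ] H).toLinearMap := by
      refine Submodule.topologicalClosure_minimal _ ?_ (T⁻ : H →L[ℂ] H).isClosed_ker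
      rintro _ ⟨x, rfl⟩
      exact congrArg (fun f : H →L[ℂ] H => f x) (CFC.negPart_mul_posPart T)
    ext x
    exact hle (S.starProjection_apply_mem x)
  have e4 : T⁺ = E * P * E - E * Q * E := by
    rw [← sub_mul, ← mul_sub, ← h]
    nth_rewrite 2 [← CFC.posPart_sub_negPart T hT]
    rw [mul_assoc, sub_mul, e2, e3, sub_zero, e1]
  refine le_trans ?_ (posTrace_conj_le b P E hP hE hE1)
  refine ENNReal.tsum_le_tsum fun n => ENNReal.ofReal_le_ofReal ?_
  have hQ' : 0 ≤ E * Q * E := by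
    simpa [hE.star_eq] using star_left_conjugate_nonneg hQ E
  have := re_inner_nonneg hQ' (b n)
  rw [e4, sub_apply, inner_sub_right, Complex.sub_re]
  linarith

theorem traceNorm_eq (b : HilbertBasis ℕ ℂ H) {A : H →L[ℂ] H} (hA : IsSelfAdjoint A) :
    traceNorm b A = posTrace b A⁺ + posTrace b A⁻ := by
  rw [traceNorm, ← posTrace_add b (CFC.posPart_nonneg A) (CFC.negPart_nonneg A),
    CFC.posPart_add_negPart A hA]

theorem traceNorm_add_le (b : HilbertBasis ℕ ℂ H) {A B : H →L[ℂ] H} (hA : IsSelfAdjoint A)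
    (hB : IsSelfAdjoint B) : traceNorm b (A + B) ≤ traceNorm b A + traceNorm b B := by
  have hp := add_nonneg (CFC.posPart_nonneg A) (CFC.posPart_nonneg B)
  have hn := add_nonneg (CFC.negPart_nonneg A) (CFC.negPart_nonneg B)
  have e : A + B = (A⁺ + B⁺) - (A⁻ + B⁻) := by
    nth_rewrite 1 [← CFC.posPart_sub_negPart A hA, ← CFC.posPart_sub_negPart B hB]
    abel
  have h1 := posTrace_posPart_le b (hA.add hB) hp hn e
  have h2 := posTrace_posPart_le b (hA.add hB).neg hn hp (by rw [e]; abel)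
  rw [CFC.posPart_neg] at h2
  rw [traceNorm_eq b (hA.add hB), traceNorm_eq b hA, traceNorm_eq b hB]
  rw [posTrace_add b (CFC.posPart_nonneg A) (CFC.posPart_nonneg B)] at h1
  rw [posTrace_add b (CFC.negPart_nonneg A) (CFC.negPart_nonneg B)] at h2
  calc _ ≤ _ := add_le_add h1 h2
    _ = _ := by abel

theorem traceNorm_smul (b : HilbertBasis ℕ ℂ H) (c : ℝ) (A : H →L[ℂ] H) :
    traceNorm b (c • A) = ENNReal.ofReal |c| * traceNorm b A := by
  have h : CFC.abs (c • A) = |c| • CFC.abs A := CFC.abs_smul (𝕜 := ℝ) c A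
  rw [traceNorm, traceNorm, h, posTrace, posTrace, ← ENNReal.tsum_mul_left]
  refine tsum_congr fun n => ?_
  rw [← ENNReal.ofReal_mul (abs_nonneg c)]
  congr 1
  rw [smul_apply, inner_smul_right_eq_smul, Complex.real_smul,
    Complex.re_ofReal_mul]

theorem eq_zero_of_basis (b : HilbertBasis ℕ ℂ H) {A : H →L[ℂ] H} (h : ∀ n, A (b n) = 0) :
    A = 0 := by
  refine ContinuousLinearMap.ext_on (s := Set.range b) ?_ ?_
  · exact Submodule.dense_iff_topologicalClosure_eq_top.2 b.dense_span
  · rintro _ ⟨n, rfl⟩; simpa using h n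

theorem eq_zero_of_traceNorm (b : HilbertBasis ℕ ℂ H) {A : H →L[ℂ] H} (h : traceNorm b A = 0) :
    A = 0 := by
  rw [traceNorm, posTrace_eq_hsSq b _ (CFC.abs_nonneg A), hsSq, ENNReal.tsum_eq_zero] at h
  have h0 : CFC.sqrt (CFC.abs A) = 0 := eq_zero_of_basis b fun n => by simpa using h n
  have h1 : CFC.abs A = 0 := by
    rw [← CFC.sqrt_mul_sqrt_self (CFC.abs A) (CFC.abs_nonneg A), h0, zero_mul]
  exact CFC.abs_eq_zero_iff.1 h1

end TraceNorm
section Sobolev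
variable {H : Type*} [NormedAddCommGroup H] [InnerProductSpace ℂ H] [CompleteSpace H]

/-- The space `T_{1,sa}` of self-adjoint trace-class operators. -/
def traceClassSA (b : HilbertBasis ℕ ℂ H) : Submodule ℝ (H →L[ℂ] H) where
  carrier := {A | IsSelfAdjoint A ∧ traceNorm b A ≠ ⊤}
  zero_mem' := ⟨IsSelfAdjoint.zero _, by simp [traceNorm, posTrace]⟩
  add_mem' := fun {A B} hA hB => ⟨hA.1.add hB.1,
    ne_top_of_le_ne_top (ENNReal.add_ne_top.2 ⟨hA.2, hB.2⟩) (traceNorm_add_le b hA.1 hB.1)⟩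
  smul_mem' := fun c A hA => ⟨(IsSelfAdjoint.all c).smul hA.1, by
    rw [traceNorm_smul]; exact ENNReal.mul_ne_top ENNReal.ofReal_ne_top hA.2⟩

theorem numWeight_memℓp (s : ℝ≥0) (f : lp (fun _ : ℕ => ℂ) 2) :
    Memℓp (fun n : ℕ => (((n + 1 : ℝ) ^ (-(s : ℝ)) : ℝ) : ℂ) * f n) 2 := by
  have hf := (memℓp_gen_iff (p := 2) (by simp)).1 (lp.memℓp f)
  refine (memℓp_gen_iff (p := 2) (by simp)).2 (hf.of_nonneg_of_le (fun n => by positivity) ?_)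
  intro n
  gcongr
  rw [norm_mul]
  refine mul_le_of_le_one_left (norm_nonneg _) ?_
  rw [Complex.norm_real, Real.norm_of_nonneg (by positivity)]
  exact Real.rpow_le_one_of_one_le_of_nonpos (by simp) (by simp)

theorem numWeight_norm_le (s : ℝ≥0) (f : lp (fun _ : ℕ => ℂ) 2) :
    ‖(⟨_, numWeight_memℓp s f⟩ : lp (fun _ : ℕ => ℂ) 2)‖ ≤ ‖f‖ := by
  have h2 : (0 : ℝ) < (2 : ℝ≥0∞).toReal := by simp
  have h2' : (2 : ℝ≥0∞) ≠ 0 := by simp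
  refine lp.norm_le_of_forall_sum_le h2 (norm_nonneg _) fun t => ?_
  refine le_trans (Finset.sum_le_sum fun n _ => ?_) (lp.sum_rpow_le_norm_rpow h2 f t)
  gcongr
  change ‖(((n + 1 : ℝ) ^ (-(s : ℝ)) : ℝ) : ℂ) * f n‖ ≤ ‖f n‖
  rw [norm_mul]
  refine mul_le_of_le_one_left (norm_nonneg _) ?_
  rw [Complex.norm_real, Real.norm_of_nonneg (by positivity)]
  exact Real.rpow_le_one_of_one_le_of_nonpos (by simp) (by simp)

/-- The bounded operator `(N + 1)^(-s)`, `s ≥ 0`, that is `|n⟩ ↦ (n + 1)^(-s) |n⟩`, as the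
multiplication by `(n + 1)^(-s)` of the coordinates in the Fock basis. -/
def numInvPow (b : HilbertBasis ℕ ℂ H) (s : ℝ≥0) : H →L[ℂ] H :=
  LinearMap.mkContinuous
    { toFun := fun v => b.repr.symm ⟨_, numWeight_memℓp s (b.repr v)⟩
      map_add' := fun v w => by
        rw [← map_add]
        congr 1
        ext n
        exact (congrArg (_ * ·) (congrFun (congrArg _ (map_add b.repr v w)) n)).trans (mul_add _ _ _)
      map_smul' := fun c v => by
        rw [RingHom.id_apply, ← map_smul]
        congr 1
        ext n
        simp [mul_left_comm] }
    1 fun v => by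
      rw [one_mul]
      change ‖b.repr.symm _‖ ≤ ‖v‖
      rw [LinearIsometryEquiv.norm_map, ← b.repr.norm_map v]
      exact numWeight_norm_le s _

theorem repr_numInvPow (b : HilbertBasis ℕ ℂ H) (s : ℝ≥0) (v : H) (n : ℕ) :
    b.repr (numInvPow b s v) n = (((n + 1 : ℝ) ^ (-(s : ℝ)) : ℝ) : ℂ) * b.repr v n := by
  change b.repr (b.repr.symm _) n = _
  rw [LinearIsometryEquiv.apply_symm_apply]

theorem weight_ne_zero (s : ℝ) (n : ℕ) : (((n + 1 : ℝ) ^ s : ℝ) : ℂ) ≠ 0 := by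
  exact_mod_cast (Real.rpow_pos_of_pos (by positivity) _).ne'

theorem numInvPow_basis (b : HilbertBasis ℕ ℂ H) (s : ℝ≥0) (n : ℕ) :
    numInvPow b s (b n) = (((n + 1 : ℝ) ^ (-(s : ℝ)) : ℝ) : ℂ) • b n := by
  apply b.repr.injective
  ext m
  rw [repr_numInvPow, map_smul, lp.coeFn_smul, Pi.smul_apply, b.repr_self, lp.single_apply,
    smul_eq_mul]
  rcases eq_or_ne m n with rfl | h
  · rfl
  · simp [Pi.single_eq_of_ne h]

theorem numInvPow_eq_zero (b : HilbertBasis ℕ ℂ H) (s : ℝ≥0) {v : H}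
    (h : numInvPow b s v = 0) : v = 0 := by
  apply b.repr.injective
  ext n
  have h1 := repr_numInvPow b s v n
  rw [h, map_zero] at h1
  have h2 := (mul_eq_zero.1 h1.symm).resolve_left (weight_ne_zero _ n)
  rw [map_zero]
  exact h2

/-- The map `(𝒲^k)⁻¹ : y ↦ (N + 1)^(-k/4) y (N + 1)^(-k/4)`. -/
def weightInv (b : HilbertBasis ℕ ℂ H) (k : ℝ≥0) : (H →L[ℂ] H) →ₗ[ℝ] (H →L[ℂ] H) where
  toFun y := numInvPow b (k / 4) ∘L y ∘L numInvPow b (k / 4)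
  map_add' y z := by ext v; simp
  map_smul' c y := by
    ext v
    simp only [ContinuousLinearMap.comp_apply, smul_apply, RingHom.id_apply]
    exact ((numInvPow b (k / 4)).restrictScalars ℝ).map_smul c _

theorem weightInv_injective (b : HilbertBasis ℕ ℂ H) (k : ℝ≥0) :
    Function.Injective (weightInv b k) := by
  rw [injective_iff_map_eq_zero]
  intro y hy
  refine eq_zero_of_basis b fun n => ?_
  have h1 : numInvPow b (k / 4) (y (numInvPow b (k / 4) (b n))) = 0 :=
    congrArg (fun f : H →L[ℂ] H => f (b n)) hy
  have h2 := numInvPow_eq_zero b _ h1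
  rw [numInvPow_basis, map_smul] at h2
  exact (smul_eq_zero.1 h2).resolve_left (weight_ne_zero _ n)

/-- The domain `D(𝒲^k) = (𝒲^k)⁻¹(T_{1,sa})`. -/
def sobolevSubmodule (b : HilbertBasis ℕ ℂ H) (k : ℝ≥0) : Submodule ℝ (H →L[ℂ] H) :=
  (traceClassSA b).map (weightInv b k)

/-- The bosonic Sobolev space `W^{k,1}`: the vector space `D(𝒲^k)`, to be normed by
`‖x‖_{W^{k,1}} = ‖𝒲^k x‖₁`. For `k = 0` it is `T_{1,sa}` with the trace norm. -/
def Sobolev (b : HilbertBasis ℕ ℂ H) (k : ℝ≥0) : Type _ := ↥(sobolevSubmodule b k)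

instance (b : HilbertBasis ℕ ℂ H) (k : ℝ≥0) : AddCommGroup (Sobolev b k) :=
  inferInstanceAs (AddCommGroup ↥(sobolevSubmodule b k))

instance (b : HilbertBasis ℕ ℂ H) (k : ℝ≥0) : Module ℝ (Sobolev b k) :=
  inferInstanceAs (Module ℝ ↥(sobolevSubmodule b k))

/-- An element of `W^{k,1}`, seen as a bounded operator on `H`. -/
def Sobolev.op {b : HilbertBasis ℕ ℂ H} {k : ℝ≥0} : Sobolev b k →ₗ[ℝ] (H →L[ℂ] H) :=
  (sobolevSubmodule b k).subtype

/-- The bijection `𝒲^k : W^{k,1} → T_{1,sa}`, `x ↦ (N + 1)^(k/4) x (N + 1)^(k/4)`,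
as the inverse of `weightInv`. -/
def Sobolev.weight (b : HilbertBasis ℕ ℂ H) (k : ℝ≥0) : Sobolev b k ≃ₗ[ℝ] traceClassSA b :=
  (Submodule.equivMapOfInjective (weightInv b k) (weightInv_injective b k)
    (traceClassSA b)).symm

instance (b : HilbertBasis ℕ ℂ H) (k : ℝ≥0) : Norm (Sobolev b k) :=
  ⟨fun x => (traceNorm b (Sobolev.weight b k x : H →L[ℂ] H)).toReal⟩

theorem Sobolev.norm_def {b : HilbertBasis ℕ ℂ H} {k : ℝ≥0} (x : Sobolev b k) :
    ‖x‖ = (traceNorm b (Sobolev.weight b k x : H →L[ℂ] H)).toReal := rfl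

theorem Sobolev.weightInv_weight {b : HilbertBasis ℕ ℂ H} {k : ℝ≥0} (x : Sobolev b k) :
    weightInv b k (Sobolev.weight b k x : H →L[ℂ] H) = x.op :=
  congrArg Subtype.val ((Submodule.equivMapOfInjective (weightInv b k) (weightInv_injective b k)
    (traceClassSA b)).apply_symm_apply x)

theorem Sobolev.norm_smul' {b : HilbertBasis ℕ ℂ H} {k : ℝ≥0} (c : ℝ) (x : Sobolev b k) :
    ‖c • x‖ = |c| * ‖x‖ := by
  rw [norm_def, norm_def, map_smul, Submodule.coe_smul, traceNorm_smul, ENNReal.toReal_mul,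
    ENNReal.toReal_ofReal (abs_nonneg c)]

/-- The norm of `W^{k,1}` is a norm. -/
def Sobolev.groupNorm (b : HilbertBasis ℕ ℂ H) (k : ℝ≥0) : AddGroupNorm (Sobolev b k) where
  toFun x := ‖x‖
  map_zero' := by simpa using Sobolev.norm_smul' (0 : ℝ) (0 : Sobolev b k)
  neg' x := by simpa using Sobolev.norm_smul' (-1 : ℝ) x
  add_le' x y := by
    have hx := (Sobolev.weight b k x).2
    have hy := (Sobolev.weight b k y).2
    rw [Sobolev.norm_def, Sobolev.norm_def, Sobolev.norm_def, map_add, Submodule.coe_add,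
      ← ENNReal.toReal_add hx.2 hy.2]
    exact ENNReal.toReal_mono (ENNReal.add_ne_top.2 ⟨hx.2, hy.2⟩) (traceNorm_add_le b hx.1 hy.1)
  eq_zero_of_map_eq_zero' x hx := by
    have h := ((ENNReal.toReal_eq_zero_iff _).1 hx).resolve_right (Sobolev.weight b k x).2.2
    exact (Sobolev.weight b k).map_eq_zero_iff.1 (Subtype.ext (eq_zero_of_traceNorm b h))

instance (b : HilbertBasis ℕ ℂ H) (k : ℝ≥0) : NormedAddCommGroup (Sobolev b k) :=
  (Sobolev.groupNorm b k).toNormedAddCommGroup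

instance (b : HilbertBasis ℕ ℂ H) (k : ℝ≥0) : NormedSpace ℝ (Sobolev b k) where
  norm_smul_le c x := (Sobolev.norm_smul' c x).le

end Sobolev

section Ladder
variable {H : Type*} [NormedAddCommGroup H] [InnerProductSpace ℂ H] [CompleteSpace H]

/-- The space `H_f` of vectors with finite support in the Fock basis `b`. -/
abbrev finVec (b : HilbertBasis ℕ ℂ H) : Submodule ℂ H := Submodule.span ℂ (Set.range b)

/-- The Fock basis `|n⟩ = b n`, as an algebraic basis of `H_f`. -/
def fock (b : HilbertBasis ℕ ℂ H) : Module.Basis ℕ ℂ (finVec b) :=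
  Module.Basis.span b.orthonormal.linearIndependent

theorem coe_fock (b : HilbertBasis ℕ ℂ H) (n : ℕ) : (fock b n : H) = b n :=
  congrArg Subtype.val (Module.Basis.span_apply b.orthonormal.linearIndependent n)

theorem fock_induction (b : HilbertBasis ℕ ℂ H) {p : finVec b → Prop} (u : finVec b)
    (basis : ∀ n, p (fock b n)) (zero : p 0) (add : ∀ u v, p u → p v → p (u + v))
    (smul : ∀ (c : ℂ) u, p u → p (c • u)) : p u := by
  obtain ⟨u, hu⟩ := u
  induction hu using Submodule.span_induction with
  | mem x hx =>
    obtain ⟨n, rfl⟩ := hx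
    have h := basis n
    have e : fock b n = ⟨b n, Submodule.subset_span ⟨n, rfl⟩⟩ := Subtype.ext (coe_fock b n)
    rwa [e] at h
  | zero => exact zero
  | add x y hx hy ihx ihy => exact add _ _ ihx ihy
  | smul c x hx ih => exact smul c _ ih

/-- The annihilation operator on `H_f`: `a |n⟩ = √n |n - 1⟩`, in particular `a |0⟩ = 0`. -/
def annihilation (b : HilbertBasis ℕ ℂ H) : Module.End ℂ (finVec b) :=
  (fock b).constr ℂ fun n => ((√(n : ℝ) : ℝ) : ℂ) • fock b (n - 1)

/-- The creation operator on `H_f`: `a† |n⟩ = √(n + 1) |n + 1⟩`. -/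
def creation (b : HilbertBasis ℕ ℂ H) : Module.End ℂ (finVec b) :=
  (fock b).constr ℂ fun n => ((√((n : ℝ) + 1) : ℝ) : ℂ) • fock b (n + 1)

/-- The operator `(N + 1)^s` on `H_f`: `|n⟩ ↦ (n + 1)^s |n⟩`. -/
def numPow (b : HilbertBasis ℕ ℂ H) (s : ℝ) : Module.End ℂ (finVec b) :=
  (fock b).constr ℂ fun n => (((n + 1 : ℝ) ^ s : ℝ) : ℂ) • fock b n

/-- The operator `p(a, a†)` on `H_f`, for a polynomial `p` in two non-commuting variables. -/
def ladderPoly (b : HilbertBasis ℕ ℂ H) (p : FreeAlgebra ℂ (Fin 2)) : Module.End ℂ (finVec b) :=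
  FreeAlgebra.lift ℂ ![annihilation b, creation b] p

/-- `B` is a formal adjoint of `A` on `H_f`. -/
def IsFormalAdjoint (b : HilbertBasis ℕ ℂ H) (A B : Module.End ℂ (finVec b)) : Prop :=
  ∀ u v : finVec b, ⟪A u, v⟫_ℂ = ⟪u, B v⟫_ℂ

open Classical in
/-- The formal adjoint `A†` of `A` on `H_f`; it exists for polynomials of `a` and `a†`, by
`isFormalAdjoint_ladderPoly`, and is unique. -/
def formalAdjoint (b : HilbertBasis ℕ ℂ H) (A : Module.End ℂ (finVec b)) :
    Module.End ℂ (finVec b) :=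
  if h : ∃ B, IsFormalAdjoint b A B then h.choose else 0

theorem isFormalAdjoint_of_fock (b : HilbertBasis ℕ ℂ H) {A B : Module.End ℂ (finVec b)}
    (h : ∀ n m, ⟪A (fock b n), fock b m⟫_ℂ = ⟪fock b n, B (fock b m)⟫_ℂ) :
    IsFormalAdjoint b A B := by
  intro u v
  induction u using fock_induction b with
  | zero => simp
  | add u u' hu hu' => rw [map_add, inner_add_left, inner_add_left, hu, hu']
  | smul c u hu => rw [map_smul, inner_smul_left, inner_smul_left, hu]
  | basis n =>
    induction v using fock_induction b with
    | zero => simp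
    | add v v' hv hv' => rw [map_add, inner_add_right, inner_add_right, hv, hv']
    | smul c v hv => rw [map_smul, inner_smul_right, inner_smul_right, hv]
    | basis m => exact h n m

theorem IsFormalAdjoint.symm {b : HilbertBasis ℕ ℂ H} {A B : Module.End ℂ (finVec b)}
    (h : IsFormalAdjoint b A B) : IsFormalAdjoint b B A := fun u v => by
  rw [← inner_conj_symm, ← h v u, inner_conj_symm]

theorem inner_fock (b : HilbertBasis ℕ ℂ H) (n m : ℕ) :
    ⟪fock b n, fock b m⟫_ℂ = if n = m then 1 else 0 := by
  rw [Submodule.coe_inner, coe_fock, coe_fock]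
  exact orthonormal_iff_ite.1 b.orthonormal n m

theorem isFormalAdjoint_annihilation (b : HilbertBasis ℕ ℂ H) :
    IsFormalAdjoint b (annihilation b) (creation b) := by
  refine isFormalAdjoint_of_fock b fun n m => ?_
  simp only [annihilation, creation, Module.Basis.constr_basis, inner_smul_left, inner_smul_right,
    inner_fock, Complex.conj_ofReal]
  rcases n with _ | n
  · simp
  · by_cases h : n = m
    · subst h; simp
    · simp [h]

theorem exists_isFormalAdjoint_ladderPoly (b : HilbertBasis ℕ ℂ H) (p : FreeAlgebra ℂ (Fin 2)) :
    ∃ B, IsFormalAdjoint b (ladderPoly b p) B := by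
  induction p using FreeAlgebra.induction with
  | grade0 c =>
    refine ⟨(starRingEnd ℂ c) • 1, fun u v => ?_⟩
    simp [ladderPoly, Module.algebraMap_end_apply, mul_comm]
  | grade1 i =>
    fin_cases i
    · exact ⟨creation b, by simpa [ladderPoly] using isFormalAdjoint_annihilation b⟩
    · exact ⟨annihilation b, by simpa [ladderPoly] using (isFormalAdjoint_annihilation b).symm⟩
  | mul p q hp hq =>
    obtain ⟨B, hB⟩ := hp
    obtain ⟨C, hC⟩ := hq
    refine ⟨C * B, fun u v => ?_⟩
    simp only [ladderPoly, map_mul] at *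
    rw [Module.End.mul_apply, Module.End.mul_apply, hB, hC]
  | add p q hp hq =>
    obtain ⟨B, hB⟩ := hp
    obtain ⟨C, hC⟩ := hq
    refine ⟨B + C, fun u v => ?_⟩
    simp only [ladderPoly, map_add] at *
    rw [LinearMap.add_apply, LinearMap.add_apply, inner_add_left, inner_add_right, hB, hC]

theorem isFormalAdjoint_ladderPoly (b : HilbertBasis ℕ ℂ H) (p : FreeAlgebra ℂ (Fin 2)) :
    IsFormalAdjoint b (ladderPoly b p) (formalAdjoint b (ladderPoly b p)) := by
  have h := exists_isFormalAdjoint_ladderPoly b p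
  rw [formalAdjoint, dif_pos h]
  exact h.choose_spec

end Ladder

section FiniteRank
variable {H : Type*} [NormedAddCommGroup H] [InnerProductSpace ℂ H] [CompleteSpace H]

/-- The finite complex linear combinations of the operators `|n⟩⟨m|`. -/
def finOp (b : HilbertBasis ℕ ℂ H) : Submodule ℂ (H →L[ℂ] H) :=
  Submodule.span ℂ (Set.range fun p : ℕ × ℕ => InnerProductSpace.rankOne ℂ (b p.1) (b p.2))

/-- The real vector space `T_f` of self-adjoint operators that are finite linear combinations of
the operators `|n⟩⟨m|`. -/
def finOpSA (b : HilbertBasis ℕ ℂ H) : Submodule ℝ (H →L[ℂ] H) where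
  carrier := {x | IsSelfAdjoint x ∧ x ∈ finOp b}
  zero_mem' := ⟨IsSelfAdjoint.zero _, zero_mem _⟩
  add_mem' := fun hx hy => ⟨hx.1.add hy.1, add_mem hx.2 hy.2⟩
  smul_mem' := fun c x hx => ⟨(IsSelfAdjoint.all c).smul hx.1, by
    simpa using (finOp b).smul_mem (c : ℂ) hx.2⟩

theorem finOp_apply_mem (b : HilbertBasis ℕ ℂ H) {x : H →L[ℂ] H} (hx : x ∈ finOp b) (v : H) :
    x v ∈ finVec b := by
  induction hx using Submodule.span_induction with
  | mem x hx =>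
    obtain ⟨p, rfl⟩ := hx
    simp only [InnerProductSpace.rankOne_apply]
    exact Submodule.smul_mem _ _ (Submodule.subset_span ⟨_, rfl⟩)
  | zero => simp
  | add x y _ _ hx hy => exact add_mem hx hy
  | smul c x _ hx => exact Submodule.smul_mem _ _ hx

/-- An operator of `T_f`, as a linear map from `H_f` to itself. -/
def toEnd {b : HilbertBasis ℕ ℂ H} (x : finOpSA b) : Module.End ℂ (finVec b) :=
  (x : H →L[ℂ] H).toLinearMap.restrict fun v _ => finOp_apply_mem b x.2.2 v

theorem coe_toEnd {b : HilbertBasis ℕ ℂ H} (x : finOpSA b) (v : finVec b) :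
    (toEnd x v : H) = (x : H →L[ℂ] H) v := rfl

theorem toEnd_injective {b : HilbertBasis ℕ ℂ H} :
    Function.Injective (toEnd (b := b)) := by
  intro x y h
  refine Subtype.ext (sub_eq_zero.1 (eq_zero_of_basis b fun n => ?_))
  have := congrArg Subtype.val (congrArg (fun f : Module.End ℂ (finVec b) => f (fock b n)) h)
  rw [coe_toEnd, coe_toEnd, coe_fock] at this
  rw [sub_apply, this, sub_self]

/-- `F` is the restriction to `H_f` of a finite linear combination of the `|n⟩⟨m|`. -/
def IsFin (b : HilbertBasis ℕ ℂ H) (F : Module.End ℂ (finVec b)) : Prop :=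
  ∃ y ∈ finOp b, ∀ v : finVec b, y v = F v

theorem rankOne_mem_finOp (b : HilbertBasis ℕ ℂ H) (u v : finVec b) :
    InnerProductSpace.rankOne ℂ (u : H) (v : H) ∈ finOp b := by
  induction u using fock_induction b with
  | zero => simp
  | add u u' hu hu' => simpa using add_mem hu hu'
  | smul c u hu => simpa using (finOp b).smul_mem c hu
  | basis n =>
    induction v using fock_induction b with
    | zero => simp
    | add v v' hv hv' => simpa using add_mem hv hv'
    | smul c v hv => simpa using (finOp b).smul_mem (starRingEnd ℂ c) hv
    | basis m =>
      rw [coe_fock, coe_fock]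
      exact Submodule.subset_span ⟨(n, m), rfl⟩

theorem IsFin.add {b : HilbertBasis ℕ ℂ H} {F G : Module.End ℂ (finVec b)} (hF : IsFin b F)
    (hG : IsFin b G) : IsFin b (F + G) := by
  obtain ⟨y, hy, h⟩ := hF
  obtain ⟨z, hz, h'⟩ := hG
  exact ⟨y + z, add_mem hy hz, fun v => by simp [h, h']⟩

theorem IsFin.smul {b : HilbertBasis ℕ ℂ H} {F : Module.End ℂ (finVec b)} (c : ℂ)
    (hF : IsFin b F) : IsFin b (c • F) := by
  obtain ⟨y, hy, h⟩ := hF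
  exact ⟨c • y, Submodule.smul_mem _ _ hy, fun v => by simp [h]⟩

theorem IsFin.zero (b : HilbertBasis ℕ ℂ H) : IsFin b 0 := ⟨0, zero_mem _, fun v => by simp⟩

theorem IsFin.mul_left {b : HilbertBasis ℕ ℂ H} {F : Module.End ℂ (finVec b)}
    (A : Module.End ℂ (finVec b)) (hF : IsFin b F) : IsFin b (A * F) := by
  obtain ⟨y, hy, h⟩ := hF
  suffices ∃ z ∈ finOp b, ∀ v : finVec b, z v = A ⟨y v, finOp_apply_mem b hy v⟩ by
    obtain ⟨z, hz, hzv⟩ := this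
    refine ⟨z, hz, fun v => ?_⟩
    rw [hzv, Module.End.mul_apply]
    congr 2
    exact Subtype.ext (h v)
  clear h
  induction hy using Submodule.span_induction with
  | mem y hy =>
    obtain ⟨p, rfl⟩ := hy
    refine ⟨InnerProductSpace.rankOne ℂ (A (fock b p.1) : H) (fock b p.2 : H),
      rankOne_mem_finOp b _ _, fun v => ?_⟩
    rw [InnerProductSpace.rankOne_apply, ← Submodule.coe_smul, ← map_smul]
    congr 2
    apply Subtype.ext
    simp [coe_fock]
  | zero => exact ⟨0, zero_mem _, fun v => by
      have : (⟨(0 : H →L[ℂ] H) v, finOp_apply_mem b (zero_mem _) v⟩ : finVec b) = 0 := rfl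
      rw [this, map_zero]
      rfl⟩
  | add x y hx hy ihx ihy =>
    obtain ⟨z, hz, hzv⟩ := ihx
    obtain ⟨w, hw, hwv⟩ := ihy
    refine ⟨z + w, add_mem hz hw, fun v => ?_⟩
    rw [add_apply, hzv, hwv, ← Submodule.coe_add, ← map_add]
    rfl
  | smul c x hx ihx =>
    obtain ⟨z, hz, hzv⟩ := ihx
    refine ⟨c • z, Submodule.smul_mem _ _ hz, fun v => ?_⟩
    rw [smul_apply, hzv, ← Submodule.coe_smul, ← map_smul]
    rfl

theorem IsFin.mul_right {b : HilbertBasis ℕ ℂ H} {F A B : Module.End ℂ (finVec b)}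
    (hAB : IsFormalAdjoint b A B) (hF : IsFin b F) : IsFin b (F * A) := by
  obtain ⟨y, hy, h⟩ := hF
  suffices ∃ z ∈ finOp b, ∀ v : finVec b, z v = y (A v) by
    obtain ⟨z, hz, hzv⟩ := this
    exact ⟨z, hz, fun v => by rw [hzv, Module.End.mul_apply, h]⟩
  clear h
  induction hy using Submodule.span_induction with
  | mem y hy =>
    obtain ⟨p, rfl⟩ := hy
    refine ⟨InnerProductSpace.rankOne ℂ (fock b p.1 : H) (B (fock b p.2) : H),
      rankOne_mem_finOp b _ _, fun v => ?_⟩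
    rw [InnerProductSpace.rankOne_apply, InnerProductSpace.rankOne_apply, ← coe_fock, ← coe_fock]
    congr 1
    exact hAB.symm _ _
  | zero => exact ⟨0, zero_mem _, fun v => by simp⟩
  | add x y hx hy ihx ihy =>
    obtain ⟨z, hz, hzv⟩ := ihx
    obtain ⟨w, hw, hwv⟩ := ihy
    exact ⟨z + w, add_mem hz hw, fun v => by simp [hzv, hwv]⟩
  | smul c x hx ihx =>
    obtain ⟨z, hz, hzv⟩ := ihx
    exact ⟨c • z, Submodule.smul_mem _ _ hz, fun v => by simp [hzv]⟩

theorem isFin_toEnd {b : HilbertBasis ℕ ℂ H} (x : finOpSA b) : IsFin b (toEnd x) :=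
  ⟨x, x.2.2, fun _ => rfl⟩

theorem isFormalAdjoint_toEnd {b : HilbertBasis ℕ ℂ H} (x : finOpSA b) :
    IsFormalAdjoint b (toEnd x) (toEnd x) := fun u v => by
  rw [Submodule.coe_inner, Submodule.coe_inner, coe_toEnd, coe_toEnd]
  exact (ContinuousLinearMap.isSelfAdjoint_iff_isSymmetric.1 x.2.1) u v

theorem exists_toEnd_eq {b : HilbertBasis ℕ ℂ H} {F : Module.End ℂ (finVec b)} (hF : IsFin b F)
    (hs : IsFormalAdjoint b F F) : ∃ x : finOpSA b, (toEnd x) = F := by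
  obtain ⟨y, hy, h⟩ := hF
  have hsa : IsSelfAdjoint y := by
    rw [IsSelfAdjoint, ← sub_eq_zero]
    refine eq_zero_of_basis b fun n => ?_
    apply b.repr.injective
    ext m
    rw [map_zero, b.repr_apply_apply, sub_apply, inner_sub_right,
      ContinuousLinearMap.star_eq_adjoint, ContinuousLinearMap.adjoint_inner_right, ← coe_fock,
      ← coe_fock, h, h, ← Submodule.coe_inner, ← Submodule.coe_inner, hs, sub_self]
    rfl
  exact ⟨⟨y, hsa, hy⟩, LinearMap.ext fun v => Subtype.ext (h v)⟩

/-- The trace `∑ₙ ⟨n|F|n⟩` of a linear map on `H_f`. -/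
def endTrace (b : HilbertBasis ℕ ℂ H) (F : Module.End ℂ (finVec b)) : ℂ :=
  ∑' n, ⟪fock b n, F (fock b n)⟫_ℂ

/-- The moment `tr [x (N + 1)^s]`, a finite sum, of an operator `x` of `T_f`. It is real; its real
part is taken in order to compare moments. -/
def moment (b : HilbertBasis ℕ ℂ H) (s : ℝ) (x : finOpSA b) : ℝ :=
  (endTrace b ((toEnd x) * numPow b s)).re

end FiniteRank

section Generator
variable {H : Type*} [NormedAddCommGroup H] [InnerProductSpace ℂ H] [CompleteSpace H]

/-- The data of a generator in GKSL form: a symmetric Hamiltonian and finitely many jump operators,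
polynomials of `a` and `a†`. -/
structure GKSL (b : HilbertBasis ℕ ℂ H) where
  /-- the polynomial of the Hamiltonian -/
  hamPoly : FreeAlgebra ℂ (Fin 2)
  /-- the number of jump operators -/
  numJumps : ℕ
  /-- the polynomials of the jump operators -/
  jumpPoly : Fin numJumps → FreeAlgebra ℂ (Fin 2)
  /-- the Hamiltonian is symmetric -/
  symmetric : (ladderPoly b hamPoly).IsSymmetric

namespace GKSL
variable {b : HilbertBasis ℕ ℂ H} (𝓛 : GKSL b)

/-- The Hamiltonian on `H_f`. -/
def ham : Module.End ℂ (finVec b) := ladderPoly b 𝓛.hamPoly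

/-- The jump operators on `H_f`. -/
def jump (j : Fin 𝓛.numJumps) : Module.End ℂ (finVec b) := ladderPoly b (𝓛.jumpPoly j)

/-- The adjoint jump operators on `H_f`. -/
def jumpAdj (j : Fin 𝓛.numJumps) : Module.End ℂ (finVec b) := formalAdjoint b (𝓛.jump j)

/-- The expression `-i[H, X] + ∑ⱼ (Lⱼ X Lⱼ† - ½ {Lⱼ† Lⱼ, X})`, for linear maps on `H_f`. -/
def lindblad (X : Module.End ℂ (finVec b)) : Module.End ℂ (finVec b) :=
  -(Complex.I • (𝓛.ham * X - X * 𝓛.ham)) +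
    ∑ j, (𝓛.jump j * X * 𝓛.jumpAdj j
      - (1 / 2 : ℂ) • (𝓛.jumpAdj j * 𝓛.jump j * X + X * (𝓛.jumpAdj j * 𝓛.jump j)))

theorem ham_adj : IsFormalAdjoint b 𝓛.ham 𝓛.ham := 𝓛.symmetric

theorem jump_adj (j) : IsFormalAdjoint b (𝓛.jump j) (𝓛.jumpAdj j) :=
  isFormalAdjoint_ladderPoly b _

theorem exists_lindblad (x : finOpSA b) : ∃ y : finOpSA b, (toEnd y) = 𝓛.lindblad (toEnd x) := by
  have hx := isFin_toEnd x
  have hxs := isFormalAdjoint_toEnd x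
  have hLL : ∀ j, IsFormalAdjoint b (𝓛.jumpAdj j * 𝓛.jump j) (𝓛.jumpAdj j * 𝓛.jump j) :=
    fun j u v => by
      rw [Module.End.mul_apply, Module.End.mul_apply, (𝓛.jump_adj j).symm, 𝓛.jump_adj j]
  refine exists_toEnd_eq ?_ ?_
  · have hneg : ∀ {F : Module.End ℂ (finVec b)}, IsFin b F → IsFin b (-F) := fun {F} h => by
      have h2 : (-1 : ℂ) • F = -F := LinearMap.ext fun v => by simp
      exact h2 ▸ h.smul (-1)
    have hsub : ∀ {F G}, IsFin b F → IsFin b G → IsFin b (F - G) := fun h h' => by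
      rw [sub_eq_add_neg]; exact h.add (hneg h')
    refine IsFin.add (hneg (IsFin.smul _ (hsub (hx.mul_left _) (hx.mul_right 𝓛.ham_adj)))) ?_
    refine Finset.sum_induction _ (IsFin b) (fun _ _ h h' => h.add h') (IsFin.zero b) fun j _ => ?_
    refine hsub ((hx.mul_left _).mul_right (𝓛.jump_adj j).symm) (IsFin.smul _ ?_)
    exact (hx.mul_left _).add (hx.mul_right (hLL j))
  · intro u v
    simp only [lindblad, LinearMap.add_apply, LinearMap.neg_apply, LinearMap.smul_apply,
      LinearMap.sub_apply, LinearMap.sum_apply, Module.End.mul_apply, inner_add_left,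
      inner_add_right, inner_neg_left, inner_neg_right, inner_smul_left, inner_smul_right,
      inner_sub_left, inner_sub_right, sum_inner, inner_sum, 𝓛.ham_adj _ _, 𝓛.jump_adj _ _ _,
      (𝓛.jump_adj _).symm _ _, hxs _ _, Complex.conj_I, map_div₀, map_one, map_ofNat]
    congr 1
    · ring
    · exact Finset.sum_congr rfl fun j _ => by ring

/-- The generator `𝓛 : T_f → T_f`, `𝓛(x) = -i[H, x] + ∑ⱼ (Lⱼ x Lⱼ† - ½ {Lⱼ† Lⱼ, x})`: the
operator `𝓛(x) ∈ T_f` is the one whose restriction to `H_f` is given by this expression. -/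
def gen : finOpSA b →ₗ[ℝ] finOpSA b where
  toFun x := (𝓛.exists_lindblad x).choose
  map_add' x y := by
    apply toEnd_injective
    rw [(𝓛.exists_lindblad _).choose_spec]
    have h1 := (𝓛.exists_lindblad x).choose_spec
    have h2 := (𝓛.exists_lindblad y).choose_spec
    have key : ∀ x y : finOpSA b, toEnd (x + y) = (toEnd x) + (toEnd y) := fun _ _ => rfl
    rw [key, key, h1, h2]
    simp only [lindblad, mul_add, add_mul, smul_add, smul_sub, Finset.sum_add_distrib,
      Finset.sum_sub_distrib]
    abel
  map_smul' c x := by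
    apply toEnd_injective
    rw [(𝓛.exists_lindblad _).choose_spec]
    have h1 := (𝓛.exists_lindblad x).choose_spec
    have key : ∀ x : finOpSA b, toEnd (c • x) = (c : ℂ) • (toEnd x) := fun _ => rfl
    rw [RingHom.id_apply, key, key, h1]
    simp only [lindblad, mul_smul_comm, smul_mul_assoc, smul_add, smul_sub, smul_neg,
      Finset.smul_sum, smul_comm (c : ℂ)]

theorem toEnd_gen (x : finOpSA b) : toEnd (𝓛.gen x) = 𝓛.lindblad (toEnd x) :=
  (𝓛.exists_lindblad x).choose_spec

end GKSL

theorem inner_numInvPow (b : HilbertBasis ℕ ℂ H) (s : ℝ≥0) (u v : H) :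
    ⟪numInvPow b s u, v⟫_ℂ = ⟪u, numInvPow b s v⟫_ℂ := by
  have hR : star (numInvPow b s) = numInvPow b s := by
    rw [← sub_eq_zero]
    refine eq_zero_of_basis b fun n => ?_
    apply b.repr.injective
    ext m
    rw [map_zero, b.repr_apply_apply, sub_apply, inner_sub_right,
      ContinuousLinearMap.star_eq_adjoint, ContinuousLinearMap.adjoint_inner_right,
      numInvPow_basis, numInvPow_basis, inner_smul_left, inner_smul_right,
      orthonormal_iff_ite.1 b.orthonormal m n, Complex.conj_ofReal]
    by_cases h : m = n
    · subst h; simp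
    · simp [h]
  rw [← ContinuousLinearMap.adjoint_inner_right, ← ContinuousLinearMap.star_eq_adjoint, hR]

theorem star_weightInv (b : HilbertBasis ℕ ℂ H) (k : ℝ≥0) (y : H →L[ℂ] H) :
    star (weightInv b k y) = weightInv b k (star y) := by
  ext v
  refine ext_inner_left ℂ fun u => ?_
  rw [ContinuousLinearMap.star_eq_adjoint, ContinuousLinearMap.adjoint_inner_right]
  change ⟪numInvPow b (k / 4) (y (numInvPow b (k / 4) u)), v⟫_ℂ =
    ⟪u, numInvPow b (k / 4) ((star y) (numInvPow b (k / 4) v))⟫_ℂ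
  rw [inner_numInvPow, ← inner_numInvPow b _ u, ContinuousLinearMap.star_eq_adjoint,
    ContinuousLinearMap.adjoint_inner_right]

theorem weightInv_smul (b : HilbertBasis ℕ ℂ H) (k : ℝ≥0) (c : ℂ) (y : H →L[ℂ] H) :
    weightInv b k (c • y) = c • weightInv b k y := by
  ext v
  exact map_smul (numInvPow b (k / 4)) c _

theorem weightInv_rankOne (b : HilbertBasis ℕ ℂ H) (k : ℝ≥0) (n m : ℕ) :
    ∃ c : ℂ, c ≠ 0 ∧ weightInv b k (InnerProductSpace.rankOne ℂ (b n) (b m)) =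
      c • InnerProductSpace.rankOne ℂ (b n) (b m) := by
  refine ⟨_, mul_ne_zero (weight_ne_zero (-((k / 4 : ℝ≥0) : ℝ)) m)
    (weight_ne_zero (-((k / 4 : ℝ≥0) : ℝ)) n), ?_⟩
  ext v
  change numInvPow b (k / 4) (InnerProductSpace.rankOne ℂ (b n) (b m)
    (numInvPow b (k / 4) v)) = _
  rw [smul_apply, InnerProductSpace.rankOne_apply, InnerProductSpace.rankOne_apply, map_smul,
    numInvPow_basis, ← inner_numInvPow, numInvPow_basis, inner_smul_left, Complex.conj_ofReal,
    smul_smul, smul_smul]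
  congr 1
  ring

theorem exists_weightInv_eq (b : HilbertBasis ℕ ℂ H) (k : ℝ≥0) {x : H →L[ℂ] H}
    (hx : x ∈ finOp b) : ∃ y ∈ finOp b, weightInv b k y = x := by
  induction hx using Submodule.span_induction with
  | mem x hx =>
    obtain ⟨⟨n, m⟩, rfl⟩ := hx
    obtain ⟨c, hc, h⟩ := weightInv_rankOne b k n m
    refine ⟨c⁻¹ • InnerProductSpace.rankOne ℂ (b n) (b m),
      Submodule.smul_mem _ _ (Submodule.subset_span ⟨(n, m), rfl⟩), ?_⟩
    rw [weightInv_smul, h, smul_smul, inv_mul_cancel₀ hc, one_smul]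
  | zero => exact ⟨0, zero_mem _, map_zero _⟩
  | add x y _ _ ihx ihy =>
    obtain ⟨z, hz, rfl⟩ := ihx
    obtain ⟨w, hw, rfl⟩ := ihy
    exact ⟨z + w, add_mem hz hw, map_add _ _ _⟩
  | smul c x _ ihx =>
    obtain ⟨z, hz, rfl⟩ := ihx
    exact ⟨c • z, Submodule.smul_mem _ _ hz, weightInv_smul b k c z⟩

theorem traceNorm_ne_top_of_mem_finOp (b : HilbertBasis ℕ ℂ H) {y : H →L[ℂ] H}
    (hy : y ∈ finOp b) : traceNorm b y ≠ ⊤ := by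
  have h : ∃ M, ∀ n ≥ M, y (b n) = 0 := by
    induction hy using Submodule.span_induction with
    | mem y hy =>
      obtain ⟨⟨k, m⟩, rfl⟩ := hy
      refine ⟨m + 1, fun n hn => ?_⟩
      rw [InnerProductSpace.rankOne_apply, orthonormal_iff_ite.1 b.orthonormal m n,
        if_neg (by omega), zero_smul]
    | zero => exact ⟨0, fun _ _ => rfl⟩
    | add x y _ _ ihx ihy =>
      obtain ⟨M, hM⟩ := ihx
      obtain ⟨M', hM'⟩ := ihy
      exact ⟨max M M', fun n hn => by
        rw [add_apply, hM n (le_trans (le_max_left _ _) hn),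
          hM' n (le_trans (le_max_right _ _) hn), add_zero]⟩
    | smul c x _ ihx =>
      obtain ⟨M, hM⟩ := ihx
      exact ⟨M, fun n hn => by rw [smul_apply, hM n hn, smul_zero]⟩
  obtain ⟨M, hM⟩ := h
  have habs : ∀ n ≥ M, CFC.abs y (b n) = 0 := fun n hn => by
    have hs : IsSelfAdjoint (CFC.abs y) := IsSelfAdjoint.of_nonneg (CFC.abs_nonneg y)
    have h1 : ⟪CFC.abs y (b n), CFC.abs y (b n)⟫_ℂ = 0 := by
      rw [← ContinuousLinearMap.adjoint_inner_right, ← ContinuousLinearMap.star_eq_adjoint,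
        hs.star_eq, ← mul_apply_eq_comp, CFC.abs_mul_abs, mul_apply_eq_comp, hM n hn]
      simp
    exact inner_self_eq_zero.1 h1
  rw [traceNorm, posTrace, tsum_eq_sum (s := Finset.range M) fun n hn => by
    rw [habs n (by simpa using hn)]; simp]
  exact ENNReal.sum_ne_top.2 fun _ _ => ENNReal.ofReal_ne_top

theorem finOpSA_le_sobolev (b : HilbertBasis ℕ ℂ H) (k : ℝ≥0) :
    finOpSA b ≤ sobolevSubmodule b k := by
  rintro x ⟨hs, hx⟩
  obtain ⟨y, hy, rfl⟩ := exists_weightInv_eq b k hx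
  refine ⟨y, ⟨?_, traceNorm_ne_top_of_mem_finOp b hy⟩, rfl⟩
  have h : star (weightInv b k y) = weightInv b k y := hs
  rw [star_weightInv] at h
  exact weightInv_injective b k h

/-- The operator `(𝓛, T_f)`, as an unbounded, densely defined operator on `W^{k,1}`. -/
def GKSL.onSobolev {b : HilbertBasis ℕ ℂ H} (𝓛 : GKSL b) (k : ℝ≥0) :
    Sobolev b k →ₗ.[ℝ] Sobolev b k where
  domain := (finOpSA b).comap Sobolev.op
  toFun := (Submodule.inclusion (finOpSA_le_sobolev b k)) ∘ₗ 𝓛.gen ∘ₗ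
    (Sobolev.op.restrict (p := (finOpSA b).comap Sobolev.op) (q := finOpSA b) fun _ hx => hx)

theorem GKSL.op_onSobolev {b : HilbertBasis ℕ ℂ H} (𝓛 : GKSL b) (k : ℝ≥0)
    (x : (𝓛.onSobolev k).domain) :
    (𝓛.onSobolev k x).op = 𝓛.gen ⟨Sobolev.op x.1, x.2⟩ := rfl

/-- The trace `∑ₙ ⟨n|A|n⟩` of a trace-class operator. -/
def opTrace (b : HilbertBasis ℕ ℂ H) (A : H →L[ℂ] H) : ℂ := ∑' n, ⟪b n, A (b n)⟫_ℂ

end Generator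

section Semigroup
variable {E : Type*} [NormedAddCommGroup E] [NormedSpace ℝ E]

/-- Strongly continuous one-parameter semigroups of bounded operators. -/
structure IsC0Semigroup (P : ℝ≥0 → E →L[ℝ] E) : Prop where
  map_zero : P 0 = ContinuousLinearMap.id ℝ E
  map_add : ∀ s t, P (s + t) = P s ∘L P t
  tendsto_zero : ∀ x, Filter.Tendsto (fun t => P t x) (nhds 0) (nhds x)

/-- `A` is the generator of `P`: `x ∈ D(A)` and `A x = y` if and only if
`(P t x - x) / t → y` as `t → 0+`. -/
def IsGenerator (A : E →ₗ.[ℝ] E) (P : ℝ≥0 → E →L[ℝ] E) : Prop :=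
  ∀ x y, (x, y) ∈ A.graph ↔
    Filter.Tendsto (fun t : ℝ≥0 => (t : ℝ)⁻¹ • (P t x - x)) (nhdsWithin 0 (Set.Ioi 0)) (nhds y)

end Semigroup

/-- The linear interpolation at `k` between the values `ω₀` at `k₀` and `ω₁` at `k₁`. -/
def interpRate (k₀ ω₀ k₁ ω₁ k : ℝ) : ℝ :=
  (k₁ - k) / (k₁ - k₀) * ω₀ + (k - k₀) / (k₁ - k₀) * ω₁

end
end Bosonic

open Bosonic Filter

open scoped InnerProductSpace ENNReal NNReal
open Filter Topology

namespace Bosonic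
noncomputable section
set_option linter.unusedSectionVars false


/-! By the Lumer-Phillips theorem it is enough, on each W^{k,1}, to bound `c - 𝓛` from below on
`T_f` and to show that its range is dense. On positive operators the norm of W^{k,1} is the moment
tr[x (N+1)^(k/2)] (`norm_ofFin_of_nonneg`), so a moment inequality is a dissipativity estimate for
positive x only. Positivity of resolvents extends it to all of `T_f`.

Rates for every k. With G = -iH - ½ ∑ L_j† L_j, the image of |u⟩⟨u| is |u⟩⟨Gu| + |Gu⟩⟨u| + ∑ |L_j
u⟩⟨L_j u| (`gen_rk`). Its trace vanishes, which is the moment inequality with exponent 0 and rate 0.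
Two inequalities with weights w₀ and w₁ give one for the parallel sum w₀w₁/(w₀+w₁): split u = u₀ +
u₁ so that the weighted vectors w₀u₀ and w₁u₁ coincide; the G-terms then add up exactly and the jump
terms are subadditive (`mom_gen_rk_parallel_le`). The geometric mean w₀^(1-θ) w₁^θ is an integral of
parallel sums of w₀ and w₁/t, and integration over t produces exactly the rate (1-θ)ω₀ + θω₁
(`mom_gen_rk_interpolate`).

Positivity. Let Q project onto the first n Fock states. If x lives on that block and c x - Q𝓛(x)Q ≥
0, then x ≥ 0: trace the inequality over the range of the negative part of x; the GKSL form gives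
each contribution a sign and leaves no negative part (`nonneg_of_compress_nonneg`). Hence the
compressed resolvent equation is uniquely solvable in finite dimension, with positive solutions for
positive data. Compression only lowers moments, so the moment inequality bounds these solutions.
Decomposing arbitrary data into positive operators without loss of norm gives the lower bound
(`norm_le_norm_compress`).

Dense range. Let x_n solve the compressed equation with right-hand side z. The defect 𝓛(x_n) -
Q𝓛(x_n)Q is O(n⁻²) in W^{k,1}, relative to the norm of x_n in W^{k',1} with k' large, because H and
the L_j are polynomials (`exists_norm_gen_sub_compress_le`). The norms in W^{k',1} are bounded
uniformly in n by the rate at k'; this is where k_r → ∞ enters. Thus (c - 𝓛) x_n → z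
(`exists_tendsto_shift`).

The semigroup is the limit of the exponentials of the Yosida approximations. Positivity, agreement
for different k, trace preservation and all growth rates are therefore inherited from properties of
the resolvents. -/

section HilleYosida

/-! ### Exponentials of bounded operators -/

section Exponential
variable {E F : Type*} [NormedAddCommGroup E] [NormedSpace ℝ E] [CompleteSpace E]
  [NormedAddCommGroup F] [NormedSpace ℝ F] [CompleteSpace F]

theorem hasSum_exp_apply (B : E →L[ℝ] E) (x : E) :
    HasSum (fun n : ℕ => ((n.factorial : ℝ)⁻¹) • (B ^ n) x) (NormedSpace.exp B x) :=
  (NormedSpace.exp_series_hasSum_exp' (𝕂 := ℝ) B).mapL (ContinuousLinearMap.apply ℝ E x)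

/-- Intertwining passes to powers and so to the series. Both the agreement of the semigroups for
different k and trace preservation rest on this. -/
theorem exp_comp_of_intertwine {B : E →L[ℝ] E} {C : F →L[ℝ] F} (j : E →L[ℝ] F)
    (h : ∀ x, j (B x) = C (j x)) (x : E) :
    j (NormedSpace.exp B x) = NormedSpace.exp C (j x) := by
  have hn : ∀ (n : ℕ) (x : E), j ((B ^ n) x) = (C ^ n) (j x) := by
    intro n
    induction n with
    | zero => intro x; rfl
    | succ n ih => intro x; rw [pow_succ, pow_succ, mul_apply_eq_comp, mul_apply_eq_comp, ih, h]
  have h1 := (hasSum_exp_apply B x).mapL j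
  have h2 := hasSum_exp_apply C (j x)
  simp only [map_smul, hn] at h1
  exact h1.unique h2

/-- The partial sums of the exponential series have nonnegative coefficients, so they stay in an
invariant convex cone. This transfers positivity from resolvents to the semigroup. -/
theorem exp_apply_mem {B : E →L[ℝ] E} {s : Set E} (hs : IsClosed s) (h0 : (0 : E) ∈ s)
    (hadd : ∀ x ∈ s, ∀ y ∈ s, x + y ∈ s) (hsmul : ∀ c : ℝ, 0 ≤ c → ∀ x ∈ s, c • x ∈ s)
    (hB : ∀ x ∈ s, B x ∈ s) {x : E} (hx : x ∈ s) : NormedSpace.exp B x ∈ s := by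
  have hn : ∀ n : ℕ, (B ^ n) x ∈ s := by
    intro n
    induction n with
    | zero => exact hx
    | succ n ih => rw [pow_succ', mul_apply_eq_comp]; exact hB _ ih
  refine hs.mem_of_tendsto (hasSum_exp_apply B x) (Eventually.of_forall fun t => ?_)
  refine Finset.sum_induction _ (· ∈ s) (fun a b ha hb => hadd a ha b hb) h0 fun n _ => ?_
  exact hsmul _ (by positivity) _ (hn n)

/-- The series is estimated at a vector, so the norm of the identity never enters and `E` may be the
zero space. -/
theorem norm_exp_le_exp_norm (B : E →L[ℝ] E) : ‖NormedSpace.exp B‖ ≤ Real.exp ‖B‖ := by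
  refine ContinuousLinearMap.opNorm_le_bound _ (Real.exp_pos _).le fun x => ?_
  have h2 : HasSum (fun n : ℕ => ((n.factorial : ℝ)⁻¹) * ‖B‖ ^ n * ‖x‖) (Real.exp ‖B‖ * ‖x‖) := by
    rw [Real.exp_eq_exp_ℝ]
    have := NormedSpace.exp_series_hasSum_exp' (𝕂 := ℝ) ‖B‖
    simpa using this.mul_right ‖x‖
  have hpow : ∀ n : ℕ, ‖(B ^ n) x‖ ≤ ‖B‖ ^ n * ‖x‖ := by
    intro n
    induction n with
    | zero => simp
    | succ n ih =>
      rw [pow_succ', mul_apply_eq_comp, pow_succ', mul_assoc]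
      exact (B.le_opNorm _).trans (by gcongr)
  rw [← (hasSum_exp_apply B x).tsum_eq]
  refine tsum_of_norm_bounded h2 fun n => ?_
  rw [norm_smul, mul_assoc, Real.norm_of_nonneg (by positivity)]
  gcongr
  exact hpow n

theorem exp_smul_sub_one (a b : ℝ) (R : E →L[ℝ] E) :
    NormedSpace.exp (a • R - b • (1 : E →L[ℝ] E)) = Real.exp (-b) • NormedSpace.exp (a • R) := by
  let _ : NormedAlgebra ℚ (E →L[ℝ] E) := NormedAlgebra.restrictScalars ℚ ℝ _
  have hc : Commute (a • R) (-(b • (1 : E →L[ℝ] E))) :=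
    (((Commute.one_right R).smul_right b).smul_left a).neg_right
  rw [sub_eq_add_neg, NormedSpace.exp_add_of_commute hc]
  have h : NormedSpace.exp (-(b • (1 : E →L[ℝ] E))) = Real.exp (-b) • (1 : E →L[ℝ] E) := by
    have := NormedSpace.algebraMap_exp_comm (𝕂 := ℝ) (𝔸 := E →L[ℝ] E) (-b)
    rw [← Real.exp_eq_exp_ℝ, Algebra.algebraMap_eq_smul_one, Algebra.algebraMap_eq_smul_one,
      neg_smul] at this
    exact this.symm
  rw [h, mul_smul_comm, mul_one]

theorem hasDerivAt_exp_smul_apply (B : E →L[ℝ] E) (x : E) (t : ℝ) :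
    HasDerivAt (fun u : ℝ => NormedSpace.exp (u • B) x) (NormedSpace.exp (t • B) (B x)) t := by
  have h := hasDerivAt_exp_smul_const (𝕂 := ℝ) B t
  exact ((ContinuousLinearMap.apply ℝ E x).hasFDerivAt.comp_hasDerivAt t h)

/-- The path s ↦ e^(sB) e^((t-s)C) joins e^(tC) to e^(tB), and by commutation its derivative is
e^(sB) e^((t-s)C) (B - C). This compares two Yosida semigroups. -/
theorem norm_exp_sub_exp_le {B C : E →L[ℝ] E} (hBC : Commute B C) {t M : ℝ} (ht : 0 ≤ t)
    (hB : ∀ s, 0 ≤ s → s ≤ t → ‖NormedSpace.exp (s • B)‖ ≤ M)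
    (hC : ∀ s, 0 ≤ s → s ≤ t → ‖NormedSpace.exp (s • C)‖ ≤ M) (x : E) :
    ‖NormedSpace.exp (t • B) x - NormedSpace.exp (t • C) x‖ ≤ t * (M ^ 2 * ‖B x - C x‖) := by
  let _ : NormedAlgebra ℚ (E →L[ℝ] E) := NormedAlgebra.restrictScalars ℚ ℝ _
  have hM : 0 ≤ M := (norm_nonneg _).trans (hB 0 le_rfl ht)
  set f : ℝ → E →L[ℝ] E := fun s => NormedSpace.exp (s • B) * NormedSpace.exp ((t - s) • C)
    with hf
  have hd : ∀ s, HasDerivAt f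
      (NormedSpace.exp (s • B) * NormedSpace.exp ((t - s) • C) * (B - C)) s := by
    intro s
    have h1 := hasDerivAt_exp_smul_const (𝕂 := ℝ) B s
    have h2 : HasDerivAt (fun u : ℝ => NormedSpace.exp ((t - u) • C))
        (-(NormedSpace.exp ((t - s) • C) * C)) s := by
      have := (hasDerivAt_exp_smul_const (𝕂 := ℝ) C (t - s)).scomp s
        ((hasDerivAt_id s).const_sub t)
      rw [neg_smul, one_smul] at this
      exact this
    refine (h1.mul h2).congr_deriv ?_
    have hc : Commute B (NormedSpace.exp ((t - s) • C)) := (hBC.smul_right _).exp_right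
    rw [mul_assoc _ B, hc.eq, mul_neg, mul_sub]
    simp only [mul_assoc, sub_eq_add_neg]
  have key := norm_image_sub_le_of_norm_deriv_le_segment' (a := 0) (b := t) (f := fun s => f s x)
    (f' := fun s => (NormedSpace.exp (s • B) * NormedSpace.exp ((t - s) • C) * (B - C)) x)
    (C := M ^ 2 * ‖B x - C x‖)
    (fun s _ => ((ContinuousLinearMap.apply ℝ E x).hasFDerivAt.comp_hasDerivAt s
      (hd s)).hasDerivWithinAt)
    (fun s hs => by
      rw [mul_apply_eq_comp, mul_apply_eq_comp, sub_apply]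
      refine (ContinuousLinearMap.le_opNorm _ _).trans ?_
      rw [pow_two, mul_assoc]
      refine mul_le_mul (hB s hs.1 hs.2.le) ?_ (norm_nonneg _) hM
      refine (ContinuousLinearMap.le_opNorm _ _).trans ?_
      gcongr
      exact hC _ (by linarith [hs.2]) (by linarith [hs.1])) t ⟨ht, le_rfl⟩
  simp only [hf, sub_self, zero_smul, sub_zero, NormedSpace.exp_zero, mul_one, one_mul] at key
  rw [mul_comm t]
  exact key

theorem norm_exp_sub_self_le {B : E →L[ℝ] E} {t M : ℝ} (ht : 0 ≤ t)
    (hB : ∀ s, 0 ≤ s → s ≤ t → ‖NormedSpace.exp (s • B)‖ ≤ M) (x : E) :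
    ‖NormedSpace.exp (t • B) x - x‖ ≤ t * (M * ‖B x‖) := by
  have key := norm_image_sub_le_of_norm_deriv_le_segment' (a := 0) (b := t)
    (f := fun s : ℝ => NormedSpace.exp (s • B) x) (C := M * ‖B x‖)
    (fun s _ => (hasDerivAt_exp_smul_apply B x s).hasDerivWithinAt)
    (fun s hs => (ContinuousLinearMap.le_opNorm _ _).trans (by
      gcongr; exact hB s hs.1 hs.2.le)) t ⟨ht, le_rfl⟩
  simpa [NormedSpace.exp_zero, mul_comm] using key

/-- The vector `v` is a substitute for `B x`. For Yosida approximations B_n, there is no uniform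
control of B_n (B_n x), whereas `v` can be taken in the domain of the generator, where B_n v
converges. -/
theorem norm_exp_sub_sub_le {B : E →L[ℝ] E} {t M : ℝ} (ht : 0 ≤ t)
    (hB : ∀ s, 0 ≤ s → s ≤ t → ‖NormedSpace.exp (s • B)‖ ≤ M) (x v : E) :
    ‖NormedSpace.exp (t • B) x - x - t • B x‖ ≤
      t * ((M + 1) * ‖B x - v‖ + t * (M * ‖B v‖)) := by
  have hM : 0 ≤ M := (norm_nonneg _).trans (hB 0 le_rfl ht)
  have hd : ∀ s : ℝ, HasDerivAt (fun s : ℝ => NormedSpace.exp (s • B) x - s • B x)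
      (NormedSpace.exp (s • B) (B x) - B x) s := fun s =>
    ((hasDerivAt_exp_smul_apply B x s).sub ((hasDerivAt_id s).smul_const (B x))).congr_deriv
      (by rw [one_smul])
  have key := norm_image_sub_le_of_norm_deriv_le_segment' (a := 0) (b := t)
    (C := (M + 1) * ‖B x - v‖ + t * (M * ‖B v‖))
    (fun s _ => (hd s).hasDerivWithinAt)
    (fun s hs => by
      have e : NormedSpace.exp (s • B) (B x) - B x = NormedSpace.exp (s • B) (B x - v)
          - (B x - v) + (NormedSpace.exp (s • B) v - v) := by rw [map_sub]; abel
      rw [e]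
      refine (norm_add_le _ _).trans (add_le_add ?_ ?_)
      · refine (norm_sub_le _ _).trans ?_
        rw [add_mul, one_mul]
        gcongr
        refine (ContinuousLinearMap.le_opNorm _ _).trans ?_
        gcongr
        exact hB s hs.1 hs.2.le
      · refine (norm_exp_sub_self_le hs.1 (fun u hu hus => hB u hu (hus.trans hs.2.le)) v).trans ?_
        gcongr
        exact hs.2.le) t ⟨ht, le_rfl⟩
  simp only [zero_smul, NormedSpace.exp_zero, sub_zero] at key
  rw [mul_comm t]
  convert key using 2
  simp only [one_apply_eq_self]
  abel

end Exponential
end HilleYosida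

/-! ### From resolvents to semigroups, by Yosida approximation -/

section ResolventFamily
variable {E F : Type*} [NormedAddCommGroup E] [NormedSpace ℝ E] [CompleteSpace E]
  [NormedAddCommGroup F] [NormedSpace ℝ F] [CompleteSpace F]

/-- The resolvents `R c = (c - A)⁻¹`, `c > l₀`, of the generator `A` of a semigroup that grows at
most as `exp (ω t)`. -/
structure IsResolventFamily (R : ℝ → E →L[ℝ] E) (l₀ ω : ℝ) : Prop where
  nonneg : 0 ≤ ω
  le : ω ≤ l₀
  bound : ∀ c > l₀, ‖R c‖ ≤ (c - ω)⁻¹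
  identity : ∀ c > l₀, ∀ d > l₀, ∀ u, R c u - R d u = (d - c) • R c (R d u)
  tendsto : ∀ u, Tendsto (fun c : ℝ => c • R c u) atTop (𝓝 u)

/-- The Yosida approximation `n² R n - n` of the generator. -/
def yosida (R : ℝ → E →L[ℝ] E) (n : ℕ) : E →L[ℝ] E :=
  ((n : ℝ) ^ 2) • R n - (n : ℝ) • (1 : E →L[ℝ] E)

/-- `P` is the pointwise limit of the semigroups generated by the Yosida approximations. -/
def IsYosidaLimit (R : ℝ → E →L[ℝ] E) (P : ℝ≥0 → E →L[ℝ] E) : Prop :=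
  ∀ (t : ℝ≥0) x, Tendsto (fun n : ℕ => NormedSpace.exp ((t : ℝ) • yosida R n) x) atTop (𝓝 (P t x))

/-- `A x = y`, for the operator `A` with the resolvents `R`. -/
def ResolventRel (R : ℝ → E →L[ℝ] E) (l₀ : ℝ) (x y : E) : Prop :=
  ∀ c > l₀, R c (c • x - y) = x

/-- With the scalar part split off, norm bounds and invariant cones can be read off from `R n`
alone. -/
theorem exp_smul_yosida (R : ℝ → E →L[ℝ] E) (n : ℕ) (t : ℝ) :
    NormedSpace.exp (t • yosida R n) =
      Real.exp (-(t * n)) • NormedSpace.exp ((t * (n : ℝ) ^ 2) • R n) := by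
  rw [← exp_smul_sub_one, yosida, smul_sub, smul_smul, smul_smul]

/-- The exponent -tn + tn²/(n - ω) equals ω t n/(n - ω), which tends to ω t, so no growth rate is
lost in the limit. -/
theorem norm_exp_smul_yosida_le {R : ℝ → E →L[ℝ] E} {n : ℕ} {ω t : ℝ} (ht : 0 ≤ t)
    (hn : ω < n) (hR : ‖R n‖ ≤ ((n : ℝ) - ω)⁻¹) :
    ‖NormedSpace.exp (t • yosida R n)‖ ≤ Real.exp (ω * ((n : ℝ) / (n - ω)) * t) := by
  have h0 : 0 < (n : ℝ) - ω := sub_pos.2 hn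
  rw [exp_smul_yosida, norm_smul, Real.norm_of_nonneg (Real.exp_pos _).le]
  have h1 : ‖NormedSpace.exp ((t * (n : ℝ) ^ 2) • R n)‖ ≤
      Real.exp (t * (n : ℝ) ^ 2 * ((n : ℝ) - ω)⁻¹) := by
    refine (norm_exp_le_exp_norm _).trans (Real.exp_le_exp.2 ?_)
    rw [norm_smul, Real.norm_of_nonneg (by positivity)]
    gcongr
  calc _ ≤ Real.exp (-(t * n)) * Real.exp (t * (n : ℝ) ^ 2 * ((n : ℝ) - ω)⁻¹) := by gcongr
    _ = _ := by
      rw [← Real.exp_add]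
      congr 1
      field_simp
      ring

namespace IsResolventFamily
variable {R : ℝ → E →L[ℝ] E} {l₀ ω : ℝ} (h : IsResolventFamily R l₀ ω)
include h

/-- For n > 2ω the factor n/(n - ω) is at most 2. This crude bound, uniform in n, is enough for the
convergence arguments; the sharp rate is recovered in `norm_le`. -/
theorem eventually_norm_exp_le : ∀ᶠ n : ℕ in atTop, ∀ t : ℝ, 0 ≤ t →
    ‖NormedSpace.exp (t • yosida R n)‖ ≤ Real.exp (ω * 2 * t) := by
  filter_upwards [tendsto_natCast_atTop_atTop.eventually_gt_atTop (2 * ω),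
    tendsto_natCast_atTop_atTop.eventually_gt_atTop l₀] with n hn hn' t ht
  have hω := h.nonneg
  have h0 : 0 < (n : ℝ) - ω := by linarith
  refine (norm_exp_smul_yosida_le ht (by linarith) (h.bound _ hn')).trans (Real.exp_le_exp.2 ?_)
  gcongr
  rw [div_le_iff₀ h0]
  linarith

theorem commute {c d : ℝ} (hc : l₀ < c) (hd : l₀ < d) : Commute (R c) (R d) := by
  rcases eq_or_ne c d with rfl | hcd
  · exact Commute.refl _
  ext u
  have h1 := h.identity c hc d hd u
  have h2 := h.identity d hd c hc u
  have h3 : (d - c) • (R c (R d u) - R d (R c u)) = 0 := by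
    rw [smul_sub, ← h1, ← neg_sub c d, neg_smul, ← h2]; abel
  exact sub_eq_zero.1 ((smul_eq_zero.1 h3).resolve_left (sub_ne_zero.2 hcd.symm))

theorem commute_yosida {n m : ℕ} (hn : l₀ < n) (hm : l₀ < m) :
    Commute (yosida R n) (yosida R m) := by
  have h1 := ((h.commute hn hm).smul_left ((n : ℝ) ^ 2)).smul_right ((m : ℝ) ^ 2)
  refine Commute.sub_left (Commute.sub_right h1 ?_) ?_
  · exact (Commute.one_right _).smul_right _
  · exact (Commute.one_left _).smul_left _

/-- The resolvent identity carries the equation from `c` to any other parameter, so a single `c`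
decides whether A x = y. -/
theorem rel_of_apply_eq {c : ℝ} (hc : l₀ < c) {x y : E} (hx : R c (c • x - y) = x) :
    ResolventRel R l₀ x y := by
  intro d hd
  have h1 := h.identity d hd c hc (c • x - y)
  rw [hx] at h1
  have e : d • x - y = (c • x - y) + (d - c) • x := by rw [sub_smul]; abel
  rw [e, map_add, map_smul, eq_add_of_sub_eq h1, ← neg_sub d c, neg_smul]
  abel

theorem rel_apply {c : ℝ} (hc : l₀ < c) (u : E) : ResolventRel R l₀ (R c u) (c • R c u - u) :=
  h.rel_of_apply_eq hc (by rw [sub_sub_cancel])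

/-- On the domain, n R_n x - x = R_n (A x): the Yosida approximation is n R_n A, which converges to
A. -/
theorem yosida_apply {n : ℕ} (hn : l₀ < n) {x y : E} (hxy : ResolventRel R l₀ x y) :
    yosida R n x = (n : ℝ) • R n y := by
  have h1 := hxy n hn
  rw [map_sub, map_smul] at h1
  rw [yosida, sub_apply, smul_apply, smul_apply, one_apply_eq_self, pow_two, mul_smul, ← smul_sub]
  congr 1
  rw [sub_eq_iff_eq_add] at h1 ⊢
  rw [h1]; abel

theorem tendsto_yosida {x y : E} (hxy : ResolventRel R l₀ x y) :
    Tendsto (fun n : ℕ => yosida R n x) atTop (𝓝 y) := by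
  refine ((h.tendsto y).comp tendsto_natCast_atTop_atTop).congr' ?_
  filter_upwards [tendsto_natCast_atTop_atTop.eventually_gt_atTop l₀] with n hn
  exact (h.yosida_apply hn hxy).symm

theorem exists_rel_norm_sub_lt (x : E) {ε : ℝ} (hε : 0 < ε) :
    ∃ v z, ResolventRel R l₀ v z ∧ ‖x - v‖ < ε := by
  have h1 := (Metric.tendsto_atTop.1 (h.tendsto x)) ε hε
  obtain ⟨N, hN⟩ := h1
  have hc : l₀ < max N (l₀ + 1) := lt_of_lt_of_le (by linarith) (le_max_right _ _)
  have h2 := h.rel_apply hc (max N (l₀ + 1) • x)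
  refine ⟨_, _, h2, ?_⟩
  rw [map_smul, ← dist_eq_norm, dist_comm]
  exact hN _ (le_max_left _ _)

theorem cauchySeq_exp_yosida {t : ℝ} (ht : 0 ≤ t) (x : E) :
    CauchySeq (fun n : ℕ => NormedSpace.exp (t • yosida R n) x) := by
  set M := Real.exp (ω * 2 * t) with hM
  have hM0 : 0 < M := Real.exp_pos _
  rw [Metric.cauchySeq_iff]
  intro ε hε
  -- Only on the domain do the Yosida approximations converge. The bound ε/(4M) makes each of the
  -- two exponentials of `x - v` cost at most ε/4.
  obtain ⟨v, z, hvz, hxv⟩ := h.exists_rel_norm_sub_lt x (ε := ε / (4 * M)) (by positivity)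
  have hc := Metric.cauchySeq_iff.1 (h.tendsto_yosida hvz).cauchySeq
    (ε / (2 * (t * M ^ 2 + 1))) (by positivity)
  obtain ⟨N, hN⟩ := hc
  obtain ⟨N', hN'⟩ := eventually_atTop.1 (h.eventually_norm_exp_le.and
    (tendsto_natCast_atTop_atTop.eventually_gt_atTop l₀))
  refine ⟨max N N', fun m hm n hn => ?_⟩
  have hm1 := hN' m ((le_max_right _ _).trans hm)
  have hn1 := hN' n ((le_max_right _ _).trans hn)
  have hb : ∀ k : ℕ, (∀ t : ℝ, 0 ≤ t → ‖NormedSpace.exp (t • yosida R k)‖ ≤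
      Real.exp (ω * 2 * t)) → ∀ s, 0 ≤ s → s ≤ t → ‖NormedSpace.exp (s • yosida R k)‖ ≤ M :=
    fun k hk s hs hst => (hk s hs).trans (Real.exp_le_exp.2 (by
      have := h.nonneg; gcongr))
  have h1 := norm_exp_sub_exp_le (h.commute_yosida hm1.2 hn1.2) ht (hb m hm1.1) (hb n hn1.1) v
  have h2 := hN m ((le_max_left _ _).trans hm) n ((le_max_left _ _).trans hn)
  rw [dist_eq_norm] at h2 ⊢
  have h3 : ∀ k : ℕ, ‖NormedSpace.exp (t • yosida R k)‖ ≤ M →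
      ‖NormedSpace.exp (t • yosida R k) (x - v)‖ ≤ ε / 4 := fun k hk => by
    refine (ContinuousLinearMap.le_opNorm _ _).trans ?_
    calc _ ≤ M * (ε / (4 * M)) := by gcongr
      _ = ε / 4 := by field_simp
  have e : NormedSpace.exp (t • yosida R m) x - NormedSpace.exp (t • yosida R n) x =
      NormedSpace.exp (t • yosida R m) (x - v) - NormedSpace.exp (t • yosida R n) (x - v) +
      (NormedSpace.exp (t • yosida R m) v - NormedSpace.exp (t • yosida R n) v) := by
    rw [map_sub, map_sub]; abel
  have h4 : t * (M ^ 2 * ‖yosida R m v - yosida R n v‖) < ε / 2 := by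
    calc _ ≤ (t * M ^ 2) * (ε / (2 * (t * M ^ 2 + 1))) := by
          rw [← mul_assoc]; gcongr
      _ < (t * M ^ 2 + 1) * (ε / (2 * (t * M ^ 2 + 1))) := by gcongr; linarith
      _ = ε / 2 := by field_simp
  rw [e]
  have h5 := norm_sub_le (NormedSpace.exp (t • yosida R m) (x - v))
    (NormedSpace.exp (t • yosida R n) (x - v))
  have h6 := h3 m (hm1.1 t ht)
  have h7 := h3 n (hn1.1 t ht)
  refine (norm_add_le _ _).trans_lt ?_
  linarith

theorem exists_isYosidaLimit : ∃ P, IsYosidaLimit R P := by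
  have hl : ∀ (t : ℝ≥0) (x : E), ∃ y,
      Tendsto (fun n : ℕ => NormedSpace.exp ((t : ℝ) • yosida R n) x) atTop (𝓝 y) :=
    fun t x => cauchySeq_tendsto_of_complete (h.cauchySeq_exp_yosida t.2 x)
  choose P hP using hl
  exact ⟨fun t => continuousLinearMapOfTendsto
    (fun n : ℕ => NormedSpace.exp ((t : ℝ) • yosida R n)) (tendsto_pi_nhds.2 (hP t)),
    fun t x => hP t x⟩

variable {P : ℝ≥0 → E →L[ℝ] E} (hP : IsYosidaLimit R P)
include hP

/-- The rate `ω'` is independent of the rate of the family: one semigroup obeys every growth bound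
for which its resolvents are eventually small enough, hence all the interpolated ones. -/
theorem norm_le {ω' : ℝ} (hω' : ∀ᶠ c in atTop, ‖R c‖ ≤ (c - ω')⁻¹) (t : ℝ≥0) :
    ‖P t‖ ≤ Real.exp (ω' * t) := by
  refine ContinuousLinearMap.opNorm_le_bound _ (Real.exp_pos _).le fun x => ?_
  have h1 : Tendsto (fun n : ℕ => Real.exp (ω' * ((n : ℝ) / (n - ω')) * t) * ‖x‖) atTop
      (𝓝 (Real.exp (ω' * 1 * t) * ‖x‖)) := by
    have h2 : Tendsto (fun n : ℕ => (n : ℝ) / (n - ω')) atTop (𝓝 1) := by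
      simpa [sub_eq_add_neg] using tendsto_natCast_div_add_atTop (𝕜 := ℝ) (-ω')
    exact (((Real.continuous_exp.tendsto _).comp
      ((h2.const_mul ω').mul_const (t : ℝ)))).mul_const _
  rw [mul_one] at h1
  refine le_of_tendsto_of_tendsto (hP t x).norm h1 ?_
  filter_upwards [tendsto_natCast_atTop_atTop.eventually hω',
    tendsto_natCast_atTop_atTop.eventually_gt_atTop ω'] with n hn hn'
  refine (ContinuousLinearMap.le_opNorm _ _).trans ?_
  gcongr
  exact norm_exp_smul_yosida_le t.2 hn' hn

theorem norm_le_exp (t : ℝ≥0) : ‖P t‖ ≤ Real.exp (ω * t) :=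
  h.norm_le hP ((eventually_gt_atTop l₀).mono fun c hc => h.bound c hc) t

theorem norm_sub_self_le {x y : E} (hxy : ResolventRel R l₀ x y) (t : ℝ≥0) :
    ‖P t x - x‖ ≤ t * (Real.exp (ω * 2 * t) * ‖y‖) := by
  refine le_of_tendsto_of_tendsto ((hP t x).sub_const x).norm
    (((h.tendsto_yosida hxy).norm.const_mul _).const_mul _) ?_
  filter_upwards [h.eventually_norm_exp_le] with n hn
  refine norm_exp_sub_self_le t.2 (fun s hs hst => (hn s hs).trans (Real.exp_le_exp.2 ?_)) x
  have := h.nonneg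
  gcongr
  exact hst

theorem norm_sub_sub_le {x y v z : E} (hxy : ResolventRel R l₀ x y) (hvz : ResolventRel R l₀ v z)
    (t : ℝ≥0) : ‖P t x - x - (t : ℝ) • y‖ ≤
      t * ((Real.exp (ω * 2 * t) + 1) * ‖y - v‖ + t * (Real.exp (ω * 2 * t) * ‖z‖)) := by
  have h1 := h.tendsto_yosida hxy
  refine le_of_tendsto_of_tendsto (((hP t x).sub_const x).sub (h1.const_smul (t : ℝ))).norm
    ((((h1.sub_const v).norm.const_mul _).add
      (((h.tendsto_yosida hvz).norm.const_mul _).const_mul _)).const_mul _) ?_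
  filter_upwards [h.eventually_norm_exp_le] with n hn
  refine norm_exp_sub_sub_le t.2 (fun s hs hst => (hn s hs).trans (Real.exp_le_exp.2 ?_)) x v
  have := h.nonneg
  gcongr
  exact hst

theorem isC0Semigroup : IsC0Semigroup P where
  map_zero := by
    ext x
    refine tendsto_nhds_unique (hP 0 x) ?_
    simp [NormedSpace.exp_zero]
  map_add s t := by
    ext x
    refine tendsto_nhds_unique (hP (s + t) x) ?_
    have h1 := (hP s (P t x))
    -- The outer exponentials are bounded uniformly in n, so the inner one may be replaced by its
    -- limit.
    have h2 : Tendsto (fun n : ℕ => NormedSpace.exp ((s : ℝ) • yosida R n)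
        (NormedSpace.exp ((t : ℝ) • yosida R n) x - P t x)) atTop (𝓝 0) := by
      have h3 : Tendsto (fun n : ℕ => Real.exp (ω * 2 * s) *
          ‖NormedSpace.exp ((t : ℝ) • yosida R n) x - P t x‖) atTop (𝓝 0) := by
        simpa using (((hP t x).sub_const (P t x)).norm.const_mul (Real.exp (ω * 2 * s)))
      refine squeeze_zero_norm' ?_ h3
      filter_upwards [h.eventually_norm_exp_le] with n hn
      refine (ContinuousLinearMap.le_opNorm _ _).trans ?_
      gcongr
      exact hn s s.2
    have h4 := h2.add h1
    rw [zero_add] at h4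
    refine h4.congr fun n => ?_
    let _ : NormedAlgebra ℚ (E →L[ℝ] E) := NormedAlgebra.restrictScalars ℚ ℝ _
    rw [map_sub, sub_add_cancel, NNReal.coe_add, add_smul, NormedSpace.exp_add_of_commute
      (((Commute.refl (yosida R n)).smul_left _).smul_right _)]
    rfl
  tendsto_zero x := by
    have hM : ∀ t : ℝ≥0, t ≤ 1 → Real.exp (ω * 2 * t) ≤ Real.exp (ω * 2) := fun t ht => by
      refine Real.exp_le_exp.2 (mul_le_of_le_one_right ?_ (by exact_mod_cast ht))
      linarith [h.nonneg]
    have hM' : ∀ t : ℝ≥0, t ≤ 1 → ‖P t‖ ≤ Real.exp (ω * 2) := fun t ht => by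
      refine (h.norm_le_exp hP t).trans (le_trans (Real.exp_le_exp.2 ?_) (hM t ht))
      have := h.nonneg
      gcongr
      linarith
    set M := Real.exp (ω * 2)
    have hM0 : 0 < M := Real.exp_pos _
    rw [Metric.tendsto_nhds]
    intro ε hε
    obtain ⟨v, z, hvz, hxv⟩ := h.exists_rel_norm_sub_lt x (ε := ε / (2 * (M + 1)))
      (by positivity)
    have h1 : Tendsto (fun t : ℝ≥0 => (t : ℝ) * (M * ‖z‖)) (𝓝 0) (𝓝 ((0 : ℝ≥0) * (M * ‖z‖))) :=
      (NNReal.continuous_coe.tendsto 0).mul_const _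
    rw [NNReal.coe_zero, zero_mul] at h1
    filter_upwards [h1.eventually (gt_mem_nhds (half_pos hε)), eventually_le_nhds one_pos]
      with t ht ht1
    have h2 := (h.norm_sub_self_le hP hvz t).trans
      (mul_le_mul_of_nonneg_left (mul_le_mul_of_nonneg_right (hM t ht1) (norm_nonneg z)) t.2)
    have e : P t x - x = P t (x - v) - (x - v) + (P t v - v) := by rw [map_sub]; abel
    rw [dist_eq_norm, e]
    have h3 : ‖P t (x - v) - (x - v)‖ ≤ ε / 2 := by
      refine (norm_sub_le _ _).trans ?_
      calc _ ≤ M * ‖x - v‖ + ‖x - v‖ := by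
            gcongr
            exact (ContinuousLinearMap.le_opNorm _ _).trans (by gcongr; exact hM' t ht1)
        _ = (M + 1) * ‖x - v‖ := by ring
        _ ≤ (M + 1) * (ε / (2 * (M + 1))) := by gcongr
        _ = ε / 2 := by field_simp
    exact (norm_add_le _ _).trans_lt (by linarith)

theorem tendsto_of_rel {x y : E} (hxy : ResolventRel R l₀ x y) :
    Tendsto (fun t : ℝ≥0 => (t : ℝ)⁻¹ • (P t x - x)) (𝓝[>] 0) (𝓝 y) := by
  set M := Real.exp (ω * 2)
  have hM0 : 0 < M := Real.exp_pos _
  rw [Metric.tendsto_nhds]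
  intro ε hε
  obtain ⟨v, z, hvz, hxv⟩ := h.exists_rel_norm_sub_lt y (ε := ε / (2 * (M + 1))) (by positivity)
  have h1 : Tendsto (fun t : ℝ≥0 => (t : ℝ) * (M * ‖z‖)) (𝓝 0) (𝓝 ((0 : ℝ≥0) * (M * ‖z‖))) :=
    (NNReal.continuous_coe.tendsto 0).mul_const _
  rw [NNReal.coe_zero, zero_mul] at h1
  filter_upwards [nhdsWithin_le_nhds (h1.eventually (gt_mem_nhds (half_pos hε))),
    nhdsWithin_le_nhds (eventually_le_nhds one_pos), self_mem_nhdsWithin] with t ht ht1 ht0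
  have ht0' : (0 : ℝ) < t := ht0
  have hM : Real.exp (ω * 2 * t) ≤ M := by
    refine Real.exp_le_exp.2 (mul_le_of_le_one_right ?_ (by exact_mod_cast ht1))
    linarith [h.nonneg]
  have e : (t : ℝ)⁻¹ • (P t x - x) - y = (t : ℝ)⁻¹ • (P t x - x - (t : ℝ) • y) := by
    rw [smul_sub _ _ ((t : ℝ) • y), smul_smul, inv_mul_cancel₀ ht0'.ne', one_smul]
  rw [dist_eq_norm, e, norm_smul, norm_inv, Real.norm_of_nonneg ht0'.le,
    inv_mul_lt_iff₀ ht0']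
  refine (h.norm_sub_sub_le hP hxy hvz t).trans_lt (mul_lt_mul_of_pos_left ?_ ht0')
  calc _ ≤ (M + 1) * ‖y - v‖ + t * (M * ‖z‖) := by gcongr
    _ < (M + 1) * (ε / (2 * (M + 1))) + ε / 2 := by gcongr
    _ = ε := by field_simp; ring

/-- If P_t d = d + t c d + o(t), then (1 + t c)‖d‖ ≤ e^(ω t)‖d‖ + o(t), so c‖d‖ ≤ ω‖d‖. This is
injectivity of c minus the derivative at 0 of the semigroup. -/
theorem eq_zero_of_tendsto {c : ℝ} (hc : ω < c) {d : E}
    (hd : Tendsto (fun t : ℝ≥0 => (t : ℝ)⁻¹ • (P t d - d)) (𝓝[>] 0) (𝓝 (c • d))) : d = 0 := by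
  have hn : (𝓝[>] (0 : ℝ≥0)).NeBot := inferInstance
  have h1 : Tendsto (fun t : ℝ≥0 => c * ‖d‖ - ‖(t : ℝ)⁻¹ • (P t d - d) - c • d‖) (𝓝[>] 0)
      (𝓝 (c * ‖d‖)) := by
    simpa using ((hd.sub_const (c • d)).norm).const_sub (c * ‖d‖)
  have h2 : Tendsto (fun t : ℝ≥0 => ω * Real.exp (ω * t) * ‖d‖) (𝓝[>] 0) (𝓝 (ω * ‖d‖)) := by
    have : Continuous (fun t : ℝ≥0 => ω * Real.exp (ω * t) * ‖d‖) := by fun_prop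
    have := (this.tendsto 0).mono_left (nhdsWithin_le_nhds (s := Set.Ioi 0))
    simpa using this
  have h3 : c * ‖d‖ ≤ ω * ‖d‖ := by
    refine le_of_tendsto_of_tendsto h1 h2 ?_
    filter_upwards [self_mem_nhdsWithin] with t ht
    have ht0 : (0 : ℝ) < t := ht
    have hPt : ‖P t d‖ ≤ Real.exp (ω * t) * ‖d‖ :=
      (ContinuousLinearMap.le_opNorm _ _).trans (by gcongr; exact h.norm_le_exp hP t)
    -- This is 1 - s ≤ e^(-s) multiplied by e^s, for s = ω t.
    have hexp : Real.exp (ω * t) - 1 ≤ ω * t * Real.exp (ω * t) := by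
      have h4 := Real.add_one_le_exp (-(ω * t))
      have h5 : Real.exp (-(ω * t)) * Real.exp (ω * t) = 1 := by rw [← Real.exp_add]; simp
      nlinarith [Real.exp_pos (ω * t)]
    have hω := h.nonneg
    have e : d + (t : ℝ) • c • d = P t d - (t : ℝ) • ((t : ℝ)⁻¹ • (P t d - d) - c • d) := by
      rw [smul_sub (t : ℝ), smul_smul (t : ℝ) (t : ℝ)⁻¹, mul_inv_cancel₀ ht0.ne', one_smul]; abel
    have h6 : ‖d + (t : ℝ) • c • d‖ = (1 + t * c) * ‖d‖ := by
      rw [smul_smul]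
      nth_rewrite 1 [← one_smul ℝ d]
      rw [← add_smul, norm_smul, Real.norm_of_nonneg]
      have : 0 < (t : ℝ) * c := mul_pos ht0 (by linarith)
      linarith
    have h7 := norm_sub_le (P t d) ((t : ℝ) • ((t : ℝ)⁻¹ • (P t d - d) - c • d))
    rw [← e, h6, norm_smul, Real.norm_of_nonneg ht0.le] at h7
    have h8 : t * (c * ‖d‖ - ‖(t : ℝ)⁻¹ • (P t d - d) - c • d‖) ≤
        t * (ω * Real.exp (ω * t) * ‖d‖) := by
      have := mul_le_mul_of_nonneg_right hexp (norm_nonneg d)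
      nlinarith
    exact le_of_mul_le_mul_left h8 ht0
  by_contra hd0
  have := norm_pos_iff.2 hd0
  nlinarith

theorem rel_iff_tendsto {x y : E} : ResolventRel R l₀ x y ↔
    Tendsto (fun t : ℝ≥0 => (t : ℝ)⁻¹ • (P t x - x)) (𝓝[>] 0) (𝓝 y) := by
  refine ⟨h.tendsto_of_rel hP, fun hxy => ?_⟩
  set c := l₀ + 1 with hc
  have hc1 : l₀ < c := by linarith
  have h1 := h.tendsto_of_rel hP (h.rel_apply hc1 (c • x - y))
  -- `x'` solves c x' - A x' = c x - y within the domain. The difference `x - x'` then has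
  -- derivative c (x - x') at 0 and must vanish.
  set x' := R c (c • x - y) with hx'
  have h2 := hxy.sub h1
  have h3 : x - x' = 0 := by
    refine h.eq_zero_of_tendsto hP (c := c) (by linarith [h.le]) ?_
    convert h2 using 2 with t
    · rw [← smul_sub, map_sub]; congr 1; abel
    · rw [smul_sub]; abel
  exact h.rel_of_apply_eq hc1 (sub_eq_zero.1 h3).symm

end IsResolventFamily

theorem IsYosidaLimit.apply_mem {R : ℝ → E →L[ℝ] E} {P : ℝ≥0 → E →L[ℝ] E}
    (hP : IsYosidaLimit R P) {s : Set E} (hs : IsClosed s) (h0 : (0 : E) ∈ s)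
    (hadd : ∀ x ∈ s, ∀ y ∈ s, x + y ∈ s) (hsmul : ∀ c : ℝ, 0 ≤ c → ∀ x ∈ s, c • x ∈ s)
    (hR : ∀ᶠ c in atTop, ∀ x ∈ s, R c x ∈ s) (t : ℝ≥0) {x : E} (hx : x ∈ s) : P t x ∈ s := by
  refine hs.mem_of_tendsto (hP t x) ?_
  filter_upwards [tendsto_natCast_atTop_atTop.eventually hR] with n hn
  rw [exp_smul_yosida]
  refine hsmul _ (Real.exp_pos _).le _ (exp_apply_mem hs h0 hadd hsmul (fun y hy => ?_) hx)
  exact hsmul _ (mul_nonneg t.2 (sq_nonneg _)) _ (hn y hy)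

theorem IsYosidaLimit.intertwine {R : ℝ → E →L[ℝ] E} {P : ℝ≥0 → E →L[ℝ] E}
    {R' : ℝ → F →L[ℝ] F} {P' : ℝ≥0 → F →L[ℝ] F} (hP : IsYosidaLimit R P)
    (hP' : IsYosidaLimit R' P') (j : E →L[ℝ] F)
    (hj : ∀ᶠ c in atTop, ∀ x, j (R c x) = R' c (j x)) (t : ℝ≥0) (x : E) :
    j (P t x) = P' t (j x) := by
  refine tendsto_nhds_unique ((j.continuous.tendsto _).comp (hP t x))
    ((hP' t (j x)).congr' ?_)
  filter_upwards [tendsto_natCast_atTop_atTop.eventually hj] with n hn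
  refine (exp_comp_of_intertwine j (fun y => ?_) x).symm
  simp only [yosida, smul_apply, sub_apply, map_smul, map_sub, hn, one_apply_eq_self]

/-- The operators c⁻¹ are the resolvents of the generator 0. The trace functional intertwines the
resolvents on W^{0,1} with them, whence trace preservation. -/
theorem isYosidaLimit_inv_smul_one :
    IsYosidaLimit (fun c : ℝ => c⁻¹ • (1 : F →L[ℝ] F)) (fun _ => 1) := by
  intro t x
  refine tendsto_const_nhds.congr' ?_
  filter_upwards [eventually_gt_atTop 0] with n hn
  have hn' : (n : ℝ) ≠ 0 := by exact_mod_cast hn.ne'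
  have : yosida (fun c : ℝ => c⁻¹ • (1 : F →L[ℝ] F)) n = 0 := by
    rw [yosida, smul_smul, pow_two, mul_assoc, mul_inv_cancel₀ hn', mul_one, sub_self]
  rw [this, smul_zero, NormedSpace.exp_zero]

end ResolventFamily

/-! ### The Lumer-Phillips theorem for the closure of an operator -/

section LumerPhillips
variable {E F : Type*} [NormedAddCommGroup E] [NormedSpace ℝ E] [CompleteSpace E]
  [NormedAddCommGroup F] [NormedSpace ℝ F] [CompleteSpace F]

/-- The map `c - A` on the domain of `A`. -/
def shiftSub (A : E →ₗ.[ℝ] E) (c : ℝ) : A.domain →ₗ[ℝ] E := c • A.domain.subtype - A.toFun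

theorem shiftSub_apply (A : E →ₗ.[ℝ] E) (c : ℝ) (x : A.domain) :
    shiftSub A c x = c • (x : E) - A x := rfl

/-- The bounded extension of the inverse of `c - A`, for a lower bounded `c - A` with dense
range. -/
def resolventExt (A : E →ₗ.[ℝ] E) (c : ℝ) : E →L[ℝ] E :=
  A.domain.subtype.extendOfNorm (shiftSub A c)

/-- The hypotheses of the Lumer-Phillips theorem. -/
structure IsQuasiDissipative (A : E →ₗ.[ℝ] E) (l₀ ω : ℝ) : Prop where
  nonneg : 0 ≤ ω
  le : ω ≤ l₀
  dense : Dense (A.domain : Set E)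
  lower : ∀ c > l₀, ∀ x : A.domain, (c - ω) * ‖(x : E)‖ ≤ ‖shiftSub A c x‖
  denseRange : ∀ c > l₀, DenseRange (shiftSub A c)

namespace IsQuasiDissipative
variable {A : E →ₗ.[ℝ] E} {l₀ ω : ℝ} (h : IsQuasiDissipative A l₀ ω)
include h

theorem norm_le {c : ℝ} (hc : l₀ < c) (x : A.domain) :
    ‖A.domain.subtype x‖ ≤ (c - ω)⁻¹ * ‖shiftSub A c x‖ := by
  rw [le_inv_mul_iff₀ (by linarith [h.le])]
  exact h.lower c hc x

theorem resolventExt_shiftSub {c : ℝ} (hc : l₀ < c) (x : A.domain) :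
    resolventExt A c (shiftSub A c x) = x :=
  LinearMap.extendOfNorm_eq (h.denseRange c hc) ⟨_, h.norm_le hc⟩ x

theorem resolventExt_induction {c : ℝ} (hc : l₀ < c) {p : E → Prop} (hp : IsClosed {u | p u})
    (hx : ∀ x : A.domain, p (shiftSub A c x)) (u : E) : p u :=
  isClosed_property (h.denseRange c hc) hp hx u

theorem norm_resolventExt_le {c ω' : ℝ} (hc : l₀ < c) (hω' : ω' < c)
    (hl : ∀ x : A.domain, (c - ω') * ‖(x : E)‖ ≤ ‖shiftSub A c x‖) :
    ‖resolventExt A c‖ ≤ (c - ω')⁻¹ := by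
  have h0 : 0 < c - ω' := sub_pos.2 hω'
  refine LinearMap.opNorm_extendOfNorm_le (h.denseRange c hc) (inv_nonneg.2 h0.le) fun x => ?_
  rw [le_inv_mul_iff₀ h0]
  exact hl x

theorem isResolventFamily : IsResolventFamily (resolventExt A) l₀ ω where
  nonneg := h.nonneg
  le := h.le
  bound c hc := h.norm_resolventExt_le hc (h.le.trans_lt hc) (h.lower c hc)
  identity c hc d hd u := by
    refine h.resolventExt_induction hd (p := fun u => resolventExt A c u - resolventExt A d u =
      (d - c) • resolventExt A c (resolventExt A d u))
      (isClosed_eq (by fun_prop) (by fun_prop)) (fun x => ?_) u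
    -- By density it is enough to check the resolvent identity on the range of d - A.
    have e : shiftSub A d x = shiftSub A c x + (d - c) • (x : E) := by
      rw [shiftSub_apply, shiftSub_apply, sub_smul]; abel
    rw [h.resolventExt_shiftSub hd, e, map_add, map_smul, h.resolventExt_shiftSub hc]
    abel
  tendsto u := by
    rw [Metric.tendsto_atTop]
    intro ε hε
    obtain ⟨x, hx, hux⟩ := Metric.dense_iff.1 h.dense u (ε / 4) (by positivity)
    rw [Metric.mem_ball, dist_eq_norm, norm_sub_rev] at hx
    -- The first summand gives c ≥ 2ω, hence c/(c - ω) ≤ 2; the second makes the resolvent of A x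
    -- smaller than ε/4. In all, u - x costs at most 3ε/4.
    refine ⟨2 * l₀ + 4 * ‖A ⟨x, hux⟩‖ / ε + 1, fun c hc => ?_⟩
    have hl : 0 ≤ l₀ := h.nonneg.trans h.le
    have hA : 0 ≤ 4 * ‖A ⟨x, hux⟩‖ / ε := by positivity
    have hc0 : l₀ < c := by linarith
    have hR := h.norm_resolventExt_le hc0 (h.le.trans_lt hc0) (h.lower c hc0)
    have h0 : 0 < c - ω := by linarith [h.le]
    have h1 := h.resolventExt_shiftSub hc0 ⟨x, hux⟩
    rw [shiftSub_apply, map_sub, map_smul, sub_eq_iff_eq_add] at h1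
    have e : c • resolventExt A c u - u =
        c • resolventExt A c (u - x) - (u - x) + resolventExt A c (A ⟨x, hux⟩) := by
      rw [map_sub, smul_sub, h1]; abel
    have h2 : ‖c • resolventExt A c (u - x)‖ ≤ 2 * ‖u - x‖ := by
      rw [norm_smul, Real.norm_of_nonneg (by linarith)]
      calc c * ‖resolventExt A c (u - x)‖ ≤ c * ((c - ω)⁻¹ * ‖u - x‖) := by
            have : 0 ≤ c := by linarith
            gcongr
            exact (ContinuousLinearMap.le_opNorm _ _).trans (by gcongr)
        _ = (c / (c - ω)) * ‖u - x‖ := by ring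
        _ ≤ 2 * ‖u - x‖ := by
            gcongr
            rw [div_le_iff₀ h0]
            linarith [h.le]
    have h3 : ‖resolventExt A c (A ⟨x, hux⟩)‖ < ε / 4 := by
      refine ((ContinuousLinearMap.le_opNorm _ _).trans
        (mul_le_mul_of_nonneg_right hR (norm_nonneg _))).trans_lt ?_
      rw [inv_mul_lt_iff₀ h0]
      have : ‖A ⟨x, hux⟩‖ = 4 * ‖A ⟨x, hux⟩‖ / ε * (ε / 4) := by field_simp
      rw [this]
      gcongr
      linarith [h.le]
    rw [dist_eq_norm, e]
    refine (norm_add_le _ _).trans_lt ?_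
    have h4 := norm_sub_le (c • resolventExt A c (u - x)) (u - x)
    linarith

omit h in
theorem shiftSub_eq_of_mem_graph {x y : E} (hxy : (x, y) ∈ A.graph) (c : ℝ) :
    ∃ v : A.domain, (v : E) = x ∧ shiftSub A c v = c • x - y := by
  obtain ⟨v, hv, hv'⟩ := (LinearPMap.mem_graph_iff A).1 hxy
  exact ⟨v, hv, by rw [shiftSub_apply, hv, hv']⟩

/-- The resolvent equation is a closed condition that holds on the graph. Conversely, u ↦ (R u, c R
u - u) is continuous and sends the dense range of c - A into the graph. -/
theorem mem_closure_graph_iff {x y : E} :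
    (x, y) ∈ A.graph.topologicalClosure ↔ ResolventRel (resolventExt A) l₀ x y := by
  constructor
  · intro hxy c hc
    have hcl : IsClosed {p : E × E | resolventExt A c (c • p.1 - p.2) = p.1} :=
      isClosed_eq (by fun_prop) (by fun_prop)
    refine closure_minimal ?_ hcl hxy
    rintro ⟨x, y⟩ hxy
    obtain ⟨v, hv, hv'⟩ := shiftSub_eq_of_mem_graph hxy c
    change resolventExt A c (c • x - y) = x
    rw [← hv', h.resolventExt_shiftSub hc, hv]
  · intro hxy
    have hc : l₀ < l₀ + 1 := by linarith
    have h1 := hxy _ hc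
    set c := l₀ + 1
    have hcont : Continuous fun u : E => (resolventExt A c u, c • resolventExt A c u - u) := by
      fun_prop
    have key : ∀ u : E, (resolventExt A c u, c • resolventExt A c u - u) ∈
        A.graph.topologicalClosure := by
      refine h.resolventExt_induction hc
        (A.graph.isClosed_topologicalClosure.preimage hcont) fun v => ?_
      rw [h.resolventExt_shiftSub hc, shiftSub_apply, sub_sub_cancel]
      exact A.graph.le_topologicalClosure (A.mem_graph v)
    have h2 := key (c • x - y)
    rwa [h1, sub_sub_cancel] at h2

/-- If (0, y) is in the closure of the graph, then R_c y = 0 for all large c, while c R_c y → y. -/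
theorem isClosable : A.IsClosable := by
  refine ⟨A.graph.topologicalClosure.toLinearPMap, (Submodule.toLinearPMap_graph_eq _ ?_).symm⟩
  rintro ⟨x, y⟩ hxy (hx : x = 0)
  subst hx
  have h1 := h.mem_closure_graph_iff.1 hxy
  refine tendsto_nhds_unique (h.isResolventFamily.tendsto y) (tendsto_const_nhds.congr' ?_)
  filter_upwards [eventually_gt_atTop l₀] with c hc
  have h2 := h1 c hc
  rw [smul_zero, zero_sub, map_neg, neg_eq_zero] at h2
  rw [h2, smul_zero]

theorem isGenerator_closure {P : ℝ≥0 → E →L[ℝ] E} (hP : IsYosidaLimit (resolventExt A) P) :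
    IsGenerator A.closure P := fun x y => by
  rw [← h.isClosable.graph_closure_eq_closure_graph, h.mem_closure_graph_iff,
    h.isResolventFamily.rel_iff_tendsto hP]

end IsQuasiDissipative

end LumerPhillips

/-! ### Trace-norm estimates and truncation in the Fock basis -/

section TraceNormFacts
variable {H : Type*} [NormedAddCommGroup H] [InnerProductSpace ℂ H] [CompleteSpace H]
  (b : HilbertBasis ℕ ℂ H)

theorem traceNorm_of_nonneg {p : H →L[ℂ] H} (hp : 0 ≤ p) : traceNorm b p = posTrace b p := by
  rw [traceNorm, CFC.abs_of_nonneg p hp]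

theorem posTrace_smul {c : ℝ} (hc : 0 ≤ c) (p : H →L[ℂ] H) :
    posTrace b (c • p) = ENNReal.ofReal c * posTrace b p := by
  rw [posTrace, posTrace, ← ENNReal.tsum_mul_left]
  refine tsum_congr fun n => ?_
  rw [← ENNReal.ofReal_mul hc, smul_apply, inner_smul_right_eq_smul, Complex.real_smul,
    Complex.re_ofReal_mul]

theorem traceNorm_sub_le {p q : H →L[ℂ] H} (hp : 0 ≤ p) (hq : 0 ≤ q) :
    traceNorm b (p - q) ≤ posTrace b p + posTrace b q := by
  rw [← traceNorm_of_nonneg b hp, ← traceNorm_of_nonneg b hq, sub_eq_add_neg]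
  have h := traceNorm_add_le b (IsSelfAdjoint.of_nonneg hp) (IsSelfAdjoint.of_nonneg hq).neg
  have h1 : traceNorm b (-q) = traceNorm b q := by
    simpa using traceNorm_smul b (-1) q
  rwa [h1] at h

theorem enorm_sq_le_hsSq (A : H →L[ℂ] H) (v : H) : ‖A v‖ₑ ^ 2 ≤ hsSq b A * ‖v‖ₑ ^ 2 := by
  rw [enorm_sq_eq_tsum b, ← hsSq_adjoint, hsSq, ← ENNReal.tsum_mul_right]
  refine ENNReal.tsum_le_tsum fun m => ?_
  rw [ContinuousLinearMap.star_eq_adjoint, ← mul_pow,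
    ← ContinuousLinearMap.adjoint_inner_left]
  gcongr
  rw [← ofReal_norm, ← ofReal_norm, ← ofReal_norm, ← ENNReal.ofReal_mul (norm_nonneg _)]
  exact ENNReal.ofReal_le_ofReal (norm_inner_le_norm _ _)

/-- ‖p‖ = ‖√p‖², and the operator norm of √p is at most its Hilbert-Schmidt norm, whose square is tr
p. -/
theorem norm_le_posTrace {p : H →L[ℂ] H} (hp : 0 ≤ p) (ht : posTrace b p ≠ ⊤) :
    ‖p‖ ≤ (posTrace b p).toReal := by
  have hs : IsSelfAdjoint (CFC.sqrt p) := IsSelfAdjoint.of_nonneg (CFC.sqrt_nonneg p)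
  have h1 : ‖p‖ = ‖CFC.sqrt p‖ ^ 2 := by
    nth_rewrite 1 [← CFC.sqrt_mul_sqrt_self p hp]
    nth_rewrite 1 [← hs.star_eq]
    rw [CStarRing.norm_star_mul_self, pow_two]
  have h2 : ‖CFC.sqrt p‖ ≤ √(posTrace b p).toReal := by
    refine ContinuousLinearMap.opNorm_le_bound _ (Real.sqrt_nonneg _) fun v => ?_
    have h3 := enorm_sq_le_hsSq b (CFC.sqrt p) v
    rw [← posTrace_eq_hsSq b p hp, ← ofReal_norm, ← ofReal_norm,
      ← ENNReal.ofReal_pow (norm_nonneg _), ← ENNReal.ofReal_pow (norm_nonneg _),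
      ← ENNReal.ofReal_toReal ht, ← ENNReal.ofReal_mul ENNReal.toReal_nonneg,
      ENNReal.ofReal_le_ofReal_iff (by positivity)] at h3
    refine (sq_le_sq₀ (norm_nonneg _) (by positivity)).1 ?_
    rwa [mul_pow, Real.sq_sqrt ENNReal.toReal_nonneg]
  rw [h1]
  calc _ ≤ √(posTrace b p).toReal ^ 2 := by gcongr
    _ = _ := Real.sq_sqrt ENNReal.toReal_nonneg

theorem norm_le_traceNorm {A : H →L[ℂ] H} (ht : traceNorm b A ≠ ⊤) :
    ‖A‖ ≤ (traceNorm b A).toReal := by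
  rw [← CFC.norm_abs]
  exact norm_le_posTrace b (CFC.abs_nonneg A) ht

/-- The projection onto the span of `|0⟩, …, |n - 1⟩`. -/
def cutoff (n : ℕ) : H →L[ℂ] H :=
  ∑ m ∈ Finset.range n, InnerProductSpace.rankOne ℂ (b m) (b m)

theorem cutoff_basis (n m : ℕ) : cutoff b n (b m) = if m < n then b m else 0 := by
  rw [cutoff, sum_apply]
  simp only [InnerProductSpace.rankOne_apply, orthonormal_iff_ite.1 b.orthonormal]
  simp

theorem ext_basis {A B : H →L[ℂ] H} (h : ∀ n, A (b n) = B (b n)) : A = B :=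
  sub_eq_zero.1 (eq_zero_of_basis b fun n => by rw [sub_apply, h, sub_self])

theorem isSelfAdjoint_of_basis {A : H →L[ℂ] H}
    (h : ∀ n m, ⟪A (b n), b m⟫_ℂ = ⟪b n, A (b m)⟫_ℂ) : IsSelfAdjoint A := by
  refine ext_basis b fun n => b.repr.injective (lp.ext (funext fun m => ?_))
  rw [b.repr_apply_apply, b.repr_apply_apply, ContinuousLinearMap.star_eq_adjoint,
    ContinuousLinearMap.adjoint_inner_right, h]

theorem isSelfAdjoint_cutoff (n : ℕ) : IsSelfAdjoint (cutoff b n) := by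
  refine isSelfAdjoint_of_basis b fun k m => ?_
  rw [cutoff_basis, cutoff_basis]
  have := orthonormal_iff_ite.1 b.orthonormal k m
  by_cases hkm : k = m
  · subst hkm; split_ifs <;> simp
  · split_ifs <;> simp [this, hkm]

theorem cutoff_mul_cutoff (n : ℕ) : cutoff b n * cutoff b n = cutoff b n := by
  refine ext_basis b fun m => ?_
  rw [mul_apply_eq_comp, cutoff_basis]
  split_ifs with h
  · rw [cutoff_basis, if_pos h]
  · simp

theorem isStarProjection_cutoff (n : ℕ) : IsStarProjection (cutoff b n) :=
  ⟨cutoff_mul_cutoff b n, isSelfAdjoint_cutoff b n⟩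

theorem norm_cutoff_apply_le (n : ℕ) (x : H) : ‖cutoff b n x‖ ≤ ‖x‖ := by
  have h : ‖cutoff b n‖ ≤ 1 := (isStarProjection_cutoff b n).norm_le
  simpa using (cutoff b n).le_of_opNorm_le h x

theorem cutoff_numInvPow (n : ℕ) (s : ℝ≥0) (v : H) :
    cutoff b n (numInvPow b s v) = numInvPow b s (cutoff b n v) := by
  suffices cutoff b n * numInvPow b s = numInvPow b s * cutoff b n from
    congrArg (fun f : H →L[ℂ] H => f v) this
  refine ext_basis b fun m => ?_
  rw [mul_apply_eq_comp, mul_apply_eq_comp, numInvPow_basis, map_smul, cutoff_basis]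
  split_ifs
  · rw [numInvPow_basis]
  · simp

/-- The traces are the remainders of the convergent series that defines tr p. -/
theorem tendsto_posTrace_cutoff_compl {p : H →L[ℂ] H} (ht : posTrace b p ≠ ⊤) :
    Tendsto (fun n => posTrace b ((1 - cutoff b n) * p * (1 - cutoff b n))) atTop (𝓝 0) := by
  refine (ENNReal.tendsto_sum_nat_add _ ht).congr fun n => ?_
  have hsa : IsSelfAdjoint (1 - cutoff b n) := (IsSelfAdjoint.one _).sub (isSelfAdjoint_cutoff b n)
  have hb : ∀ m, (1 - cutoff b n) (b m) = if m < n then 0 else b m := fun m => by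
    rw [sub_apply, cutoff_basis, one_apply_eq_self]; split_ifs <;> simp
  have hi : ∀ m, ⟪b m, ((1 - cutoff b n) * p * (1 - cutoff b n)) (b m)⟫_ℂ =
      ⟪(1 - cutoff b n) (b m), p ((1 - cutoff b n) (b m))⟫_ℂ := fun m => by
    nth_rewrite 1 [mul_assoc, mul_apply_eq_comp, ← hsa.star_eq]
    rw [ContinuousLinearMap.star_eq_adjoint, ContinuousLinearMap.adjoint_inner_right,
      mul_apply_eq_comp]
  rw [posTrace, ← ENNReal.summable.sum_add_tsum_nat_add' (k := n)
    (f := fun m => ENNReal.ofReal (⟪b m, ((1 - cutoff b n) * p * (1 - cutoff b n)) (b m)⟫_ℂ).re),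
    Finset.sum_eq_zero, zero_add]
  · refine tsum_congr fun m => ?_
    rw [hi, hb, if_neg (by omega)]
  · intro m hm
    rw [hi, hb, if_pos (Finset.mem_range.1 hm)]
    simp

theorem conj_nonneg_of_isSelfAdjoint {p A : H →L[ℂ] H} (hp : 0 ≤ p) (hA : IsSelfAdjoint A) :
    0 ≤ A * p * A := by
  simpa [hA.star_eq] using star_left_conjugate_nonneg hp A

/-- Bound of the off-diagonal part `A p B + B p A` of a positive operator. -/
theorem traceNorm_offDiag_le {p A B : H →L[ℂ] H} (hp : 0 ≤ p) (hA : IsSelfAdjoint A)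
    (hB : IsSelfAdjoint B) {c : ℝ} (hc : 0 < c) :
    traceNorm b (A * p * B + B * p * A) ≤
      ENNReal.ofReal c * posTrace b (A * p * A) + ENNReal.ofReal c⁻¹ * posTrace b (B * p * B) := by
  -- With T = dA + d⁻¹B and U = dA - d⁻¹B, the off-diagonal part is ½(TpT - UpU), while ½(TpT + UpU)
  -- is diagonal: a weighted arithmetic-geometric inequality.
  set d := √c
  have hd : 0 < d := Real.sqrt_pos.2 hc
  have hdd : d * d = c := Real.mul_self_sqrt hc.le
  have hdc : d⁻¹ * d⁻¹ = c⁻¹ := by rw [← hdd, mul_inv]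
  have hd1 : d⁻¹ * d = 1 := inv_mul_cancel₀ hd.ne'
  set T := d • A + d⁻¹ • B with hT
  set U := d • A - d⁻¹ • B with hU
  have hA' : IsSelfAdjoint (d • A) := (IsSelfAdjoint.all d).smul hA
  have hB' : IsSelfAdjoint (d⁻¹ • B) := (IsSelfAdjoint.all d⁻¹).smul hB
  have hTp := conj_nonneg_of_isSelfAdjoint hp (hA'.add hB')
  have hUp := conj_nonneg_of_isSelfAdjoint hp (hA'.sub hB')
  have hp1 := conj_nonneg_of_isSelfAdjoint hp hA
  have hp2 := conj_nonneg_of_isSelfAdjoint hp hB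
  have e1 : A * p * B + B * p * A = (1 / 2 : ℝ) • (T * p * T) - (1 / 2 : ℝ) • (U * p * U) := by
    simp only [hT, hU, add_mul, mul_add, sub_mul, mul_sub, smul_mul_assoc, mul_smul_comm, smul_add,
      smul_sub, smul_smul]
    rw [mul_inv_cancel₀ hd.ne', hd1]
    module
  have e2 : (1 / 2 : ℝ) • (T * p * T) + (1 / 2 : ℝ) • (U * p * U) =
      c • (A * p * A) + c⁻¹ • (B * p * B) := by
    simp only [hT, hU, add_mul, mul_add, sub_mul, mul_sub, smul_mul_assoc, mul_smul_comm, smul_add,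
      smul_sub, smul_smul]
    rw [mul_inv_cancel₀ hd.ne', hd1, hdd, hdc]
    module
  rw [e1]
  refine (traceNorm_sub_le b (smul_nonneg (by norm_num) hTp) (smul_nonneg (by norm_num) hUp)).trans
    (le_of_eq ?_)
  rw [← posTrace_add b (smul_nonneg (by norm_num) hTp) (smul_nonneg (by norm_num) hUp), e2,
    posTrace_add b (smul_nonneg hc.le hp1) (smul_nonneg (inv_nonneg.2 hc.le) hp2),
    posTrace_smul b hc.le, posTrace_smul b (inv_nonneg.2 hc.le)]

/-- The off-diagonal blocks cost c tr p plus c⁻¹ times the trace of the corner (1-Q)p(1-Q), which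
tends to 0. So `c` is fixed first, then `n` is taken large. -/
theorem tendsto_traceNorm_sub_cutoff_of_nonneg {p : H →L[ℂ] H} (hp : 0 ≤ p)
    (ht : posTrace b p ≠ ⊤) :
    Tendsto (fun n => traceNorm b (p - cutoff b n * p * cutoff b n)) atTop (𝓝 0) := by
  have hb : ∀ n, ∀ c : ℝ, 0 < c → traceNorm b (p - cutoff b n * p * cutoff b n) ≤
      ENNReal.ofReal c * posTrace b p + (ENNReal.ofReal c⁻¹ + 1) *
        posTrace b ((1 - cutoff b n) * p * (1 - cutoff b n)) := by
    intro n c hc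
    have hQ : IsSelfAdjoint (cutoff b n) := isSelfAdjoint_cutoff b n
    have hQ' : IsSelfAdjoint (1 - cutoff b n) := (IsSelfAdjoint.one _).sub hQ
    set Q := cutoff b n
    have e : p - Q * p * Q = (Q * p * (1 - Q) + (1 - Q) * p * Q) + (1 - Q) * p * (1 - Q) := by
      noncomm_ring
    have hp2 := conj_nonneg_of_isSelfAdjoint hp hQ'
    have hoff : IsSelfAdjoint (Q * p * (1 - Q) + (1 - Q) * p * Q) := by
      have := (IsSelfAdjoint.of_nonneg hp).sub
        (IsSelfAdjoint.of_nonneg (conj_nonneg_of_isSelfAdjoint hp hQ))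
      rw [e] at this
      simpa using this.sub (IsSelfAdjoint.of_nonneg hp2)
    rw [e]
    refine (traceNorm_add_le b hoff (IsSelfAdjoint.of_nonneg hp2)).trans ?_
    rw [traceNorm_of_nonneg b hp2, add_mul, one_mul, ← add_assoc]
    gcongr
    refine (traceNorm_offDiag_le b hp hQ hQ' hc).trans ?_
    gcongr
    exact posTrace_conj_le b p Q hp hQ (norm_cutoff_apply_le b n)
  rw [ENNReal.tendsto_nhds_zero]
  intro ε hε
  obtain ⟨c, hc, hcε⟩ : ∃ c : ℝ, 0 < c ∧ ENNReal.ofReal c * posTrace b p ≤ ε / 2 := by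
    rcases eq_or_ne ε ⊤ with rfl | hεt
    · exact ⟨1, one_pos, by simp [ENNReal.top_div]⟩
    · have h0 : 0 < ε.toReal := ENNReal.toReal_pos hε.ne' hεt
      refine ⟨ε.toReal / 2 / ((posTrace b p).toReal + 1), by positivity, ?_⟩
      rw [← ENNReal.ofReal_toReal ht, ← ENNReal.ofReal_mul (by positivity)]
      refine ENNReal.ofReal_le_of_le_toReal ?_
      rw [ENNReal.toReal_div, ENNReal.toReal_ofNat, ENNReal.toReal_ofReal ENNReal.toReal_nonneg]
      rw [div_mul_eq_mul_div, div_le_iff₀ (by positivity)]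
      have : 0 ≤ (posTrace b p).toReal := ENNReal.toReal_nonneg
      nlinarith
  have hK : (ENNReal.ofReal c⁻¹ + 1) ≠ ⊤ := by simp
  have h1 := ENNReal.Tendsto.const_mul (tendsto_posTrace_cutoff_compl b ht)
    (Or.inr hK) (a := ENNReal.ofReal c⁻¹ + 1)
  rw [mul_zero] at h1
  filter_upwards [(ENNReal.tendsto_nhds_zero.1 h1) (ε / 2) (ENNReal.half_pos hε.ne')] with n hn
  calc _ ≤ _ := hb n c hc
    _ ≤ ε / 2 + ε / 2 := add_le_add hcε hn
    _ = ε := ENNReal.add_halves ε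

theorem posTrace_posPart_le_traceNorm {y : H →L[ℂ] H} (hy : IsSelfAdjoint y) :
    posTrace b y⁺ ≤ traceNorm b y := by rw [traceNorm_eq b hy]; exact le_self_add

theorem posTrace_negPart_le_traceNorm {y : H →L[ℂ] H} (hy : IsSelfAdjoint y) :
    posTrace b y⁻ ≤ traceNorm b y := by rw [traceNorm_eq b hy]; exact le_add_self

theorem tendsto_traceNorm_sub_cutoff {y : H →L[ℂ] H} (hy : IsSelfAdjoint y)
    (ht : traceNorm b y ≠ ⊤) :
    Tendsto (fun n => traceNorm b (y - cutoff b n * y * cutoff b n)) atTop (𝓝 0) := by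
  have h1 := tendsto_traceNorm_sub_cutoff_of_nonneg b (CFC.posPart_nonneg y)
    (ne_top_of_le_ne_top ht (posTrace_posPart_le_traceNorm b hy))
  have h2 := tendsto_traceNorm_sub_cutoff_of_nonneg b (CFC.negPart_nonneg y)
    (ne_top_of_le_ne_top ht (posTrace_negPart_le_traceNorm b hy))
  have h3 := h1.add h2
  rw [add_zero] at h3
  refine tendsto_of_tendsto_of_tendsto_of_le_of_le tendsto_const_nhds h3 (fun _ => zero_le)
    fun n => ?_
  have hQ : IsSelfAdjoint (cutoff b n) := isSelfAdjoint_cutoff b n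
  have hsa : ∀ p : H →L[ℂ] H, 0 ≤ p → IsSelfAdjoint (p - cutoff b n * p * cutoff b n) :=
    fun p hp => (IsSelfAdjoint.of_nonneg hp).sub
        (IsSelfAdjoint.of_nonneg (conj_nonneg_of_isSelfAdjoint hp hQ))
  have e : y - cutoff b n * y * cutoff b n = (y⁺ - cutoff b n * y⁺ * cutoff b n) +
      -(y⁻ - cutoff b n * y⁻ * cutoff b n) := by
    nth_rewrite 1 2 [← CFC.posPart_sub_negPart y hy]
    noncomm_ring
  rw [e]
  refine (traceNorm_add_le b (hsa _ (CFC.posPart_nonneg y))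
    (hsa _ (CFC.negPart_nonneg y)).neg).trans
    (le_of_eq ?_)
  congr 1
  simpa using traceNorm_smul b (-1) (y⁻ - cutoff b n * y⁻ * cutoff b n)

end TraceNormFacts

/-! ### The spaces W^{k,1}: completeness, density of `T_f`, embeddings, trace -/

section SobolevFacts
variable {H : Type*} [NormedAddCommGroup H] [InnerProductSpace ℂ H] [CompleteSpace H]
  (b : HilbertBasis ℕ ℂ H)

theorem isClosed_nonneg_op : IsClosed {A : H →L[ℂ] H | 0 ≤ A} := isClosed_Ici

theorem posTrace_tsum {p : ℕ → H →L[ℂ] H} (hp : ∀ n, 0 ≤ p n) (hs : Summable p) :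
    posTrace b (∑' n, p n) = ∑' n, posTrace b (p n) := by
  unfold posTrace
  rw [ENNReal.tsum_comm]
  refine tsum_congr fun m => ?_
  have h1 : HasSum (fun n => (⟪b m, p n (b m)⟫_ℂ).re) (⟪b m, (∑' n, p n) (b m)⟫_ℂ).re :=
    Complex.hasSum_re ((hs.hasSum.mapL (ContinuousLinearMap.apply ℂ H (b m))).mapL
      (innerSL ℂ (b m)))
  rw [← h1.tsum_eq, ENNReal.ofReal_tsum_of_nonneg (fun n => re_inner_nonneg (hp n) _) h1.summable]

/-- The trace dominates the operator norm, so the series converges in operator norm. Countable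
additivity of the trace on positive operators then identifies the trace of the remainder. -/
theorem exists_tendsto_traceNorm_of_nonneg {p : ℕ → H →L[ℂ] H} (hp : ∀ n, 0 ≤ p n)
    (ht : ∑' n, posTrace b (p n) ≠ ⊤) :
    ∃ P : H →L[ℂ] H, 0 ≤ P ∧ posTrace b P ≠ ⊤ ∧
      ∀ n, 0 ≤ P - ∑ i ∈ Finset.range n, p i ∧
      posTrace b (P - ∑ i ∈ Finset.range n, p i) = ∑' i, posTrace b (p (i + n)) := by
  have hs : Summable p := by
    refine Summable.of_norm_bounded (ENNReal.summable_toReal ht) fun n => ?_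
    exact norm_le_posTrace b (hp n) (ENNReal.ne_top_of_tsum_ne_top ht n)
  refine ⟨∑' n, p n, tsum_nonneg hp, by rwa [posTrace_tsum b hp hs], fun n => ?_⟩
  have e : ∑' n, p n - ∑ i ∈ Finset.range n, p i = ∑' i, p (i + n) := by
    rw [← hs.sum_add_tsum_nat_add n, add_sub_cancel_left]
  rw [e]
  exact ⟨tsum_nonneg fun i => hp _,
    posTrace_tsum b (fun i => hp _) ((summable_nat_add_iff n).2 hs)⟩

namespace Sobolev
variable {b} {k : ℝ≥0}

/-- Makes norms on `W^{k,1}` elaborate to the norm of its `NormedAddCommGroup` structure. -/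
local instance : Norm (Sobolev b k) := NormedAddCommGroup.toNorm

theorem norm_eq (x : Sobolev b k) :
    ‖x‖ = (traceNorm b (Sobolev.weight b k x : H →L[ℂ] H)).toReal := rfl

/-- The element `(N + 1)^(-k/4) y (N + 1)^(-k/4)` of `W^{k,1}`. -/
def mk (b : HilbertBasis ℕ ℂ H) (k : ℝ≥0) (y : traceClassSA b) : Sobolev b k :=
  (Sobolev.weight b k).symm y

theorem weight_mk (y : traceClassSA b) : Sobolev.weight b k (mk b k y) = y :=
  (Sobolev.weight b k).apply_symm_apply y

theorem op_mk (y : traceClassSA b) : (mk b k y).op = weightInv b k y := by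
  rw [← weightInv_weight, weight_mk]

theorem norm_mk (y : traceClassSA b) : ‖mk b k y‖ = (traceNorm b (y : H →L[ℂ] H)).toReal := by
  rw [norm_eq, weight_mk]

theorem op_injective : Function.Injective (op : Sobolev b k → (H →L[ℂ] H)) :=
  Subtype.val_injective

theorem isSelfAdjoint_op (x : Sobolev b k) : IsSelfAdjoint x.op := by
  rw [← weightInv_weight, IsSelfAdjoint, star_weightInv, (Sobolev.weight b k x).2.1.star_eq]

theorem ofReal_norm_eq (x : Sobolev b k) :
    ENNReal.ofReal ‖x‖ = traceNorm b (Sobolev.weight b k x : H →L[ℂ] H) := by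
  rw [norm_eq, ENNReal.ofReal_toReal (Sobolev.weight b k x).2.2]

theorem norm_numInvPow_apply_le (s : ℝ≥0) (v : H) : ‖numInvPow b s v‖ ≤ ‖v‖ := by
  have h : ‖numInvPow b s‖ ≤ 1 := LinearMap.mkContinuous_norm_le _ zero_le_one _
  simpa using (numInvPow b s).le_of_opNorm_le h v

theorem norm_op_le (x : Sobolev b k) : ‖x.op‖ ≤ ‖x‖ := by
  rw [← weightInv_weight, norm_eq]
  refine le_trans ?_ (norm_le_traceNorm b (Sobolev.weight b k x).2.2)
  refine ContinuousLinearMap.opNorm_le_bound _ (norm_nonneg _) fun v => ?_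
  change ‖numInvPow b (k / 4) ((Sobolev.weight b k x : H →L[ℂ] H) (numInvPow b (k / 4) v))‖ ≤ _
  refine (norm_numInvPow_apply_le _ _).trans ?_
  refine (ContinuousLinearMap.le_opNorm _ _).trans ?_
  gcongr
  exact norm_numInvPow_apply_le _ _

theorem continuous_op : Continuous (op : Sobolev b k → (H →L[ℂ] H)) :=
  (op.mkContinuous 1 fun x => by simpa using norm_op_le x).continuous

theorem isClosed_setOf_nonneg : IsClosed {x : Sobolev b k | 0 ≤ x.op} :=
  isClosed_nonneg_op.preimage continuous_op

/-- An absolutely convergent series is summed separately over the positive and the negative parts of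
the weighted operators, since for positive operators trace-norm remainders are remainders of the
traces. -/
instance : CompleteSpace (Sobolev b k) := by
  refine NormedAddCommGroup.completeSpace_of_summable_imp_tendsto fun u hu => ?_
  set y : ℕ → H →L[ℂ] H := fun n => Sobolev.weight b k (u n) with hy
  have hsa : ∀ n, IsSelfAdjoint (y n) := fun n => (Sobolev.weight b k (u n)).2.1
  have hsum : ∑' n, traceNorm b (y n) ≠ ⊤ := by
    have : ∀ n, traceNorm b (y n) = ENNReal.ofReal ‖u n‖ := fun n => (ofReal_norm_eq _).symm
    simp_rw [this]
    rw [← ENNReal.ofReal_tsum_of_nonneg (fun _ => norm_nonneg _) hu]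
    exact ENNReal.ofReal_ne_top
  have hpt : ∑' n, posTrace b (y n)⁺ ≠ ⊤ :=
    ne_top_of_le_ne_top hsum (ENNReal.tsum_le_tsum fun n =>
      posTrace_posPart_le_traceNorm b (hsa n))
  have hqt : ∑' n, posTrace b (y n)⁻ ≠ ⊤ :=
    ne_top_of_le_ne_top hsum (ENNReal.tsum_le_tsum fun n =>
      posTrace_negPart_le_traceNorm b (hsa n))
  obtain ⟨P, hP, hPt, hPn⟩ :=
    exists_tendsto_traceNorm_of_nonneg b (fun n => CFC.posPart_nonneg (y n)) hpt
  obtain ⟨Q, hQ, hQt, hQn⟩ :=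
    exists_tendsto_traceNorm_of_nonneg b (fun n => CFC.negPart_nonneg (y n)) hqt
  set z : traceClassSA b := ⟨P - Q, (IsSelfAdjoint.of_nonneg hP).sub (IsSelfAdjoint.of_nonneg hQ),
    ne_top_of_le_ne_top (ENNReal.add_ne_top.2 ⟨hPt, hQt⟩) (traceNorm_sub_le b hP hQ)⟩ with hz
  refine ⟨mk b k z, ?_⟩
  rw [tendsto_iff_norm_sub_tendsto_zero]
  have h0 := (ENNReal.tendsto_sum_nat_add _ hpt).add (ENNReal.tendsto_sum_nat_add _ hqt)
  rw [add_zero] at h0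
  have h1 := (ENNReal.tendsto_toReal (ENNReal.zero_ne_top)).comp h0
  refine squeeze_zero_norm' ?_ h1
  have hfin : ∀ᶠ n in atTop, (∑' i, posTrace b (y (i + n))⁺ + ∑' i, posTrace b (y (i + n))⁻) ≠ ⊤ :=
    (h0.eventually_lt_const ENNReal.zero_lt_top).mono fun n hn => hn.ne
  filter_upwards [hfin] with n hn
  rw [norm_norm, norm_sub_rev, norm_eq]
  refine ENNReal.toReal_mono hn ?_
  have e : ((Sobolev.weight b k (mk b k z - ∑ i ∈ Finset.range n, u i) : traceClassSA b) :
      H →L[ℂ] H) =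
      (P - ∑ i ∈ Finset.range n, (y i)⁺) - (Q - ∑ i ∈ Finset.range n, (y i)⁻) := by
    rw [map_sub, weight_mk, map_sum, Submodule.coe_sub, Submodule.coe_sum]
    have : ∀ i, ((Sobolev.weight b k (u i) : traceClassSA b) : H →L[ℂ] H) = (y i)⁺ - (y i)⁻ :=
      fun i => (CFC.posPart_sub_negPart (y i) (hsa i)).symm
    simp_rw [this]
    rw [Finset.sum_sub_distrib]
    exact sub_sub_sub_comm _ _ _ _
  change _ ≤ ∑' i, posTrace b (y (i + n))⁺ + ∑' i, posTrace b (y (i + n))⁻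
  rw [e, ← (hPn n).2, ← (hQn n).2]
  exact traceNorm_sub_le b (hPn n).1 (hQn n).1

theorem cutoff_weightInv (n : ℕ) (y : H →L[ℂ] H) :
    cutoff b n * weightInv b k y * cutoff b n = weightInv b k (cutoff b n * y * cutoff b n) := by
  ext v
  change cutoff b n (numInvPow b (k / 4) (y (numInvPow b (k / 4) (cutoff b n v)))) =
    numInvPow b (k / 4) (cutoff b n (y (cutoff b n (numInvPow b (k / 4) v))))
  rw [cutoff_numInvPow, cutoff_numInvPow]

theorem cutoff_conj_mem_finOp (n : ℕ) (y : H →L[ℂ] H) :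
    cutoff b n * y * cutoff b n ∈ finOp b := by
  have e : cutoff b n * y * cutoff b n = ∑ i ∈ Finset.range n, ∑ j ∈ Finset.range n,
      ⟪b i, y (b j)⟫_ℂ • InnerProductSpace.rankOne ℂ (b i) (b j) := by
    ext v
    rw [mul_apply_eq_comp, mul_apply_eq_comp]
    simp only [cutoff, sum_apply, InnerProductSpace.rankOne_apply, map_sum,
      map_smul, smul_apply, smul_smul]
    rw [Finset.sum_comm' (t' := Finset.range n) (s' := fun _ => Finset.range n) (by simp)]
    simp only [Finset.smul_sum, smul_smul]
    exact Finset.sum_congr rfl fun i _ => Finset.sum_congr rfl fun j _ => by rw [mul_comm]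
  rw [e]
  exact sum_mem fun i _ => sum_mem fun j _ =>
    Submodule.smul_mem _ _ (Submodule.subset_span ⟨(i, j), rfl⟩)

theorem cutoff_conj_mem_finOpSA (n : ℕ) {y : H →L[ℂ] H} (hy : IsSelfAdjoint y) :
    cutoff b n * y * cutoff b n ∈ finOpSA b := by
  refine ⟨?_, cutoff_conj_mem_finOp n y⟩
  have hQ := isSelfAdjoint_cutoff b n
  rw [IsSelfAdjoint, star_mul, star_mul, hQ.star_eq, hy.star_eq, mul_assoc]

/-- An operator of `T_f`, as an element of `W^{k,1}`. -/
def ofFin (k : ℝ≥0) : finOpSA b →ₗ[ℝ] Sobolev b k :=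
  Submodule.inclusion (finOpSA_le_sobolev b k)

theorem op_ofFin (x : finOpSA b) : (ofFin k x).op = x := rfl

/-- The truncation of `x`, as an operator of `T_f`. -/
def truncate (n : ℕ) (x : Sobolev b k) : finOpSA b :=
  ⟨cutoff b n * x.op * cutoff b n, cutoff_conj_mem_finOpSA n (isSelfAdjoint_op x)⟩

/-- The weights commute with the cutoff, so truncation in W^{k,1} is truncation of the weighted
operator in trace norm. -/
theorem tendsto_truncate (x : Sobolev b k) :
    Tendsto (fun n => ofFin k (truncate n x)) atTop (𝓝 x) := by
  rw [tendsto_iff_norm_sub_tendsto_zero]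
  have hw := (Sobolev.weight b k x).2
  have h := tendsto_traceNorm_sub_cutoff b hw.1 hw.2
  have h1 := (ENNReal.tendsto_toReal (ENNReal.zero_ne_top)).comp h
  refine h1.congr fun n => ?_
  rw [norm_sub_rev, norm_eq, Function.comp_apply]
  congr 2
  apply weightInv_injective b k
  rw [weightInv_weight, map_sub, map_sub, op_ofFin, ← cutoff_weightInv, weightInv_weight]
  rfl

theorem denseRange_ofFin (k : ℝ≥0) : DenseRange (ofFin k : finOpSA b → Sobolev b k) := fun x =>
  mem_closure_of_tendsto (tendsto_truncate x) (Eventually.of_forall fun _ => ⟨_, rfl⟩)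

theorem truncate_nonneg (n : ℕ) {x : Sobolev b k} (hx : 0 ≤ x.op) :
    0 ≤ (truncate n x : H →L[ℂ] H) :=
  conj_nonneg_of_isSelfAdjoint hx (isSelfAdjoint_cutoff b n)

theorem numInvPow_mul_numInvPow (s t : ℝ≥0) (v : H) :
    numInvPow b s (numInvPow b t v) = numInvPow b (s + t) v := by
  suffices numInvPow b s * numInvPow b t = numInvPow b (s + t) from
    congrArg (fun f : H →L[ℂ] H => f v) this
  refine ext_basis b fun m => ?_
  rw [mul_apply_eq_comp, numInvPow_basis, map_smul, numInvPow_basis, numInvPow_basis, smul_smul,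
    ← Complex.ofReal_mul, ← Real.rpow_add (by positivity), NNReal.coe_add, neg_add,
    add_comm (-(t : ℝ))]

theorem isSelfAdjoint_numInvPow (s : ℝ≥0) : IsSelfAdjoint (numInvPow b s) := by
  refine isSelfAdjoint_of_basis b fun n m => inner_numInvPow b s _ _

theorem traceNorm_conj_le {y D : H →L[ℂ] H} (hy : IsSelfAdjoint y) (hD : IsSelfAdjoint D)
    (hD1 : ∀ v, ‖D v‖ ≤ ‖v‖) : traceNorm b (D * y * D) ≤ traceNorm b y := by
  nth_rewrite 1 [← CFC.posPart_sub_negPart y hy]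
  rw [mul_sub, sub_mul, traceNorm_eq b hy]
  refine (traceNorm_sub_le b (conj_nonneg_of_isSelfAdjoint (CFC.posPart_nonneg y) hD)
    (conj_nonneg_of_isSelfAdjoint (CFC.negPart_nonneg y) hD)).trans ?_
  exact add_le_add (posTrace_conj_le b _ _ (CFC.posPart_nonneg y) hD hD1)
    (posTrace_conj_le b _ _ (CFC.negPart_nonneg y) hD hD1)

/-- The operator (N+1)^(-k'/4) factors as (N+1)^(-k/4) times the contraction (N+1)^(-(k'-k)/4), and
conjugation by a self-adjoint contraction does not increase the trace norm. -/
theorem exists_inclusion {k k' : ℝ≥0} (h : k ≤ k') (x : Sobolev b k') :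
    ∃ z : Sobolev b k, z.op = x.op ∧ ‖z‖ ≤ ‖x‖ := by
  set y := Sobolev.weight b k' x
  set D := numInvPow b ((k' - k) / 4)
  have hD : IsSelfAdjoint D := isSelfAdjoint_numInvPow _
  have hle := traceNorm_conj_le (b := b) y.2.1 hD (norm_numInvPow_apply_le _)
  have hsa : IsSelfAdjoint (D * (y : H →L[ℂ] H) * D) := by
    rw [IsSelfAdjoint, star_mul, star_mul, hD.star_eq, y.2.1.star_eq, mul_assoc]
  refine ⟨mk b k ⟨D * (y : H →L[ℂ] H) * D, hsa, ne_top_of_le_ne_top y.2.2 hle⟩, ?_, ?_⟩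
  · rw [op_mk, ← weightInv_weight]
    ext v
    change numInvPow b (k / 4) (D ((y : H →L[ℂ] H) (D (numInvPow b (k / 4) v)))) =
      numInvPow b (k' / 4) ((y : H →L[ℂ] H) (numInvPow b (k' / 4) v))
    have e1 : k / 4 + (k' - k) / 4 = k' / 4 := by
      rw [← add_div, add_tsub_cancel_of_le h]
    rw [numInvPow_mul_numInvPow, numInvPow_mul_numInvPow, add_comm _ (k / 4), e1]
  · rw [norm_mk, norm_eq]
    exact ENNReal.toReal_mono y.2.2 hle

/-- The embedding of `W^{k',1}` into `W^{k,1}`, for `k ≤ k'`. -/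
def inclusion {k k' : ℝ≥0} (h : k ≤ k') : Sobolev b k' →L[ℝ] Sobolev b k :=
  LinearMap.mkContinuous
    { toFun := fun x => (exists_inclusion h x).choose
      map_add' := fun x y => op_injective ((exists_inclusion h (x + y)).choose_spec.1.trans (by
        rw [map_add, map_add, (exists_inclusion h x).choose_spec.1,
          (exists_inclusion h y).choose_spec.1]))
      map_smul' := fun c x => op_injective ((exists_inclusion h (c • x)).choose_spec.1.trans (by
        rw [map_smul, map_smul, (exists_inclusion h x).choose_spec.1, RingHom.id_apply])) }
    1 fun x => by rw [one_mul]; exact (exists_inclusion h x).choose_spec.2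

theorem op_inclusion {k k' : ℝ≥0} (h : k ≤ k') (x : Sobolev b k') : (inclusion h x).op = x.op :=
  (exists_inclusion h x).choose_spec.1

theorem weightInv_zero (y : H →L[ℂ] H) : weightInv b 0 y = y := by
  have h : numInvPow b (0 / 4) = 1 := ext_basis b fun n => by
    rw [numInvPow_basis]; simp
  ext v
  change numInvPow b (0 / 4) (y (numInvPow b (0 / 4) v)) = y v
  rw [h]; rfl

theorem op_eq_weight_zero (x : Sobolev b 0) : x.op = Sobolev.weight b 0 x := by
  rw [← weightInv_weight, weightInv_zero]

theorem summable_inner_of_nonneg {p : H →L[ℂ] H} (hp : 0 ≤ p) (ht : posTrace b p ≠ ⊤) :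
    Summable (fun n => ‖⟪b n, p (b n)⟫_ℂ‖) ∧
      ∑' n, ‖⟪b n, p (b n)⟫_ℂ‖ = (posTrace b p).toReal := by
  have h1 : ∀ n, ‖⟪b n, p (b n)⟫_ℂ‖ = (ENNReal.ofReal (⟪b n, p (b n)⟫_ℂ).re).toReal := fun n => by
    rw [ENNReal.toReal_ofReal (re_inner_nonneg hp _)]
    have h2 := ((ContinuousLinearMap.nonneg_iff_isPositive p).1 hp).inner_nonneg_right (b n)
    exact (Complex.re_eq_norm.2 h2).symm
  simp_rw [h1]
  exact ⟨ENNReal.summable_toReal ht, (ENNReal.tsum_toReal_eq fun _ => ENNReal.ofReal_ne_top).symm⟩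

theorem summable_inner {y : H →L[ℂ] H} (hy : IsSelfAdjoint y) (ht : traceNorm b y ≠ ⊤) :
    Summable (fun n => ⟪b n, y (b n)⟫_ℂ) ∧ ‖opTrace b y‖ ≤ (traceNorm b y).toReal := by
  have hpt := ne_top_of_le_ne_top ht (posTrace_posPart_le_traceNorm b hy)
  have hqt := ne_top_of_le_ne_top ht (posTrace_negPart_le_traceNorm b hy)
  obtain ⟨h1, h1'⟩ := summable_inner_of_nonneg (CFC.posPart_nonneg y) hpt
  obtain ⟨h2, h2'⟩ := summable_inner_of_nonneg (CFC.negPart_nonneg y) hqt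
  have e : ∀ n, ⟪b n, y (b n)⟫_ℂ = ⟪b n, y⁺ (b n)⟫_ℂ - ⟪b n, y⁻ (b n)⟫_ℂ := fun n => by
    nth_rewrite 1 [← CFC.posPart_sub_negPart y hy]
    rw [sub_apply, inner_sub_right]
  have hs : Summable fun n => ⟪b n, y (b n)⟫_ℂ := by
    simp_rw [e]
    exact h1.of_norm.sub h2.of_norm
  refine ⟨hs, ?_⟩
  rw [traceNorm_eq b hy, ENNReal.toReal_add hpt hqt, ← h1', ← h2', ← h1.tsum_add h2]
  refine tsum_of_norm_bounded (h1.add h2).hasSum fun n => ?_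
  rw [e]
  exact norm_sub_le _ _

/-- The trace, as a continuous linear functional on `W^{0,1}`. -/
def traceL (b : HilbertBasis ℕ ℂ H) : Sobolev b 0 →L[ℝ] ℂ :=
  LinearMap.mkContinuous
    { toFun := fun x => opTrace b x.op
      map_add' := fun x y => by
        have hx := (Sobolev.weight b 0 x).2
        have hy := (Sobolev.weight b 0 y).2
        rw [op_eq_weight_zero, op_eq_weight_zero, op_eq_weight_zero, map_add, opTrace, opTrace,
          opTrace]
        refine Eq.trans ?_ ((summable_inner hx.1 hx.2).1.tsum_add (summable_inner hy.1 hy.2).1)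
        exact tsum_congr fun n => by rw [Submodule.coe_add, add_apply, inner_add_right]
      map_smul' := fun c x => by
        have hx := (Sobolev.weight b 0 x).2
        rw [op_eq_weight_zero, op_eq_weight_zero, map_smul, opTrace, opTrace, RingHom.id_apply]
        refine Eq.trans ?_ ((summable_inner hx.1 hx.2).1.tsum_const_smul c)
        exact tsum_congr fun n => by
          rw [Submodule.coe_smul, smul_apply, inner_smul_right_eq_smul] }
    1 fun x => by
      rw [one_mul, norm_eq]
      change ‖opTrace b x.op‖ ≤ _
      rw [op_eq_weight_zero]
      exact (summable_inner (Sobolev.weight b 0 x).2.1 (Sobolev.weight b 0 x).2.2).2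

end Sobolev
end SobolevFacts

/-! ### Weighted quadratic forms and weighted traces -/

section WeightedForms
variable {H : Type*} [NormedAddCommGroup H] [InnerProductSpace ℂ H] [CompleteSpace H]
  {b : HilbertBasis ℕ ℂ H}

/-- The diagonal operator `|n⟩ ↦ w n |n⟩` on `H_f`. -/
def diag (b : HilbertBasis ℕ ℂ H) (w : ℕ → ℝ) : Module.End ℂ (finVec b) :=
  (fock b).constr ℂ fun n => ((w n : ℝ) : ℂ) • fock b n

theorem diag_fock (w : ℕ → ℝ) (n : ℕ) : diag b w (fock b n) = ((w n : ℝ) : ℂ) • fock b n :=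
  Module.Basis.constr_basis _ _ _ _

theorem isFormalAdjoint_diag (w : ℕ → ℝ) : IsFormalAdjoint b (diag b w) (diag b w) := by
  refine isFormalAdjoint_of_fock b fun n m => ?_
  rw [diag_fock, diag_fock, inner_smul_left, inner_smul_right, inner_fock, Complex.conj_ofReal]
  split_ifs with h
  · rw [h]
  · simp

theorem inner_fock_diag (w : ℕ → ℝ) (n : ℕ) (u : finVec b) :
    ⟪fock b n, diag b w u⟫_ℂ = (w n : ℂ) * ⟪fock b n, u⟫_ℂ := by
  rw [← isFormalAdjoint_diag, diag_fock, inner_smul_left, Complex.conj_ofReal]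

theorem ext_inner_fock {u v : finVec b} (h : ∀ n, ⟪fock b n, u⟫_ℂ = ⟪fock b n, v⟫_ℂ) : u = v := by
  refine Subtype.ext (b.repr.injective (lp.ext (funext fun n => ?_)))
  have := h n
  rw [Submodule.coe_inner, Submodule.coe_inner, coe_fock] at this
  rw [b.repr_apply_apply, b.repr_apply_apply, this]

theorem exists_inner_fock_eq_zero (u : finVec b) : ∃ M, ∀ n ≥ M, ⟪fock b n, u⟫_ℂ = 0 := by
  induction u using fock_induction b with
  | basis m => exact ⟨m + 1, fun n hn => by rw [inner_fock, if_neg (by omega)]⟩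
  | zero => exact ⟨0, fun n _ => inner_zero_right _⟩
  | add u v hu hv =>
    obtain ⟨M, hM⟩ := hu
    obtain ⟨M', hM'⟩ := hv
    exact ⟨max M M', fun n hn => by
      rw [inner_add_right, hM n (le_trans (le_max_left _ _) hn),
        hM' n (le_trans (le_max_right _ _) hn), add_zero]⟩
  | smul c u hu =>
    obtain ⟨M, hM⟩ := hu
    exact ⟨M, fun n hn => by rw [inner_smul_right, hM n hn, mul_zero]⟩

theorem hasSum_inner_fock (u v : finVec b) :
    HasSum (fun n => ⟪u, fock b n⟫_ℂ * ⟪fock b n, v⟫_ℂ) ⟪u, v⟫_ℂ := by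
  have h := b.hasSum_inner_mul_inner (u : H) (v : H)
  simp only [Submodule.coe_inner, coe_fock]
  exact h

/-- The quadratic form of the diagonal operator with the weights `w`. -/
def wq (w : ℕ → ℝ) (u : finVec b) : ℝ := (⟪u, diag b w u⟫_ℂ).re

theorem hasSum_wq (w : ℕ → ℝ) (u : finVec b) :
    HasSum (fun n => w n * ‖⟪fock b n, u⟫_ℂ‖ ^ 2) (wq w u) := by
  have h := Complex.hasSum_re (hasSum_inner_fock u (diag b w u))
  rw [wq]
  convert h using 1
  ext n
  rw [inner_fock_diag, mul_left_comm, ← inner_conj_symm u, mul_comm (starRingEnd ℂ _),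
    Complex.mul_conj, Complex.normSq_eq_norm_sq, Complex.re_ofReal_mul, Complex.ofReal_re]

theorem wq_mono {w w' : ℕ → ℝ} (h : ∀ n, w n ≤ w' n) (u : finVec b) : wq w u ≤ wq w' u :=
  hasSum_le (fun n => by have := h n; gcongr) (hasSum_wq w u) (hasSum_wq w' u)

theorem wq_nonneg {w : ℕ → ℝ} (h : ∀ n, 0 ≤ w n) (u : finVec b) : 0 ≤ wq w u :=
  (hasSum_wq w u).nonneg fun n => mul_nonneg (h n) (sq_nonneg _)

theorem wq_const_mul (c : ℝ) (w : ℕ → ℝ) (u : finVec b) :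
    wq (fun n => c * w n) u = c * wq w u := by
  refine (hasSum_wq _ u).unique ?_
  simp only [mul_assoc]
  exact (hasSum_wq w u).mul_left c

theorem wq_diag (w v : ℕ → ℝ) (u : finVec b) :
    wq w (diag b v u) = wq (fun n => w n * v n ^ 2) u := by
  refine (hasSum_wq _ _).unique ?_
  convert hasSum_wq _ u using 1
  ext n
  rw [inner_fock_diag, norm_mul, Complex.norm_real, mul_pow, Real.norm_eq_abs, sq_abs, mul_assoc]

theorem wq_one (u : finVec b) : wq (fun _ => 1) u = ‖u‖ ^ 2 := by
  have : diag b (fun _ => 1) u = u := ext_inner_fock fun n => by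
    rw [inner_fock_diag]; simp
  rw [wq, this, inner_self_eq_norm_sq_to_K]
  norm_cast

/-- A functional that depends linearly on finitely many values of the weight. -/
def IsFinForm (F : (ℕ → ℝ) → ℝ) : Prop :=
  ∃ (S : Finset ℕ) (c : ℕ → ℝ), ∀ w, F w = ∑ n ∈ S, w n * c n

/-- Since `v` has finitely many Fock coefficients, only finitely many weights enter. This later
permits integrating over a family of weights under the form. -/
theorem isFinForm_inner (u v : finVec b) : IsFinForm fun w => (⟪diag b w u, v⟫_ℂ).re := by
  obtain ⟨M, hM⟩ := exists_inner_fock_eq_zero v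
  refine ⟨Finset.range M, fun n => (⟪u, fock b n⟫_ℂ * ⟪fock b n, v⟫_ℂ).re, fun w => ?_⟩
  have h := Complex.hasSum_re (hasSum_inner_fock (diag b w u) v)
  have e : ∀ n, (⟪diag b w u, fock b n⟫_ℂ * ⟪fock b n, v⟫_ℂ).re =
      w n * (⟪u, fock b n⟫_ℂ * ⟪fock b n, v⟫_ℂ).re := fun n => by
    rw [isFormalAdjoint_diag, diag_fock, inner_smul_right, mul_assoc, Complex.re_ofReal_mul]
  simp only [e] at h
  beta_reduce
  rw [← h.tsum_eq]
  refine tsum_eq_sum fun n hn => ?_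
  rw [hM n (by simpa using hn)]
  simp

theorem isFinForm_wq (u : finVec b) : IsFinForm fun w => wq w u := by
  obtain ⟨S, c, h⟩ := isFinForm_inner u u
  refine ⟨S, c, fun w => ?_⟩
  beta_reduce at h ⊢
  rw [← h w, isFormalAdjoint_diag]
  rfl

theorem IsFinForm.add {F G : (ℕ → ℝ) → ℝ} (hF : IsFinForm F) (hG : IsFinForm G) :
    IsFinForm fun w => F w + G w := by
  obtain ⟨S, c, h⟩ := hF
  obtain ⟨T, d, h'⟩ := hG
  refine ⟨S ∪ T, fun n => (if n ∈ S then c n else 0) + (if n ∈ T then d n else 0), fun w => ?_⟩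
  beta_reduce
  rw [h, h']
  simp only [mul_add, Finset.sum_add_distrib, mul_ite, mul_zero]
  rw [← Finset.sum_filter, ← Finset.sum_filter]
  congr 2
  · ext n; simp +contextual
  · ext n; simp +contextual

theorem IsFinForm.const_mul {F : (ℕ → ℝ) → ℝ} (a : ℝ) (hF : IsFinForm F) :
    IsFinForm fun w => a * F w := by
  obtain ⟨S, c, h⟩ := hF
  refine ⟨S, fun n => a * c n, fun w => ?_⟩
  beta_reduce
  rw [h, Finset.mul_sum]
  exact Finset.sum_congr rfl fun n _ => by ring

theorem IsFinForm.sum {ι : Type*} (s : Finset ι) {F : ι → (ℕ → ℝ) → ℝ}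
    (hF : ∀ i, IsFinForm (F i)) : IsFinForm fun w => ∑ i ∈ s, F i w := by
  classical
  induction s using Finset.induction_on with
  | empty => exact ⟨∅, 0, fun w => by simp⟩
  | insert i s hi ih => simp only [Finset.sum_insert hi]; exact (hF i).add ih

/-- `|u⟩⟨u|` as an operator of `T_f`. -/
def rk (u : finVec b) : finOpSA b :=
  ⟨InnerProductSpace.rankOne ℂ (u : H) (u : H),
    (InnerProductSpace.isPositive_rankOne_self (u : H)).isSelfAdjoint, rankOne_mem_finOp b u u⟩

theorem rk_nonneg (u : finVec b) : 0 ≤ (rk u : H →L[ℂ] H) :=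
  (ContinuousLinearMap.nonneg_iff_isPositive _).2
    (InnerProductSpace.isPositive_rankOne_self (u : H))

/-- `|u⟩⟨v| + |v⟩⟨u|` as an operator of `T_f`. -/
def symRk (u v : finVec b) : finOpSA b := rk (u + v) - rk u - rk v

theorem coe_rk_apply (u : finVec b) (v : H) : (rk u : H →L[ℂ] H) v = ⟪(u : H), v⟫_ℂ • (u : H) := rfl

theorem coe_symRk_apply (u v : finVec b) (x : H) :
    (symRk u v : H →L[ℂ] H) x = ⟪(u : H), x⟫_ℂ • (v : H) + ⟪(v : H), x⟫_ℂ • (u : H) := by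
  rw [symRk, AddSubgroupClass.coe_sub, AddSubgroupClass.coe_sub, sub_apply, sub_apply,
    coe_rk_apply, coe_rk_apply, coe_rk_apply, Submodule.coe_add, inner_add_left, add_smul,
    smul_add, smul_add]
  abel

theorem exists_apply_eq_zero (x : finOpSA b) : ∃ M, ∀ n ≥ M, (x : H →L[ℂ] H) (b n) = 0 := by
  obtain ⟨x, hs, hx⟩ := x
  change ∃ M, ∀ n ≥ M, x (b n) = 0
  clear hs
  induction hx using Submodule.span_induction with
  | mem y hy =>
    obtain ⟨⟨k, m⟩, rfl⟩ := hy
    refine ⟨m + 1, fun n hn => ?_⟩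
    rw [InnerProductSpace.rankOne_apply, orthonormal_iff_ite.1 b.orthonormal m n,
      if_neg (by omega), zero_smul]
  | zero => exact ⟨0, fun _ _ => rfl⟩
  | add x y _ _ ihx ihy =>
    obtain ⟨M, hM⟩ := ihx
    obtain ⟨M', hM'⟩ := ihy
    exact ⟨max M M', fun n hn => by
      rw [add_apply, hM n (le_trans (le_max_left _ _) hn),
        hM' n (le_trans (le_max_right _ _) hn), add_zero]⟩
  | smul c x _ ihx =>
    obtain ⟨M, hM⟩ := ihx
    exact ⟨M, fun n hn => by rw [smul_apply, hM n hn, smul_zero]⟩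

theorem summable_mom (w : ℕ → ℝ) (x : finOpSA b) :
    Summable fun n => w n * (⟪b n, (x : H →L[ℂ] H) (b n)⟫_ℂ).re := by
  obtain ⟨M, hM⟩ := exists_apply_eq_zero x
  refine summable_of_ne_finset_zero (s := Finset.range M) fun n hn => ?_
  rw [hM n (by simpa using hn)]
  simp

/-- The weighted trace `∑ₙ w n ⟨n|x|n⟩`. -/
def mom (w : ℕ → ℝ) : finOpSA b →ₗ[ℝ] ℝ where
  toFun x := ∑' n, w n * (⟪b n, (x : H →L[ℂ] H) (b n)⟫_ℂ).re
  map_add' x y := by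
    rw [← (summable_mom w x).tsum_add (summable_mom w y)]
    refine tsum_congr fun n => ?_
    rw [Submodule.coe_add, add_apply, inner_add_right, Complex.add_re, mul_add]
  map_smul' c x := by
    rw [RingHom.id_apply, smul_eq_mul, ← tsum_mul_left]
    refine tsum_congr fun n => ?_
    rw [Submodule.coe_smul, smul_apply, inner_smul_right_eq_smul, Complex.real_smul,
      Complex.re_ofReal_mul]
    ring

theorem mom_apply (w : ℕ → ℝ) (x : finOpSA b) :
    mom w x = ∑' n, w n * (⟪b n, (x : H →L[ℂ] H) (b n)⟫_ℂ).re := rfl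

theorem mom_nonneg {w : ℕ → ℝ} (hw : ∀ n, 0 ≤ w n) {x : finOpSA b}
    (hx : 0 ≤ (x : H →L[ℂ] H)) : 0 ≤ mom w x :=
  tsum_nonneg fun n => mul_nonneg (hw n) (re_inner_nonneg hx _)

/-- The weights of the moment `tr [x (N + 1)^(k/2)]`. -/
def momWeight (k : ℝ) (n : ℕ) : ℝ := (n + 1 : ℝ) ^ (k / 2)

theorem momWeight_pos (k : ℝ) (n : ℕ) : 0 < momWeight k n := Real.rpow_pos_of_pos (by positivity) _

theorem momWeight_mono {k k' : ℝ} (h : k ≤ k') (n : ℕ) : momWeight k n ≤ momWeight k' n :=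
  Real.rpow_le_rpow_of_exponent_le (by simp) (by linarith)

theorem moment_eq_mom (k : ℝ) (x : finOpSA b) : moment b (k / 2) x = mom (momWeight k) x := by
  obtain ⟨M, hM⟩ := exists_apply_eq_zero x
  have e : ∀ n, ⟪fock b n, (toEnd x * numPow b (k / 2)) (fock b n)⟫_ℂ =
      ((momWeight k n : ℝ) : ℂ) * ⟪b n, (x : H →L[ℂ] H) (b n)⟫_ℂ := fun n => by
    have : numPow b (k / 2) (fock b n) = ((momWeight k n : ℝ) : ℂ) • fock b n :=
      Module.Basis.constr_basis _ _ _ _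
    rw [Module.End.mul_apply, this, map_smul, inner_smul_right, Submodule.coe_inner, coe_toEnd,
      coe_fock]
  rw [moment, endTrace, mom_apply]
  simp_rw [e]
  rw [Complex.re_tsum]
  · exact tsum_congr fun n => Complex.re_ofReal_mul _ _
  · refine summable_of_ne_finset_zero (s := Finset.range M) fun n hn => ?_
    rw [hM n (by simpa using hn)]
    simp

theorem mom_rk (w : ℕ → ℝ) (u : finVec b) : mom w (rk u) = wq w u := by
  rw [← (hasSum_wq w u).tsum_eq, mom_apply]
  refine tsum_congr fun n => ?_
  rw [coe_rk_apply, inner_smul_right, ← inner_conj_symm (u : H), mul_comm (starRingEnd ℂ _),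
    Complex.mul_conj, Complex.normSq_eq_norm_sq, Complex.ofReal_re, Submodule.coe_inner, coe_fock]

theorem wq_add (w : ℕ → ℝ) (u v : finVec b) :
    wq w (u + v) = wq w u + wq w v + 2 * (⟪diag b w u, v⟫_ℂ).re := by
  have h : (⟪v, diag b w u⟫_ℂ).re = (⟪diag b w u, v⟫_ℂ).re := by
    rw [← inner_conj_symm, Complex.conj_re]
  rw [wq, wq, wq, map_add, inner_add_left, inner_add_right, inner_add_right,
    ← isFormalAdjoint_diag w u v]
  simp only [Complex.add_re]
  rw [h]
  ring

theorem mom_symRk (w : ℕ → ℝ) (u v : finVec b) :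
    mom w (symRk u v) = 2 * (⟪diag b w u, v⟫_ℂ).re := by
  rw [symRk, map_sub, map_sub, mom_rk, mom_rk, mom_rk, wq_add]
  ring

end WeightedForms

/-! ### The generator on rank-one operators -/

namespace GKSL
variable {H : Type*} [NormedAddCommGroup H] [InnerProductSpace ℂ H] [CompleteSpace H]
  {b : HilbertBasis ℕ ℂ H} (𝓛 : GKSL b)

/-- The operator `-i H - ½ ∑ⱼ Lⱼ† Lⱼ`. -/
def drift : Module.End ℂ (finVec b) :=
  -(Complex.I • 𝓛.ham) - (1 / 2 : ℂ) • ∑ j, 𝓛.jumpAdj j * 𝓛.jump j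

/-- The Hamiltonian and anticommutator terms combine into |Gu⟩⟨u| + |u⟩⟨Gu|, with G the drift. In
this form each moment of the generator is a sum of quadratic expressions in `u`. -/
theorem gen_rk (u : finVec b) :
    𝓛.gen (rk u) = symRk u (𝓛.drift u) + ∑ j, rk (𝓛.jump j u) := by
  apply toEnd_injective
  rw [toEnd_gen]
  refine LinearMap.ext fun v => Subtype.ext ?_
  have hrk : ∀ (u v : finVec b), toEnd (rk u) v = ⟪u, v⟫_ℂ • u := fun u v => rfl
  have hsum : ((toEnd (symRk u (𝓛.drift u) + ∑ j, rk (𝓛.jump j u)) v : finVec b) : H) =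
      ((⟪u, v⟫_ℂ • 𝓛.drift u + ⟪𝓛.drift u, v⟫_ℂ • u +
        ∑ j, ⟪𝓛.jump j u, v⟫_ℂ • 𝓛.jump j u : finVec b) : H) := by
    rw [coe_toEnd, Submodule.coe_add, add_apply, coe_symRk_apply, AddSubmonoidClass.coe_finsetSum,
      sum_apply]
    push_cast
    rfl
  rw [hsum]
  congr 1
  have hH := 𝓛.ham_adj
  have hJ := 𝓛.jump_adj
  have hJ' := fun j => (𝓛.jump_adj j).symm
  simp only [lindblad, drift, LinearMap.add_apply, LinearMap.neg_apply, LinearMap.smul_apply,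
    LinearMap.sub_apply, LinearMap.sum_apply, Module.End.mul_apply, hrk, map_smul,
    inner_sub_left, inner_neg_left, inner_smul_left, sum_inner, smul_sub,
    smul_add, Finset.sum_sub_distrib, smul_neg, sub_smul, neg_smul, Finset.sum_add_distrib,
    ← Finset.smul_sum, Finset.sum_smul, Finset.mul_sum, Complex.conj_I, map_div₀, map_one,
    map_ofNat, mul_smul]
  -- With all operators moved into the second argument of the inner products, both sides are the
  -- same sum.
  have h1 : ∀ v, ⟪𝓛.ham u, v⟫_ℂ = ⟪u, 𝓛.ham v⟫_ℂ := fun v => hH u v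
  have h2 : ∀ j v, ⟪𝓛.jump j u, v⟫_ℂ = ⟪u, 𝓛.jumpAdj j v⟫_ℂ := fun j v => hJ j u v
  have h3 : ∀ j v, ⟪𝓛.jumpAdj j (𝓛.jump j u), v⟫_ℂ = ⟪u, 𝓛.jumpAdj j (𝓛.jump j v)⟫_ℂ :=
    fun j v => by rw [hJ' j, hJ j]
  simp only [h1, h2, h3]
  rw [smul_comm (⟪u, v⟫_ℂ) Complex.I, smul_comm (⟪u, v⟫_ℂ) (1 / 2 : ℂ)]
  abel_nf

/-- This is tr 𝓛(|u⟩⟨u|) = 0: the Hamiltonian contributes an imaginary number, and the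
anticommutator takes away what the jumps add. -/
theorem two_mul_re_inner_drift (u : finVec b) :
    2 * (⟪u, 𝓛.drift u⟫_ℂ).re + ∑ j, ‖𝓛.jump j u‖ ^ 2 = 0 := by
  have h1 : (Complex.I * ⟪u, 𝓛.ham u⟫_ℂ).re = 0 := by
    have := 𝓛.ham_adj u u
    rw [← inner_conj_symm, Complex.conj_eq_iff_im] at this
    rw [Complex.I_mul_re, this, neg_zero]
  have h2 : ∀ j, (⟪u, 𝓛.jumpAdj j (𝓛.jump j u)⟫_ℂ).re = ‖𝓛.jump j u‖ ^ 2 := fun j => by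
    rw [← 𝓛.jump_adj j, inner_self_eq_norm_sq_to_K]
    norm_cast
  have h3 : (1 / 2 : ℂ) = ((1 / 2 : ℝ) : ℂ) := by push_cast; rfl
  rw [drift, LinearMap.sub_apply, LinearMap.neg_apply, LinearMap.smul_apply, LinearMap.smul_apply,
    LinearMap.sum_apply, inner_sub_right, inner_neg_right, inner_smul_right, inner_smul_right,
    inner_sum, Complex.sub_re, Complex.neg_re, h1, h3, Complex.re_ofReal_mul, Complex.re_sum]
  simp only [Module.End.mul_apply, h2]
  ring

/-- The weighted trace of `𝓛 (|u⟩⟨u|)`. -/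
theorem mom_gen_rk (w : ℕ → ℝ) (u : finVec b) :
    mom w (𝓛.gen (rk u)) =
      2 * (⟪diag b w u, 𝓛.drift u⟫_ℂ).re + ∑ j, wq w (𝓛.jump j u) := by
  rw [gen_rk, map_add, mom_symRk, map_sum]
  simp only [mom_rk]

theorem isFinForm_mom_gen_rk (u : finVec b) : IsFinForm fun w => mom w (𝓛.gen (rk u)) := by
  simp only [mom_gen_rk]
  exact ((isFinForm_inner u _).const_mul 2).add (IsFinForm.sum _ fun j => isFinForm_wq _)

end GKSL

/-! ### Interpolation of moment inequalities through parallel sums -/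

section Interpolation
open MeasureTheory Set Real

theorem continuousOn_rpow_mul_div_sq {θ : ℝ} (hθ : θ ∈ Ioo (0 : ℝ) 1) {a : ℝ} (ha : 0 < a) :
    ContinuousOn (fun t : ℝ => t ^ θ * a / (t + a) ^ 2) (Ioi 0) := by
  refine ContinuousOn.div ?_ (by fun_prop) fun t ht => ?_
  · exact (continuousOn_id.rpow_const fun t ht => Or.inr hθ.1.le).mul continuousOn_const
  · have : (0 : ℝ) < t := ht
    positivity

theorem rpow_mul_div_sq_le {θ : ℝ} (hθ : θ ∈ Ioo (0 : ℝ) 1) {a t : ℝ} (ha : 0 < a) (ht : 0 < t) :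
    t ^ θ * a / (t + a) ^ 2 ≤ rpowIntegrand₀₁ θ t a := by
  rw [rpowIntegrand₀₁_eq_pow_div hθ ht.le ha.le, div_le_div_iff₀ (by positivity) (by positivity),
    rpow_sub_one ht.ne']
  have h : t ^ θ / t * a * (t + a) ^ 2 - t ^ θ * a * (t + a) = t ^ θ / t * a * (a * (t + a)) := by
    field_simp
    ring
  have : 0 ≤ t ^ θ / t * a * (a * (t + a)) := by positivity
  linarith

theorem integrableOn_rpow_mul_div_sq {θ : ℝ} (hθ : θ ∈ Ioo (0 : ℝ) 1) {a : ℝ} (ha : 0 < a) :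
    IntegrableOn (fun t : ℝ => t ^ θ * a / (t + a) ^ 2) (Ioi 0) := by
  refine Integrable.mono' (integrableOn_rpowIntegrand₀₁_Ioi hθ ha.le)
    ((continuousOn_rpow_mul_div_sq hθ ha).aestronglyMeasurable measurableSet_Ioi) ?_
  filter_upwards [ae_restrict_mem measurableSet_Ioi] with t ht
  have ht' : (0 : ℝ) < t := ht
  rw [norm_of_nonneg (by positivity)]
  exact rpow_mul_div_sq_le hθ ha ht

/-- Integration by parts: the function t^θ a/(t+a) vanishes at 0 and at infinity, and its derivative
is θ times one integrand minus the other. The factor θ becomes the share of ω₁ in the interpolated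
rate. -/
theorem integral_rpow_mul_div_sq {θ : ℝ} (hθ : θ ∈ Ioo (0 : ℝ) 1) {a : ℝ} (ha : 0 < a) :
    ∫ t in Ioi (0 : ℝ), t ^ θ * a / (t + a) ^ 2 =
      θ * ∫ t in Ioi (0 : ℝ), rpowIntegrand₀₁ θ t a := by
  have hI := integrableOn_rpowIntegrand₀₁_Ioi hθ ha.le
  have hJ := integrableOn_rpow_mul_div_sq hθ ha
  have hd : ∀ t ∈ Ioi (0 : ℝ), HasDerivAt (fun t : ℝ => t ^ θ * (a / (t + a)))
      (θ * rpowIntegrand₀₁ θ t a - t ^ θ * a / (t + a) ^ 2) t := by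
    intro t ht
    have ht' : (0 : ℝ) < t := ht
    have h1 := (hasDerivAt_rpow_const (x := t) (p := θ) (Or.inl ht'.ne'))
    have h2 : HasDerivAt (fun t : ℝ => a / (t + a)) (-a / (t + a) ^ 2) t := by
      have := ((hasDerivAt_id t).add_const a).inv (by simpa using (by positivity : t + a ≠ 0))
      have := this.const_mul a
      refine this.congr_deriv ?_
      simp only [id]
      ring
    refine (h1.mul h2).congr_deriv ?_
    rw [rpowIntegrand₀₁_eq_pow_div hθ ht'.le ha.le]
    field_simp
    ring
  have hc : ContinuousWithinAt (fun t : ℝ => t ^ θ * (a / (t + a))) (Ici 0) 0 := by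
    refine ContinuousAt.continuousWithinAt ?_
    refine ContinuousAt.mul (continuousAt_rpow_const _ _ (Or.inr hθ.1.le)) ?_
    exact ContinuousAt.div continuousAt_const (by fun_prop) (by simpa using ha.ne')
  have hlim : Tendsto (fun t : ℝ => t ^ θ * (a / (t + a))) atTop (𝓝 0) := by
    have h1 : Tendsto (fun t : ℝ => t ^ (-(1 - θ)) * a) atTop (𝓝 (0 * a)) :=
      (tendsto_rpow_neg_atTop (by linarith [hθ.2])).mul_const a
    rw [zero_mul] at h1
    refine squeeze_zero' ?_ ?_ h1
    · filter_upwards [eventually_gt_atTop 0] with t ht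
      positivity
    · filter_upwards [eventually_gt_atTop 0] with t ht
      have e : t ^ (-(1 - θ)) = t ^ θ / t := by
        rw [neg_sub, rpow_sub_one ht.ne']
      rw [e, div_mul_eq_mul_div, mul_div_assoc]
      gcongr
      linarith
  have h := integral_Ioi_of_hasDerivAt_of_tendsto hc hd ((hI.const_mul θ).sub hJ) hlim
  rw [integral_sub (hI.const_mul θ) hJ, integral_const_mul, zero_rpow hθ.1.ne', zero_mul,
    sub_zero] at h
  linarith

theorem IsFinForm.map_const_mul {F : (ℕ → ℝ) → ℝ} (hF : IsFinForm F) (c : ℝ) (w : ℕ → ℝ) :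
    F (fun n => c * w n) = c * F w := by
  obtain ⟨S, d, h⟩ := hF
  rw [h, h, Finset.mul_sum]
  exact Finset.sum_congr rfl fun n _ => mul_assoc _ _ _

theorem IsFinForm.integral {F : (ℕ → ℝ) → ℝ} (hF : IsFinForm F) {f : ℝ → ℕ → ℝ} {s : Set ℝ}
    (hf : ∀ n, IntegrableOn (fun t => f t n) s) :
    IntegrableOn (fun t => F (f t)) s ∧ ∫ t in s, F (f t) = F fun n => ∫ t in s, f t n := by
  obtain ⟨S, d, h⟩ := hF
  simp only [h]
  refine ⟨integrable_finsetSum _ fun n _ => (hf n).mul_const _, ?_⟩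
  rw [integral_finsetSum _ fun n _ => (hf n).mul_const _]
  exact Finset.sum_congr rfl fun n _ => integral_mul_const _ _

variable {H : Type*} [NormedAddCommGroup H] [InnerProductSpace ℂ H] [CompleteSpace H]
  {b : HilbertBasis ℕ ℂ H}

theorem mom_const_mul (c : ℝ) (w : ℕ → ℝ) (x : finOpSA b) :
    mom (fun n => c * w n) x = c * mom w x := by
  rw [mom_apply, mom_apply, ← tsum_mul_left]
  exact tsum_congr fun n => mul_assoc _ _ _

theorem diag_diag (w v : ℕ → ℝ) (u : finVec b) :
    diag b w (diag b v u) = diag b (fun n => w n * v n) u :=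
  ext_inner_fock fun n => by
    rw [inner_fock_diag, inner_fock_diag, inner_fock_diag, Complex.ofReal_mul, mul_assoc]

theorem diag_add (w v : ℕ → ℝ) (u : finVec b) :
    diag b w u + diag b v u = diag b (fun n => w n + v n) u :=
  ext_inner_fock fun n => by
    rw [inner_add_right, inner_fock_diag, inner_fock_diag, inner_fock_diag, Complex.ofReal_add,
      add_mul]

theorem diag_one (u : finVec b) : diag b (fun _ => 1) u = u := ext_inner_fock fun n => by
  rw [inner_fock_diag]; simp

/-- The quadratic form of a parallel sum is at most the sum of the quadratic forms. -/
theorem wq_parallel_le {w₀ w₁ v : ℕ → ℝ} (h0 : ∀ n, 0 < w₀ n) (h1 : ∀ n, 0 < w₁ n)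
    (hv : ∀ n, v n = w₀ n * w₁ n / (w₀ n + w₁ n)) (x y : finVec b) :
    wq v (x + y) ≤ wq w₀ x + wq w₁ y := by
  refine hasSum_le (fun n => ?_) (hasSum_wq v (x + y)) ((hasSum_wq w₀ x).add (hasSum_wq w₁ y))
  have hs : 0 < w₀ n + w₁ n := add_pos (h0 n) (h1 n)
  have hn := norm_add_le (⟪fock b n, x⟫_ℂ) (⟪fock b n, y⟫_ℂ)
  rw [inner_add_right, hv, div_mul_eq_mul_div, div_le_iff₀ hs]
  set α := ‖⟪fock b n, x⟫_ℂ‖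
  set β := ‖⟪fock b n, y⟫_ℂ‖
  have hp := mul_pos (h0 n) (h1 n)
  -- After clearing the denominator, the second inequality has the defect (w₀α - w₁β)².
  calc _ ≤ w₀ n * w₁ n * (α + β) ^ 2 := by gcongr
    _ ≤ _ := by nlinarith [sq_nonneg (w₀ n * α - w₁ n * β)]

namespace GKSL
variable (𝓛 : GKSL b)

/-- As v/w₀ + v/w₁ = 1, the vector splits as u = u₀ + u₁ with v u = w₀ u₀ = w₁ u₁. For this optimal
splitting the drift terms are exactly additive, and the jump terms obey `wq_parallel_le`. -/
theorem mom_gen_rk_parallel_le {w₀ w₁ v : ℕ → ℝ} (h0 : ∀ n, 0 < w₀ n) (h1 : ∀ n, 0 < w₁ n)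
    (hv : ∀ n, v n = w₀ n * w₁ n / (w₀ n + w₁ n)) {ω₀ ω₁ : ℝ}
    (hm0 : ∀ u, mom w₀ (𝓛.gen (rk u)) ≤ ω₀ * wq w₀ u)
    (hm1 : ∀ u, mom w₁ (𝓛.gen (rk u)) ≤ ω₁ * wq w₁ u) (u : finVec b) :
    mom v (𝓛.gen (rk u)) ≤ ω₀ * wq (fun n => w₀ n * (v n / w₀ n) ^ 2) u +
      ω₁ * wq (fun n => w₁ n * (v n / w₁ n) ^ 2) u := by
  set u₀ := diag b (fun n => v n / w₀ n) u with hu0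
  set u₁ := diag b (fun n => v n / w₁ n) u with hu1
  have hu : u = u₀ + u₁ := by
    rw [hu0, hu1, diag_add]
    conv_lhs => rw [← diag_one u]
    congr 2
    ext n
    have := h0 n
    have := h1 n
    rw [hv]
    field_simp
    ring
  have e0 : diag b v u = diag b w₀ u₀ := by
    rw [hu0, diag_diag]
    congr 2
    ext n
    rw [mul_div_cancel₀ _ (h0 n).ne']
  have e1 : diag b v u = diag b w₁ u₁ := by
    rw [hu1, diag_diag]
    congr 2
    ext n
    rw [mul_div_cancel₀ _ (h1 n).ne']
  have key : mom v (𝓛.gen (rk u)) ≤ mom w₀ (𝓛.gen (rk u₀)) + mom w₁ (𝓛.gen (rk u₁)) := by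
    rw [mom_gen_rk, mom_gen_rk, mom_gen_rk]
    have h2 : (⟪diag b v u, 𝓛.drift u⟫_ℂ).re =
        (⟪diag b w₀ u₀, 𝓛.drift u₀⟫_ℂ).re + (⟪diag b w₁ u₁, 𝓛.drift u₁⟫_ℂ).re := by
      rw [← e0, ← e1, ← Complex.add_re, ← inner_add_right, ← map_add, ← hu]
    have h3 : ∑ j, wq v (𝓛.jump j u) ≤ ∑ j, (wq w₀ (𝓛.jump j u₀) + wq w₁ (𝓛.jump j u₁)) := by
      refine Finset.sum_le_sum fun j _ => ?_
      have := wq_parallel_le h0 h1 hv (𝓛.jump j u₀) (𝓛.jump j u₁)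
      rwa [← map_add, ← hu] at this
    rw [Finset.sum_add_distrib] at h3
    linarith
  refine key.trans (add_le_add ((hm0 u₀).trans_eq ?_) ((hm1 u₁).trans_eq ?_))
  · rw [hu0, wq_diag]
  · rw [hu1, wq_diag]

/-- With a = w₁/w₀, the weight w₀ a^θ is, up to the constant C, the integral over t of w₀ t^(θ-1)
a/(t+a), which is t^(θ-1) times the parallel sum of w₀ and w₁/t. The parallel-sum inequality is
integrated in t. -/
theorem mom_gen_rk_interpolate {w₀ w₁ : ℕ → ℝ} (h0 : ∀ n, 0 < w₀ n) (h1 : ∀ n, 0 < w₁ n)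
    {ω₀ ω₁ : ℝ} (hm0 : ∀ u, mom w₀ (𝓛.gen (rk u)) ≤ ω₀ * wq w₀ u)
    (hm1 : ∀ u, mom w₁ (𝓛.gen (rk u)) ≤ ω₁ * wq w₁ u) {θ : ℝ} (hθ : θ ∈ Ioo (0 : ℝ) 1)
    (u : finVec b) :
    mom (fun n => w₀ n * (w₁ n / w₀ n) ^ θ) (𝓛.gen (rk u)) ≤
      ((1 - θ) * ω₀ + θ * ω₁) * wq (fun n => w₀ n * (w₁ n / w₀ n) ^ θ) u := by
  set a : ℕ → ℝ := fun n => w₁ n / w₀ n with ha_def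
  have ha : ∀ n, 0 < a n := fun n => div_pos (h1 n) (h0 n)
  have hw1 : ∀ n, w₁ n = w₀ n * a n := fun n => (mul_div_cancel₀ _ (h0 n).ne').symm
  set C := ∫ t in Ioi (0 : ℝ), rpowIntegrand₀₁ θ t 1
  have hC : 0 < C := integral_rpowIntegrand₀₁_one_pos hθ
  have hI : ∀ n, IntegrableOn (fun t => w₀ n * rpowIntegrand₀₁ θ t (a n)) (Ioi 0) := fun n =>
    (integrableOn_rpowIntegrand₀₁_Ioi hθ (ha n).le).const_mul _
  have hJ : ∀ n, IntegrableOn (fun t : ℝ => w₀ n * (t ^ θ * a n / (t + a n) ^ 2)) (Ioi 0) :=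
    fun n => (integrableOn_rpow_mul_div_sq hθ (ha n)).const_mul _
  have hIv : ∀ n, ∫ t in Ioi (0 : ℝ), w₀ n * rpowIntegrand₀₁ θ t (a n) =
      C * (w₀ n * a n ^ θ) := fun n => by
    rw [integral_const_mul, integral_rpowIntegrand₀₁_eq_rpow_mul_const hθ (ha n).le]
    ring
  have hJv : ∀ n, ∫ t in Ioi (0 : ℝ), w₀ n * (t ^ θ * a n / (t + a n) ^ 2) =
      (θ * C) * (w₀ n * a n ^ θ) := fun n => by
    rw [integral_const_mul, integral_rpow_mul_div_sq hθ (ha n),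
      integral_rpowIntegrand₀₁_eq_rpow_mul_const hθ (ha n).le]
    ring
  have hF := 𝓛.isFinForm_mom_gen_rk u
  have hq := isFinForm_wq u
  obtain ⟨iF, eF⟩ := hF.integral hI
  obtain ⟨iJ, eJ⟩ := hq.integral hJ
  -- The two weights on the right add up to the weight on the left; their integrals are the
  -- fractions 1 - θ and θ of its integral.
  have hle : ∀ t ∈ Ioi (0 : ℝ),
      mom (fun n => w₀ n * rpowIntegrand₀₁ θ t (a n)) (𝓛.gen (rk u)) ≤
      ω₀ * wq (fun n => w₀ n * rpowIntegrand₀₁ θ t (a n) -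
        w₀ n * (t ^ θ * a n / (t + a n) ^ 2)) u +
      ω₁ * wq (fun n => w₀ n * (t ^ θ * a n / (t + a n) ^ 2)) u := by
    intro t ht
    have ht' : (0 : ℝ) < t := ht
    have hc : 0 < t ^ (θ - 1) := rpow_pos_of_pos ht' _
    have hmt : ∀ u, mom (fun n => t⁻¹ * w₁ n) (𝓛.gen (rk u)) ≤
        ω₁ * wq (fun n => t⁻¹ * w₁ n) u := fun u => by
      rw [mom_const_mul, wq_const_mul, mul_left_comm]
      exact mul_le_mul_of_nonneg_left (hm1 u) (inv_nonneg.2 ht'.le)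
    have hp := 𝓛.mom_gen_rk_parallel_le (v := fun n => w₀ n * (t⁻¹ * w₁ n) / (w₀ n + t⁻¹ * w₁ n))
      h0 (fun n => mul_pos (inv_pos.2 ht') (h1 n)) (fun n => rfl) hm0 hmt u
    have hp' := mul_le_mul_of_nonneg_left hp hc.le
    rw [mul_add, mul_left_comm _ ω₀, mul_left_comm _ ω₁, ← mom_const_mul (t ^ (θ - 1)),
      ← wq_const_mul (t ^ (θ - 1)), ← wq_const_mul (t ^ (θ - 1))] at hp'
    have eθ : t ^ θ = t ^ (θ - 1) * t := by rw [rpow_sub_one ht'.ne', div_mul_cancel₀ _ ht'.ne']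
    have f1 : (fun n => w₀ n * rpowIntegrand₀₁ θ t (a n)) = fun n =>
        t ^ (θ - 1) * (w₀ n * (t⁻¹ * w₁ n) / (w₀ n + t⁻¹ * w₁ n)) := by
      ext n
      have := h0 n
      have := ha n
      rw [rpowIntegrand₀₁_eq_pow_div hθ ht'.le (ha n).le, hw1]
      field_simp
    have f2 : (fun n => w₀ n * rpowIntegrand₀₁ θ t (a n) -
        w₀ n * (t ^ θ * a n / (t + a n) ^ 2)) = fun n =>
        t ^ (θ - 1) * (w₀ n * (w₀ n * (t⁻¹ * w₁ n) / (w₀ n + t⁻¹ * w₁ n) / w₀ n) ^ 2) := by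
      ext n
      have := h0 n
      have := ha n
      rw [rpowIntegrand₀₁_eq_pow_div hθ ht'.le (ha n).le, hw1, eθ]
      field_simp
      ring
    have f3 : (fun n => w₀ n * (t ^ θ * a n / (t + a n) ^ 2)) = fun n =>
        t ^ (θ - 1) * (t⁻¹ * w₁ n *
          (w₀ n * (t⁻¹ * w₁ n) / (w₀ n + t⁻¹ * w₁ n) / (t⁻¹ * w₁ n)) ^ 2) := by
      ext n
      have := h0 n
      have := ha n
      rw [hw1, eθ]
      field_simp
    rw [f2, f3, f1]
    exact hp'
  have hK' : ∀ n, IntegrableOn (fun t : ℝ => w₀ n * rpowIntegrand₀₁ θ t (a n) -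
      w₀ n * (t ^ θ * a n / (t + a n) ^ 2)) (Ioi 0) := fun n => (hI n).sub (hJ n)
  obtain ⟨iK, eK⟩ := hq.integral hK'
  have hint := setIntegral_mono_on iF (g := fun t => ω₀ * wq (fun n => w₀ n *
    rpowIntegrand₀₁ θ t (a n) - w₀ n * (t ^ θ * a n / (t + a n) ^ 2)) u +
      ω₁ * wq (fun n => w₀ n * (t ^ θ * a n / (t + a n) ^ 2)) u)
    ((iK.const_mul ω₀).add (iJ.const_mul ω₁)) measurableSet_Ioi hle
  rw [integral_add (iK.const_mul ω₀) (iJ.const_mul ω₁), integral_const_mul, integral_const_mul, eF,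
    eK, eJ] at hint
  have hK : ∀ n, ∫ t in Ioi (0 : ℝ), (w₀ n * rpowIntegrand₀₁ θ t (a n) -
      w₀ n * (t ^ θ * a n / (t + a n) ^ 2)) = ((1 - θ) * C) * (w₀ n * a n ^ θ) := fun n => by
    rw [integral_sub (hI n) (hJ n), hIv, hJv]
    ring
  simp only [hIv, hJv, hK] at hint
  rw [hF.map_const_mul, hq.map_const_mul, hq.map_const_mul] at hint
  refine le_of_mul_le_mul_left (hint.trans_eq ?_) hC
  ring

/-- Interpolation between two moment bounds. -/
theorem mom_gen_rk_interpRate {κ₀ κ₁ ω₀ ω₁ k : ℝ}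
    (hm0 : ∀ u, mom (momWeight κ₀) (𝓛.gen (rk u)) ≤ ω₀ * wq (momWeight κ₀) u)
    (hm1 : ∀ u, mom (momWeight κ₁) (𝓛.gen (rk u)) ≤ ω₁ * wq (momWeight κ₁) u)
    (h0 : κ₀ ≤ k) (h1 : k < κ₁) (u : finVec b) :
    mom (momWeight k) (𝓛.gen (rk u)) ≤ interpRate κ₀ ω₀ κ₁ ω₁ k * wq (momWeight k) u := by
  have hd : κ₁ - κ₀ ≠ 0 := (by linarith : 0 < κ₁ - κ₀).ne'
  -- The integral representation needs θ > 0; for k = κ₀ the claim is the first hypothesis itself.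
  rcases h0.eq_or_lt with rfl | h0
  · rw [interpRate, sub_self, zero_div, zero_mul, add_zero, div_self hd, one_mul]
    exact hm0 u
  · have hθ : (k - κ₀) / (κ₁ - κ₀) ∈ Ioo (0 : ℝ) 1 :=
      ⟨div_pos (by linarith) (by linarith), (div_lt_one (by linarith)).2 (by linarith)⟩
    have h := 𝓛.mom_gen_rk_interpolate (momWeight_pos κ₀) (momWeight_pos κ₁) hm0 hm1 hθ u
    have e : (fun n => momWeight κ₀ n * (momWeight κ₁ n / momWeight κ₀ n) ^
        ((k - κ₀) / (κ₁ - κ₀))) = momWeight k := by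
      ext n
      have hn : (0 : ℝ) < n + 1 := by positivity
      simp only [momWeight]
      rw [← rpow_sub hn, ← rpow_mul hn.le, ← rpow_add hn]
      congr 1
      field_simp
      ring
    have e2 : 1 - (k - κ₀) / (κ₁ - κ₀) = (κ₁ - k) / (κ₁ - κ₀) := by
      field_simp
      ring
    rw [e, e2] at h
    exact h

end GKSL
end Interpolation

/-! ### Finite blocks of the Fock basis -/

section Blocks
variable {H : Type*} [NormedAddCommGroup H] [InnerProductSpace ℂ H] [CompleteSpace H]
  {b : HilbertBasis ℕ ℂ H}

instance : AddCommGroup (finOpSA b) := Submodule.addCommGroup _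

instance : Module ℝ (finOpSA b) := Submodule.module _

/-- The compression of an operator of `T_f` to the span of `|0⟩, …, |n - 1⟩`. -/
def compress (b : HilbertBasis ℕ ℂ H) (n : ℕ) : finOpSA b →ₗ[ℝ] finOpSA b where
  toFun x := ⟨cutoff b n * (x : H →L[ℂ] H) * cutoff b n, Sobolev.cutoff_conj_mem_finOpSA n x.2.1⟩
  map_add' x y := Subtype.ext (by
    simp only [Submodule.coe_add, mul_add, add_mul])
  map_smul' c x := Subtype.ext (by
    simp only [Submodule.coe_smul, mul_smul_comm, smul_mul_assoc, RingHom.id_apply])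

theorem coe_compress (n : ℕ) (x : finOpSA b) :
    (compress b n x : H →L[ℂ] H) = cutoff b n * (x : H →L[ℂ] H) * cutoff b n := rfl

/-- The operators of `T_f` that live on the span of `|0⟩, …, |n - 1⟩`. -/
def block (b : HilbertBasis ℕ ℂ H) (n : ℕ) : Submodule ℝ (finOpSA b) :=
  LinearMap.eqLocus (compress b n) LinearMap.id

theorem mem_block {n : ℕ} {x : finOpSA b} : x ∈ block b n ↔ compress b n x = x := Iff.rfl

theorem compress_mem_block (n : ℕ) (x : finOpSA b) : compress b n x ∈ block b n := by
  refine Subtype.ext ?_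
  change cutoff b n * (cutoff b n * (x : H →L[ℂ] H) * cutoff b n) * cutoff b n =
    cutoff b n * (x : H →L[ℂ] H) * cutoff b n
  rw [mul_assoc, mul_assoc _ (cutoff b n) (cutoff b n), cutoff_mul_cutoff, ← mul_assoc,
    ← mul_assoc, cutoff_mul_cutoff]

theorem mul_cutoff_of_apply {A : H →L[ℂ] H} {n : ℕ} (h : ∀ m ≥ n, A (b m) = 0) :
    A * cutoff b n = A := ext_basis b fun m => by
  rw [mul_apply_eq_comp, cutoff_basis]
  split_ifs with hm
  · rfl
  · rw [map_zero, h m (not_lt.1 hm)]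

theorem cutoff_mul_of_apply {A : H →L[ℂ] H} (hA : IsSelfAdjoint A) {n : ℕ}
    (h : ∀ m ≥ n, A (b m) = 0) : cutoff b n * A = A := by
  have := congrArg star (mul_cutoff_of_apply h)
  rwa [star_mul, (isSelfAdjoint_cutoff b n).star_eq, hA.star_eq] at this

theorem mem_block_iff_apply {n : ℕ} {x : finOpSA b} :
    x ∈ block b n ↔ ∀ m ≥ n, (x : H →L[ℂ] H) (b m) = 0 := by
  refine ⟨fun h m hm => ?_, fun h => Subtype.ext ?_⟩
  · rw [← mem_block.1 h, coe_compress, mul_apply_eq_comp, cutoff_basis, if_neg (by omega), map_zero]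
  · change cutoff b n * (x : H →L[ℂ] H) * cutoff b n = x
    rw [cutoff_mul_of_apply x.2.1 h, mul_cutoff_of_apply h]

theorem eventually_mem_block (x : finOpSA b) : ∀ᶠ n in atTop, x ∈ block b n := by
  obtain ⟨M, hM⟩ := exists_apply_eq_zero x
  filter_upwards [eventually_ge_atTop M] with n hn
  exact mem_block_iff_apply.2 fun m hm => hM m (hn.trans hm)

theorem mem_finOpSA_of_apply {A : H →L[ℂ] H} (hA : IsSelfAdjoint A) {n : ℕ}
    (h : ∀ m ≥ n, A (b m) = 0) : A ∈ finOpSA b := by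
  have := Sobolev.cutoff_conj_mem_finOpSA (b := b) n hA
  rwa [cutoff_mul_of_apply hA h, mul_cutoff_of_apply h] at this

instance (n : ℕ) : AddCommGroup (block b n) := Submodule.addCommGroup _

instance (n : ℕ) : Module ℝ (block b n) := Submodule.module _

instance finiteDimensional_block (n : ℕ) : FiniteDimensional ℝ (block b n) := by
  let f : block b n →ₗ[ℝ] (Fin n → Fin n → ℂ) :=
    { toFun := fun x i j => ⟪b i, ((x : finOpSA b) : H →L[ℂ] H) (b j)⟫_ℂ
      map_add' := fun x y => by
        ext i j
        simp
      map_smul' := fun c x => by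
        ext i j
        simp only [Submodule.coe_smul, smul_apply, inner_smul_right_eq_smul, RingHom.id_apply,
          Pi.smul_apply] }
  refine FiniteDimensional.of_injective f (LinearMap.ker_eq_bot.1 (LinearMap.ker_eq_bot'.2
    fun x hx => ?_))
  have h0 := mem_block_iff_apply.1 x.2
  refine Subtype.ext (Subtype.ext (eq_zero_of_basis b fun j => ?_))
  by_cases hj : j < n
  · apply b.repr.injective
    ext i
    rw [map_zero, b.repr_apply_apply]
    by_cases hi : i < n
    · exact congrFun (congrFun hx ⟨i, hi⟩) ⟨j, hj⟩
    · have hs := ContinuousLinearMap.isSelfAdjoint_iff_isSymmetric.1 (x : finOpSA b).2.1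
      have := hs (b i) (b j)
      simp only [ContinuousLinearMap.coe_coe] at this
      rw [← this, h0 i (not_lt.1 hi), inner_zero_left]
      rfl
  · exact h0 j (not_lt.1 hj)

theorem cutoff_apply_mem_finVec (n : ℕ) (v : H) : cutoff b n v ∈ finVec b := by
  rw [cutoff, sum_apply]
  exact Submodule.sum_mem _ fun m _ => Submodule.smul_mem _ _ (Submodule.subset_span ⟨m, rfl⟩)

theorem sqrt_apply_eq_zero {p : H →L[ℂ] H} (hp : 0 ≤ p) {v : H} (hv : p v = 0) :
    CFC.sqrt p v = 0 := by
  have hs : IsSelfAdjoint (CFC.sqrt p) := IsSelfAdjoint.of_nonneg (CFC.sqrt_nonneg p)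
  have h1 : ⟪CFC.sqrt p v, CFC.sqrt p v⟫_ℂ = 0 := by
    rw [← ContinuousLinearMap.adjoint_inner_right, ← ContinuousLinearMap.star_eq_adjoint,
      hs.star_eq, ← mul_apply_eq_comp, CFC.sqrt_mul_sqrt_self p hp, hv, inner_zero_right]
  exact inner_self_eq_zero.1 h1

theorem abs_apply_eq_zero {p : H →L[ℂ] H} {v : H} (hv : p v = 0) : CFC.abs p v = 0 := by
  refine sqrt_apply_eq_zero (star_mul_self_nonneg p) ?_
  rw [mul_apply_eq_comp, hv, map_zero]

theorem posPart_negPart_apply_eq_zero {x : H →L[ℂ] H} (hx : IsSelfAdjoint x) {v : H}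
    (hv : x v = 0) : x⁺ v = 0 ∧ x⁻ v = 0 := by
  have h1 := abs_apply_eq_zero hv
  have h2 := hv
  rw [← CFC.posPart_add_negPart x hx, add_apply] at h1
  nth_rewrite 1 [← CFC.posPart_sub_negPart x hx] at h2
  rw [sub_apply, sub_eq_zero] at h2
  rw [h2, ← two_smul ℂ] at h1
  have h3 := (smul_eq_zero.1 h1).resolve_left two_ne_zero
  exact ⟨h2.trans h3, h3⟩

/-- The kernel of a positive operator lies in that of its square root; this is used twice, with an
adjoint in between. It makes the columns of the roots of the positive and negative parts mutually
orthogonal. -/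
theorem sqrt_mul_sqrt_eq_zero {p q : H →L[ℂ] H} (hp : 0 ≤ p) (hq : 0 ≤ q) (h : q * p = 0) :
    CFC.sqrt p * CFC.sqrt q = 0 := by
  have h1 : CFC.sqrt q * p = 0 := ContinuousLinearMap.ext fun v =>
    sqrt_apply_eq_zero hq (congrArg (fun f : H →L[ℂ] H => f v) h)
  have h2 : p * CFC.sqrt q = 0 := by
    have := congrArg star h1
    rwa [star_mul, (IsSelfAdjoint.of_nonneg hp).star_eq,
      (IsSelfAdjoint.of_nonneg (CFC.sqrt_nonneg q)).star_eq, star_zero] at this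
  exact ContinuousLinearMap.ext fun v =>
    sqrt_apply_eq_zero hp (congrArg (fun f : H →L[ℂ] H => f v) h2)

/-- The columns of `√p`, for a positive operator `p` of a block. -/
theorem exists_sum_rk_eq {n : ℕ} {p : finOpSA b} (hp : 0 ≤ (p : H →L[ℂ] H)) (hn : p ∈ block b n) :
    ∃ ψ : ℕ → finVec b, (∀ m, (ψ m : H) = CFC.sqrt (p : H →L[ℂ] H) (b m)) ∧
      (∀ m, ∀ l ≥ n, ⟪fock b l, ψ m⟫_ℂ = 0) ∧ p = ∑ m ∈ Finset.range n, rk (ψ m) := by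
  set s := CFC.sqrt (p : H →L[ℂ] H) with hs
  have hsa : IsSelfAdjoint s := IsSelfAdjoint.of_nonneg (CFC.sqrt_nonneg _)
  have hs0 : ∀ m ≥ n, s (b m) = 0 := fun m hm =>
    sqrt_apply_eq_zero hp (mem_block_iff_apply.1 hn m hm)
  have hc := cutoff_mul_of_apply hsa hs0
  have hsym : ∀ u v, ⟪s u, v⟫_ℂ = ⟪u, s v⟫_ℂ :=
    fun u v => ContinuousLinearMap.isSelfAdjoint_iff_isSymmetric.1 hsa u v
  have hmem : ∀ m, s (b m) ∈ finVec b := fun m => by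
    rw [← hc]
    exact cutoff_apply_mem_finVec n _
  refine ⟨fun m => ⟨s (b m), hmem m⟩, fun m => rfl, fun m l hl => ?_, ?_⟩
  · rw [Submodule.coe_inner, coe_fock]
    change ⟪b l, s (b m)⟫_ℂ = 0
    rw [← hsym, hs0 l hl, inner_zero_left]
  · refine Subtype.ext (ContinuousLinearMap.ext fun v => ?_)
    rw [AddSubmonoidClass.coe_finsetSum, sum_apply]
    simp only [coe_rk_apply]
    -- The decomposition is p = s s = s Q s, with Q the cutoff written as the sum of its rank-one
    -- projections.
    rw [← CFC.sqrt_mul_sqrt_self (p : H →L[ℂ] H) hp, ← hs]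
    nth_rewrite 2 [← hc]
    rw [mul_apply_eq_comp, mul_apply_eq_comp, cutoff, sum_apply, map_sum]
    refine Finset.sum_congr rfl fun m _ => ?_
    rw [InnerProductSpace.rankOne_apply, map_smul, hsym]

theorem mom_compress (w : ℕ → ℝ) (n : ℕ) (x : finOpSA b) :
    mom w (compress b n x) = mom (fun m => if m < n then w m else 0) x := by
  rw [mom_apply, mom_apply]
  refine tsum_congr fun m => ?_
  have hsym := ContinuousLinearMap.isSelfAdjoint_iff_isSymmetric.1 (isSelfAdjoint_cutoff b n)
  have e : ⟪b m, (compress b n x : H →L[ℂ] H) (b m)⟫_ℂ =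
      ⟪cutoff b n (b m), (x : H →L[ℂ] H) (cutoff b n (b m))⟫_ℂ := (hsym (b m) _).symm
  rw [e, cutoff_basis]
  split_ifs <;> simp

theorem mom_add_mom (w w' : ℕ → ℝ) (x : finOpSA b) :
    mom w x + mom w' x = mom (fun m => w m + w' m) x := by
  rw [mom_apply, mom_apply, mom_apply, ← (summable_mom w x).tsum_add (summable_mom w' x)]
  exact tsum_congr fun n => (add_mul _ _ _).symm

end Blocks

/-! ### Compressed generators: positivity and solvability -/

namespace GKSL
variable {H : Type*} [NormedAddCommGroup H] [InnerProductSpace ℂ H] [CompleteSpace H]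
  {b : HilbertBasis ℕ ℂ H} (𝓛 : GKSL b)

theorem mom_gen_le_of_rk {w : ℕ → ℝ} {ω : ℝ}
    (hm : ∀ u, mom w (𝓛.gen (rk u)) ≤ ω * wq w u) {x : finOpSA b} (hx : 0 ≤ (x : H →L[ℂ] H)) :
    mom w (𝓛.gen x) ≤ ω * mom w x := by
  obtain ⟨n, hn⟩ := (eventually_mem_block x).exists
  obtain ⟨ψ, -, -, e⟩ := exists_sum_rk_eq hx hn
  rw [e]
  simp only [map_sum, Finset.mul_sum, mom_rk]
  exact Finset.sum_le_sum fun m _ => hm _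

/-- The discarded diagonal entries of 𝓛(x) lie outside the block, where x vanishes. The drift
contributes nothing there and the jumps contribute nonnegative terms. -/
theorem mom_compress_gen_le {w : ℕ → ℝ} (hw : ∀ n, 0 ≤ w n) {n : ℕ} {x : finOpSA b}
    (hx : 0 ≤ (x : H →L[ℂ] H)) (hn : x ∈ block b n) :
    mom w (compress b n (𝓛.gen x)) ≤ mom w (𝓛.gen x) := by
  have e : mom w (𝓛.gen x) = mom w (compress b n (𝓛.gen x)) +
      mom (fun m => if m < n then 0 else w m) (𝓛.gen x) := by
    rw [mom_compress, mom_add_mom]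
    congr 2
    ext m
    split_ifs <;> simp
  rw [e, le_add_iff_nonneg_right]
  obtain ⟨ψ, -, h0, rfl⟩ := exists_sum_rk_eq hx hn
  simp only [map_sum]
  refine Finset.sum_nonneg fun m _ => ?_
  have hd : diag b (fun m => if m < n then 0 else w m) (ψ m) = 0 := ext_inner_fock fun l => by
    rw [inner_fock_diag, inner_zero_right]
    split_ifs with h
    · simp
    · rw [h0 m l (not_lt.1 h), mul_zero]
  rw [mom_gen_rk, hd, inner_zero_left, Complex.zero_re, mul_zero, zero_add]
  refine Finset.sum_nonneg fun j _ => wq_nonneg (fun l => ?_) _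
  split_ifs
  exacts [le_rfl, hw l]

/-- The diagonal matrix elements of `𝓛 (|u⟩⟨u|)`. -/
theorem re_inner_gen_rk (e u : finVec b) :
    (⟪(e : H), (𝓛.gen (rk u) : H →L[ℂ] H) e⟫_ℂ).re =
      2 * (⟪u, e⟫_ℂ * ⟪e, 𝓛.drift u⟫_ℂ).re + ∑ j, ‖⟪e, 𝓛.jump j u⟫_ℂ‖ ^ 2 := by
  rw [gen_rk, Submodule.coe_add, add_apply, coe_symRk_apply, AddSubmonoidClass.coe_finsetSum,
    sum_apply, inner_add_right, inner_add_right, inner_sum, inner_smul_right,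
    inner_smul_right, Complex.add_re, Complex.add_re, Complex.re_sum]
  simp only [coe_rk_apply, inner_smul_right, ← Submodule.coe_inner]
  have h1 : (⟪𝓛.drift u, e⟫_ℂ * ⟪e, u⟫_ℂ).re = (⟪u, e⟫_ℂ * ⟪e, 𝓛.drift u⟫_ℂ).re := by
    rw [← inner_conj_symm u e, ← inner_conj_symm e (𝓛.drift u), ← map_mul, Complex.conj_re,
      mul_comm]
  have h2 : ∀ j, (⟪𝓛.jump j u, e⟫_ℂ * ⟪e, 𝓛.jump j u⟫_ℂ).re = ‖⟪e, 𝓛.jump j u⟫_ℂ‖ ^ 2 := fun j => by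
    rw [← inner_conj_symm _ e, mul_comm, Complex.mul_conj, Complex.normSq_eq_norm_sq,
      Complex.ofReal_re]
  rw [h1]
  simp only [h2]
  ring

/-- The resolvents of the compressed generators preserve positivity. -/
theorem nonneg_of_compress_nonneg {n : ℕ} {x : finOpSA b} (hn : x ∈ block b n) {c : ℝ} (hc : 0 < c)
    (h : 0 ≤ ((c • x - compress b n (𝓛.gen x) : finOpSA b) : H →L[ℂ] H)) :
    0 ≤ (x : H →L[ℂ] H) := by
  have hxs := x.2.1
  have hx0 := mem_block_iff_apply.1 hn
  have hp := CFC.posPart_nonneg (x : H →L[ℂ] H)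
  have hq := CFC.negPart_nonneg (x : H →L[ℂ] H)
  have hsub := CFC.posPart_sub_negPart (x : H →L[ℂ] H) hxs
  have hp0 : ∀ m ≥ n, (x : H →L[ℂ] H)⁺ (b m) = 0 := fun m hm =>
    (posPart_negPart_apply_eq_zero hxs (hx0 m hm)).1
  have hq0 : ∀ m ≥ n, (x : H →L[ℂ] H)⁻ (b m) = 0 := fun m hm =>
    (posPart_negPart_apply_eq_zero hxs (hx0 m hm)).2
  set p : finOpSA b := ⟨(x : H →L[ℂ] H)⁺, mem_finOpSA_of_apply (IsSelfAdjoint.of_nonneg hp) hp0⟩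
  set q : finOpSA b := ⟨(x : H →L[ℂ] H)⁻, mem_finOpSA_of_apply (IsSelfAdjoint.of_nonneg hq) hq0⟩
  have hxpq : x = p - q := Subtype.ext hsub.symm
  obtain ⟨ψ, hψs, -, hψ⟩ := exists_sum_rk_eq (p := p) hp (mem_block_iff_apply.2 hp0)
  obtain ⟨φ, hφs, hφ0, hφ⟩ := exists_sum_rk_eq (p := q) hq (mem_block_iff_apply.2 hq0)
  have horth : ∀ i j, ⟪ψ i, φ j⟫_ℂ = 0 := fun i j => by
    have h1 := sqrt_mul_sqrt_eq_zero hp hq (CFC.negPart_mul_posPart (x : H →L[ℂ] H))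
    have hsa : IsSelfAdjoint (CFC.sqrt ((x : H →L[ℂ] H)⁺)) :=
      IsSelfAdjoint.of_nonneg (CFC.sqrt_nonneg _)
    rw [Submodule.coe_inner, hψs, hφs]
    refine (ContinuousLinearMap.isSelfAdjoint_iff_isSymmetric.1 hsa (b i) _).trans ?_
    change ⟪b i, (CFC.sqrt ((x : H →L[ℂ] H)⁺) * CFC.sqrt ((x : H →L[ℂ] H)⁻)) (b j)⟫_ℂ = 0
    rw [h1, zero_apply, inner_zero_right]
  -- `F` is spanned by the columns of √q: it is orthogonal to the columns of √p and contained in the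
  -- block.
  set F : Submodule ℂ (finVec b) := Submodule.span ℂ (φ '' (Finset.range n : Set ℕ))
  have : FiniteDimensional ℂ F :=
    FiniteDimensional.span_of_finite ℂ ((Finset.range n).finite_toSet.image φ)
  have hFψ : ∀ e ∈ F, ∀ i, ⟪ψ i, e⟫_ℂ = 0 := fun e he i => by
    induction he using Submodule.span_induction with
    | mem e he => obtain ⟨j, -, rfl⟩ := he; exact horth i j
    | zero => exact inner_zero_right _
    | add u v _ _ hu hv => rw [inner_add_right, hu, hv, add_zero]
    | smul a u _ hu => rw [inner_smul_right, hu, mul_zero]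
  have hFn : ∀ e ∈ F, ∀ l ≥ n, ⟪fock b l, e⟫_ℂ = 0 := fun e he l hl => by
    induction he using Submodule.span_induction with
    | mem e he => obtain ⟨j, -, rfl⟩ := he; exact hφ0 j l hl
    | zero => exact inner_zero_right _
    | add u v _ _ hu hv => rw [inner_add_right, hu, hv, add_zero]
    | smul a u _ hu => rw [inner_smul_right, hu, mul_zero]
  have hFcut : ∀ e ∈ F, cutoff b n (e : H) = e := fun e he => by
    apply b.repr.injective
    ext l
    rw [b.repr_apply_apply, b.repr_apply_apply]
    have hs := ContinuousLinearMap.isSelfAdjoint_iff_isSymmetric.1 (isSelfAdjoint_cutoff b n)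
      (b l) e
    simp only [ContinuousLinearMap.coe_coe] at hs
    rw [← hs, cutoff_basis]
    split_ifs with hl
    · rfl
    · have := hFn e he l (not_lt.1 hl)
      rw [Submodule.coe_inner, coe_fock] at this
      rw [this, inner_zero_left]
  let B := stdOrthonormalBasis ℂ F
  have hBo : Orthonormal ℂ fun i => ((B i : F) : finVec b) :=
    B.orthonormal.comp_linearIsometry F.subtypeₗᵢ
  have hparseval : ∀ f ∈ F, ∀ v : finVec b, ∑ i, ⟪f, (B i : finVec b)⟫_ℂ * ⟪(B i : finVec b), v⟫_ℂ =
      ⟪f, v⟫_ℂ := fun f hf v => by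
    have h1 := congrArg (fun u : F => ⟪(u : finVec b), v⟫_ℂ) (B.sum_repr' ⟨f, hf⟩)
    simp only [Submodule.coe_sum, Submodule.coe_smul, sum_inner, inner_smul_left] at h1
    rw [← h1]
    refine Finset.sum_congr rfl fun i _ => ?_
    rw [inner_conj_symm]
    rfl
  -- `t` is the partial trace over `F`. It is unaffected by the compression, vanishes on `p`, and
  -- gives the full trace on `q`.
  set t : finOpSA b → ℝ := fun y =>
    ∑ i, (⟪((B i : finVec b) : H), (y : H →L[ℂ] H) (B i : finVec b)⟫_ℂ).re with ht
  have ht_sub : ∀ y z, t (y - z) = t y - t z := fun y z => by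
    simp only [ht, AddSubgroupClass.coe_sub, sub_apply, inner_sub_right, Complex.sub_re,
      Finset.sum_sub_distrib]
  have ht_sum : ∀ (s : Finset ℕ) (f : ℕ → finOpSA b), t (∑ m ∈ s, f m) = ∑ m ∈ s, t (f m) := by
    intro s f
    simp only [ht, AddSubmonoidClass.coe_finsetSum, sum_apply, inner_sum,
      Complex.re_sum]
    exact Finset.sum_comm
  have ht_smul : ∀ (a : ℝ) y, t (a • y) = a * t y := fun a y => by
    simp only [ht, Submodule.coe_smul, smul_apply, inner_smul_right_eq_smul, Complex.real_smul,
      Complex.re_ofReal_mul, Finset.mul_sum]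
  have ht_compress : ∀ y, t (compress b n y) = t y := fun y => by
    refine Finset.sum_congr rfl fun i _ => ?_
    have hs := ContinuousLinearMap.isSelfAdjoint_iff_isSymmetric.1 (isSelfAdjoint_cutoff b n)
      ((B i : finVec b) : H) ((y : H →L[ℂ] H) (cutoff b n (B i : finVec b)))
    simp only [ContinuousLinearMap.coe_coe] at hs
    rw [coe_compress, mul_apply_eq_comp, mul_apply_eq_comp, ← hs, hFcut _ (B i).2]
  have ht_rk : ∀ u : finVec b, t (rk u) =
      (∑ i, ⟪u, (B i : finVec b)⟫_ℂ * ⟪(B i : finVec b), u⟫_ℂ).re :=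
    fun u => by
      rw [Complex.re_sum]
      refine Finset.sum_congr rfl fun i _ => ?_
      rw [coe_rk_apply, inner_smul_right]
      rfl
  have htψ : ∀ m, t (rk (ψ m)) = 0 := fun m => by
    rw [ht_rk, Finset.sum_eq_zero fun i _ => by rw [hFψ _ (B i).2, zero_mul], Complex.zero_re]
  have hφF : ∀ m ∈ Finset.range n, φ m ∈ F := fun m hm => Submodule.subset_span ⟨m, hm, rfl⟩
  have htφ : ∀ m ∈ Finset.range n, t (rk (φ m)) = ‖φ m‖ ^ 2 := fun m hm => by
    rw [ht_rk, hparseval _ (hφF m hm), inner_self_eq_norm_sq_to_K]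
    norm_cast
  -- Since ψ is orthogonal to `F`, only the jump terms remain: the population of `F` can only be fed
  -- by `p`.
  have hgψ : ∀ m, 0 ≤ t (𝓛.gen (rk (ψ m))) := fun m => by
    refine Finset.sum_nonneg fun i _ => ?_
    rw [re_inner_gen_rk, hFψ _ (B i).2, zero_mul, Complex.zero_re, mul_zero, zero_add]
    positivity
  -- Since φ lies in `F`, the drift term is seen in full, but by Bessel only part of the jump terms;
  -- with all of them the sum would be the trace, which is 0.
  have hgφ : ∀ m ∈ Finset.range n, t (𝓛.gen (rk (φ m))) ≤ 0 := fun m hm => by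
    simp only [ht, re_inner_gen_rk]
    rw [Finset.sum_add_distrib, ← Finset.mul_sum, ← Complex.re_sum, hparseval _ (hφF m hm),
      Finset.sum_comm, ← 𝓛.two_mul_re_inner_drift (φ m)]
    gcongr with j
    exact hBo.sum_inner_products_le _
  -- With x = p - q this reads 0 ≤ -c tr q - t(𝓛 p) + t(𝓛 q) ≤ -c tr q, hence q = 0.
  have htz : 0 ≤ t (c • x - compress b n (𝓛.gen x)) :=
    Finset.sum_nonneg fun i _ => re_inner_nonneg h _
  rw [ht_sub, ht_smul, ht_compress, hxpq, map_sub, ht_sub, ht_sub, hψ, hφ, map_sum, map_sum, ht_sum,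
    ht_sum, ht_sum, ht_sum, Finset.sum_eq_zero fun m _ => htψ m, Finset.sum_congr rfl htφ] at htz
  have h1 := Finset.sum_nonneg fun m (_ : m ∈ Finset.range n) => hgψ m
  have h2 := Finset.sum_nonpos hgφ
  have h3 : ∑ m ∈ Finset.range n, ‖φ m‖ ^ 2 = 0 := by
    refine le_antisymm ?_ (Finset.sum_nonneg fun m _ => sq_nonneg _)
    by_contra hcon
    have := mul_pos hc (not_le.1 hcon)
    linarith
  have hq : q = 0 := by
    rw [hφ]
    refine Finset.sum_eq_zero fun m hm => ?_
    have := (Finset.sum_eq_zero_iff_of_nonneg fun m _ => sq_nonneg _).1 h3 m hm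
    have h0 : φ m = 0 := by simpa using this
    refine Subtype.ext (ContinuousLinearMap.ext fun v => ?_)
    rw [coe_rk_apply, h0]
    simp
  rw [hxpq, hq, sub_zero]
  exact hp

/-- Solvability of the resolvent equation of the compressed generator. -/
theorem exists_compress_resolvent {n : ℕ} {z : finOpSA b} (hz : z ∈ block b n) {c : ℝ}
    (hc : 0 < c) : ∃ x ∈ block b n, c • x - compress b n (𝓛.gen x) = z := by
  let T : block b n →ₗ[ℝ] block b n :=
    (c • LinearMap.id - compress b n ∘ₗ 𝓛.gen).restrict fun x hx =>
      sub_mem (Submodule.smul_mem _ _ hx) (compress_mem_block n _)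
  have hT : ∀ x : block b n, (T x : finOpSA b) = c • (x : finOpSA b) -
    compress b n (𝓛.gen x) := fun x => rfl
  have hinj : Function.Injective T := by
    refine LinearMap.ker_eq_bot.1 (LinearMap.ker_eq_bot'.2 fun x hx => ?_)
    -- Applied to `x` and `-x`, positivity forces the kernel to be zero; finite dimension then gives
    -- surjectivity.
    have h1 : ∀ x : block b n, T x = 0 → 0 ≤ ((x : finOpSA b) : H →L[ℂ] H) := fun x hx => by
      refine 𝓛.nonneg_of_compress_nonneg x.2 hc ?_
      rw [← hT, hx]
      exact le_rfl
    have h2 := h1 (-x) (by rw [map_neg, hx, neg_zero])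
    exact Subtype.ext (Subtype.ext (le_antisymm (neg_nonneg.1 h2) (h1 x hx)))
  obtain ⟨x, hx⟩ := LinearMap.injective_iff_surjective.1 hinj ⟨z, hz⟩
  exact ⟨x, x.2, congrArg Subtype.val hx⟩

theorem mom_compress_resolvent_le {w : ℕ → ℝ} (hw : ∀ n, 0 ≤ w n) {ω c : ℝ}
    (hm : ∀ u, mom w (𝓛.gen (rk u)) ≤ ω * wq w u) {n : ℕ} {x : finOpSA b}
    (hx : 0 ≤ (x : H →L[ℂ] H)) (hn : x ∈ block b n) :
    (c - ω) * mom w x ≤ mom w (c • x - compress b n (𝓛.gen x)) := by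
  have h1 := 𝓛.mom_compress_gen_le hw hx hn
  have h2 := 𝓛.mom_gen_le_of_rk hm hx
  rw [map_sub, map_smul, smul_eq_mul]
  linarith

end GKSL

/-! ### The norm of W^{k,1} on `T_f` -/

section SobolevNorms
variable {H : Type*} [NormedAddCommGroup H] [InnerProductSpace ℂ H] [CompleteSpace H]
  {b : HilbertBasis ℕ ℂ H}

local instance (k : ℝ≥0) : Norm (Sobolev b k) := NormedAddCommGroup.toNorm

open Bosonic.Sobolev (ofFin)

theorem inner_weightInv (k : ℝ≥0) (y : H →L[ℂ] H) (u v : H) :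
    ⟪u, weightInv b k y v⟫_ℂ = ⟪numInvPow b (k / 4) u, y (numInvPow b (k / 4) v)⟫_ℂ := by
  rw [inner_numInvPow]
  rfl

theorem weightInv_nonneg (k : ℝ≥0) {y : H →L[ℂ] H} (hy : 0 ≤ y) : 0 ≤ weightInv b k y :=
  conj_nonneg_of_isSelfAdjoint hy (Sobolev.isSelfAdjoint_numInvPow _)

theorem denseRange_numInvPow (s : ℝ≥0) : DenseRange (numInvPow b s) := by
  have h : finVec b ≤ LinearMap.range (numInvPow b s).toLinearMap := by
    refine Submodule.span_le.2 ?_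
    rintro _ ⟨n, rfl⟩
    refine ⟨(((n + 1 : ℝ) ^ (-(s : ℝ)) : ℝ) : ℂ)⁻¹ • b n, ?_⟩
    change numInvPow b s _ = _
    rw [map_smul, numInvPow_basis, smul_smul, inv_mul_cancel₀ (weight_ne_zero _ n), one_smul]
  have hd : Dense (finVec b : Set H) := Submodule.dense_iff_topologicalClosure_eq_top.2 b.dense_span
  exact hd.mono h

theorem nonneg_of_weightInv_nonneg (k : ℝ≥0) {y : H →L[ℂ] H} (hs : IsSelfAdjoint y)
    (h : 0 ≤ weightInv b k y) : 0 ≤ y := by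
  rw [ContinuousLinearMap.nonneg_iff_isPositive, ContinuousLinearMap.isPositive_def']
  refine ⟨hs, fun v => ?_⟩
  have key : ∀ v, 0 ≤ (⟪v, y v⟫_ℂ).re := fun v => by
    refine (denseRange_numInvPow (b := b) (k / 4)).induction_on
      (p := fun v => 0 ≤ (⟪v, y v⟫_ℂ).re) v ?_ fun u => ?_
    · exact isClosed_le continuous_const (by fun_prop)
    · rw [← inner_weightInv]
      exact re_inner_nonneg h u
  rw [ContinuousLinearMap.reApplyInnerSelf_apply, ← inner_conj_symm, RCLike.conj_re]
  exact key v

theorem re_inner_weightInv (k : ℝ≥0) (y : H →L[ℂ] H) (n : ℕ) :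
    (⟪b n, y (b n)⟫_ℂ).re = momWeight k n * (⟪b n, weightInv b k y (b n)⟫_ℂ).re := by
  rw [inner_weightInv, numInvPow_basis, map_smul, inner_smul_left, inner_smul_right,
    Complex.conj_ofReal, Complex.re_ofReal_mul, Complex.re_ofReal_mul, ← mul_assoc, ← mul_assoc,
    momWeight, ← Real.rpow_add (by positivity), ← Real.rpow_add (by positivity)]
  have : (k : ℝ) / 2 + -((k / 4 : ℝ≥0) : ℝ) + -((k / 4 : ℝ≥0) : ℝ) = 0 := by
    push_cast
    ring
  rw [this, Real.rpow_zero, one_mul]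

theorem posTrace_weight {k : ℝ≥0} {p : finOpSA b} {y : H →L[ℂ] H} (hp : 0 ≤ (p : H →L[ℂ] H))
    (h : weightInv b k y = p) : posTrace b y = ENNReal.ofReal (mom (momWeight k) p) := by
  rw [mom_apply, ENNReal.ofReal_tsum_of_nonneg
    (fun n => mul_nonneg (momWeight_pos _ _).le (re_inner_nonneg hp _)) (summable_mom _ _)]
  refine tsum_congr fun n => ?_
  rw [re_inner_weightInv k y n, h]

/-- On positive operators, the norm of `W^{k,1}` is the moment `tr [x (N + 1)^(k/2)]`. -/
theorem norm_ofFin_of_nonneg (k : ℝ≥0) {p : finOpSA b} (hp : 0 ≤ (p : H →L[ℂ] H)) :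
    ‖ofFin k p‖ = mom (momWeight k) p := by
  have h := Sobolev.weightInv_weight (ofFin k p)
  rw [Sobolev.op_ofFin] at h
  have hy := nonneg_of_weightInv_nonneg k (Sobolev.weight b k (ofFin k p)).2.1 (h ▸ hp)
  rw [Sobolev.norm_eq, traceNorm_of_nonneg b hy, posTrace_weight hp h,
    ENNReal.toReal_ofReal (mom_nonneg (fun n => (momWeight_pos _ _).le) hp)]

theorem norm_ofFin_rk (k : ℝ≥0) (u : finVec b) : ‖ofFin k (rk u)‖ = wq (momWeight k) u := by
  rw [norm_ofFin_of_nonneg k (rk_nonneg u), mom_rk]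

/-- The norm of `W^{k,1}` is attained by a decomposition into positive operators. -/
theorem exists_sub_eq_norm (k : ℝ≥0) {n : ℕ} {x : finOpSA b} (hx : x ∈ block b n) :
    ∃ p ∈ block b n, ∃ q ∈ block b n, 0 ≤ (p : H →L[ℂ] H) ∧ 0 ≤ (q : H →L[ℂ] H) ∧ x = p - q ∧
      ‖ofFin k x‖ = mom (momWeight k) p + mom (momWeight k) q := by
  have h := Sobolev.weightInv_weight (ofFin k x)
  have hnorm := Sobolev.norm_eq (ofFin k x)
  obtain ⟨hys, hyt⟩ := (Sobolev.weight b k (ofFin k x)).2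
  rw [Sobolev.op_ofFin] at h
  set y : H →L[ℂ] H := (Sobolev.weight b k (ofFin k x) : H →L[ℂ] H)
  have hw : ∀ z : H →L[ℂ] H, ∀ m, weightInv b k z (b m) = 0 ↔ z (b m) = 0 := fun z m => by
    change numInvPow b (k / 4) (z (numInvPow b (k / 4) (b m))) = 0 ↔ _
    rw [numInvPow_basis, map_smul, map_smul]
    refine ⟨fun h => numInvPow_eq_zero b _ ((smul_eq_zero.1 h).resolve_left (weight_ne_zero _ m)),
      fun h => by rw [h, map_zero, smul_zero]⟩
  have hy0 : ∀ m ≥ n, y (b m) = 0 := fun m hm => by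
    rw [← hw, h]
    exact mem_block_iff_apply.1 hx m hm
  -- The parts are those of the weighted operator `y`, not of `x`: the norm is additive on them, and
  -- removing the weights keeps them positive and in the block.
  have hp := CFC.posPart_nonneg y
  have hq := CFC.negPart_nonneg y
  have hp0 : ∀ m ≥ n, weightInv b k y⁺ (b m) = 0 := fun m hm =>
    (hw _ m).2 (posPart_negPart_apply_eq_zero hys (hy0 m hm)).1
  have hq0 : ∀ m ≥ n, weightInv b k y⁻ (b m) = 0 := fun m hm =>
    (hw _ m).2 (posPart_negPart_apply_eq_zero hys (hy0 m hm)).2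
  have hwp := weightInv_nonneg (b := b) k hp
  have hwq := weightInv_nonneg (b := b) k hq
  let p : finOpSA b := ⟨weightInv b k y⁺, mem_finOpSA_of_apply (IsSelfAdjoint.of_nonneg hwp) hp0⟩
  let q : finOpSA b := ⟨weightInv b k y⁻, mem_finOpSA_of_apply (IsSelfAdjoint.of_nonneg hwq) hq0⟩
  refine ⟨p, mem_block_iff_apply.2 hp0, q, mem_block_iff_apply.2 hq0, hwp, hwq, Subtype.ext ?_, ?_⟩
  · rw [AddSubgroupClass.coe_sub]
    change _ = weightInv b k y⁺ - weightInv b k y⁻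
    rw [← map_sub, CFC.posPart_sub_negPart y hys, h]
  · have hm : ∀ z : finOpSA b, 0 ≤ (z : H →L[ℂ] H) → 0 ≤ mom (momWeight k) z := fun z hz =>
      mom_nonneg (fun n => (momWeight_pos _ _).le) hz
    rw [hnorm, traceNorm_eq b hys, posTrace_weight (p := p) hwp rfl,
      posTrace_weight (p := q) hwq rfl,
      ← ENNReal.ofReal_add (hm p hwp) (hm q hwq),
      ENNReal.toReal_ofReal (add_nonneg (hm p hwp) (hm q hwq))]

theorem wq_add_add_wq_sub (w : ℕ → ℝ) (u v : finVec b) :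
    wq w (u + v) + wq w (u - v) = 2 * wq w u + 2 * wq w v := by
  have h1 : wq w (-v) = wq w v := by
    rw [wq, wq, map_neg, inner_neg_left, inner_neg_right, neg_neg]
  rw [sub_eq_add_neg, wq_add, wq_add, h1, inner_neg_right, Complex.neg_re]
  ring

theorem wq_smul (w : ℕ → ℝ) (c : ℂ) (u : finVec b) : wq w (c • u) = ‖c‖ ^ 2 * wq w u := by
  rw [wq, wq, map_smul, inner_smul_left, inner_smul_right, ← mul_assoc, mul_comm (starRingEnd ℂ c),
    Complex.mul_conj, Complex.normSq_eq_norm_sq, Complex.re_ofReal_mul]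

/-- The operator does not change when (u, v) becomes (αu, α⁻¹v). After polarization, the free `α`
distributes the smallness of one vector over both terms. -/
theorem norm_ofFin_symRk_le (k : ℝ≥0) (u v : finVec b) {α : ℝ} (hα : α ≠ 0) :
    ‖ofFin k (symRk u v)‖ ≤
      α ^ 2 * wq (momWeight k) u + (α⁻¹) ^ 2 * wq (momWeight k) v := by
  set u' := (α : ℂ) • u with hu
  set v' := ((α⁻¹ : ℝ) : ℂ) • v with hv
  have e : symRk u v = (2⁻¹ : ℝ) • (rk (u' + v') - rk (u' - v')) := by
    refine Subtype.ext (ContinuousLinearMap.ext fun x => ?_)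
    rw [coe_symRk_apply, Submodule.coe_smul, smul_apply, AddSubgroupClass.coe_sub, sub_apply,
      coe_rk_apply, coe_rk_apply]
    push_cast
    have hc : (α : ℂ) ≠ 0 := by exact_mod_cast hα
    have h2 : ∀ z : H, (2⁻¹ : ℝ) • z = (2⁻¹ : ℂ) • z := fun z => by
      rw [← Complex.coe_smul]
      push_cast
      rfl
    rw [h2, hu, hv]
    push_cast
    simp only [inner_add_left, inner_sub_left, inner_smul_left, Complex.conj_ofReal, map_inv₀]
    match_scalars
    · field_simp
      ring
    · field_simp
      ring
  rw [e, map_smul, map_sub, norm_smul]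
  refine (mul_le_mul_of_nonneg_left (norm_sub_le _ _) (norm_nonneg _)).trans_eq ?_
  rw [norm_ofFin_rk, norm_ofFin_rk, wq_add_add_wq_sub, hu, hv, wq_smul, wq_smul, Complex.norm_real,
    Complex.norm_real, Real.norm_eq_abs, Real.norm_eq_abs, Real.norm_eq_abs, sq_abs, sq_abs,
    abs_of_pos (by norm_num : (0 : ℝ) < 2⁻¹)]
  ring

end SobolevNorms

/-! ### Moment bounds for polynomials of the ladder operators -/

section PolynomialBounds
variable {H : Type*} [NormedAddCommGroup H] [InnerProductSpace ℂ H] [CompleteSpace H]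
  {b : HilbertBasis ℕ ℂ H}

/-- A functional on `H_f` bounded by a multiple of some moment form. -/
def IsMomentBounded (Q : finVec b → ℝ) : Prop :=
  ∃ C d : ℝ≥0, ∀ u, Q u ≤ C * wq (momWeight d) u

theorem wq_momWeight_nonneg (k : ℝ) (u : finVec b) : 0 ≤ wq (momWeight k) u :=
  wq_nonneg (fun n => (momWeight_pos k n).le) u

theorem isMomentBounded_wq (k : ℝ≥0) : IsMomentBounded fun u : finVec b => wq (momWeight k) u :=
  ⟨1, k, fun u => by simp⟩

theorem IsMomentBounded.mono {Q Q' : finVec b → ℝ} (h : IsMomentBounded Q) (hQ : ∀ u, Q' u ≤ Q u) :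
    IsMomentBounded Q' := by
  obtain ⟨C, d, h⟩ := h
  exact ⟨C, d, fun u => (hQ u).trans (h u)⟩

theorem IsMomentBounded.add {Q Q' : finVec b → ℝ} (h : IsMomentBounded Q)
    (h' : IsMomentBounded Q') : IsMomentBounded fun u => Q u + Q' u := by
  obtain ⟨C, d, h⟩ := h
  obtain ⟨C', d', h'⟩ := h'
  refine ⟨C + C', max d d', fun u => (add_le_add (h u) (h' u)).trans ?_⟩
  rw [NNReal.coe_add, add_mul]
  gcongr
  · exact wq_mono (momWeight_mono (by exact_mod_cast le_max_left d d')) u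
  · exact wq_mono (momWeight_mono (by exact_mod_cast le_max_right d d')) u

theorem IsMomentBounded.const_mul {Q : finVec b → ℝ} (h : IsMomentBounded Q) (a : ℝ≥0) :
    IsMomentBounded fun u => a * Q u := by
  obtain ⟨C, d, h⟩ := h
  refine ⟨a * C, d, fun u => ?_⟩
  rw [NNReal.coe_mul, mul_assoc]
  exact mul_le_mul_of_nonneg_left (h u) a.2

theorem IsMomentBounded.sum {ι : Type*} (s : Finset ι) {Q : ι → finVec b → ℝ}
    (h : ∀ i, IsMomentBounded (Q i)) : IsMomentBounded fun u => ∑ i ∈ s, Q i u := by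
  classical
  induction s using Finset.induction_on with
  | empty => exact ⟨0, 0, fun u => by simp⟩
  | insert i s hi ih => simp only [Finset.sum_insert hi]; exact (h i).add ih

/-- Linear maps of `H_f` all of whose moment forms are bounded by moment forms. -/
def IsOrderBounded (A : Module.End ℂ (finVec b)) : Prop :=
  ∀ k : ℝ≥0, IsMomentBounded fun u => wq (momWeight k) (A u)

theorem isOrderBounded_smul_one (c : ℂ) : IsOrderBounded (c • (1 : Module.End ℂ (finVec b))) :=
  fun k => ⟨‖c‖₊ ^ 2, k, fun u => by
    beta_reduce
    rw [LinearMap.smul_apply, Module.End.one_apply, wq_smul]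
    simp⟩

theorem IsOrderBounded.mul {A B : Module.End ℂ (finVec b)} (hA : IsOrderBounded A)
    (hB : IsOrderBounded B) : IsOrderBounded (A * B) := fun k => by
  obtain ⟨C, d, h⟩ := hA k
  exact ((hB d).const_mul C).mono fun u => h _

theorem IsOrderBounded.add {A B : Module.End ℂ (finVec b)} (hA : IsOrderBounded A)
    (hB : IsOrderBounded B) : IsOrderBounded (A + B) := fun k => by
  refine (((hA k).const_mul 2).add ((hB k).const_mul 2)).mono fun u => ?_
  have h1 := wq_add_add_wq_sub (momWeight k) (A u) (B u)
  have h2 := wq_momWeight_nonneg k (A u - B u)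
  rw [LinearMap.add_apply]
  push_cast
  linarith

theorem IsOrderBounded.smul {A : Module.End ℂ (finVec b)} (hA : IsOrderBounded A) (c : ℂ) :
    IsOrderBounded (c • A) := by
  simpa using (isOrderBounded_smul_one c).mul hA

theorem IsOrderBounded.sum {ι : Type*} (s : Finset ι) {A : ι → Module.End ℂ (finVec b)}
    (h : ∀ i, IsOrderBounded (A i)) : IsOrderBounded (∑ i ∈ s, A i) := by
  classical
  induction s using Finset.induction_on with
  | empty => simpa using isOrderBounded_smul_one (b := b) 0
  | insert i s hi ih => rw [Finset.sum_insert hi]; exact (h i).add ih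

theorem inner_fock_annihilation (n : ℕ) (u : finVec b) :
    ⟪fock b n, annihilation b u⟫_ℂ = ((√((n : ℝ) + 1) : ℝ) : ℂ) * ⟪fock b (n + 1), u⟫_ℂ := by
  rw [← (isFormalAdjoint_annihilation b).symm, creation, Module.Basis.constr_basis, inner_smul_left,
    Complex.conj_ofReal]

theorem inner_fock_creation (n : ℕ) (u : finVec b) :
    ⟪fock b n, creation b u⟫_ℂ = ((√(n : ℝ) : ℝ) : ℂ) * ⟪fock b (n - 1), u⟫_ℂ := by
  rw [← isFormalAdjoint_annihilation b, annihilation, Module.Basis.constr_basis, inner_smul_left,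
    Complex.conj_ofReal]

/-- The squared coefficient of a u at n is (n+1)|u_(n+1)|². The extra factor is one power of N + 1,
that is, two units of `k`. -/
theorem isOrderBounded_annihilation : IsOrderBounded (annihilation b) := fun k => by
  refine ⟨1, k + 2, fun u => ?_⟩
  have h1 := hasSum_wq (momWeight k) (annihilation b u)
  have h2 := hasSum_wq (momWeight (k + 2 : ℝ≥0)) u
  have h3 := (hasSum_nat_add_iff' 1).2 h2
  rw [NNReal.coe_one, one_mul]
  refine (hasSum_le (fun n => ?_) h1 h3).trans ?_
  · rw [inner_fock_annihilation, norm_mul, mul_pow, Complex.norm_real, Real.norm_eq_abs, sq_abs,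
      Real.sq_sqrt (by positivity), ← mul_assoc]
    gcongr
    have e : momWeight (k + 2 : ℝ≥0) (n + 1) = ((n : ℝ) + 2) ^ ((k : ℝ) / 2) * (n + 2) := by
      rw [momWeight, ← Real.rpow_add_one (by positivity)]
      push_cast
      congr 1 <;> ring
    rw [e, momWeight]
    gcongr <;> linarith
  · rw [sub_le_self_iff]
    exact Finset.sum_nonneg fun n _ => mul_nonneg (momWeight_pos _ _).le (sq_nonneg _)

theorem isOrderBounded_creation : IsOrderBounded (creation b) := fun k => by
  -- The constant comes from the shift of the weight: n + 2 ≤ 2(n + 1), raised to the power k/2.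
  refine ⟨2 ^ ((k : ℝ) / 2), k + 2, fun u => ?_⟩
  have h1 := (hasSum_nat_add_iff' 1).2 (hasSum_wq (momWeight k) (creation b u))
  have h2 := (hasSum_wq (momWeight (k + 2 : ℝ≥0)) u).mul_left ((2 : ℝ) ^ ((k : ℝ) / 2))
  rw [Finset.sum_range_one, inner_fock_creation] at h1
  simp only [Nat.cast_zero, Real.sqrt_zero, Complex.ofReal_zero, zero_mul, norm_zero, ne_eq,
    OfNat.ofNat_ne_zero, not_false_eq_true, zero_pow, mul_zero, sub_zero] at h1
  rw [NNReal.coe_rpow]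
  refine hasSum_le (fun n => ?_) h1 h2
  rw [inner_fock_creation, norm_mul, mul_pow, Complex.norm_real, Real.norm_eq_abs, sq_abs,
    Real.sq_sqrt (by positivity), ← mul_assoc, ← mul_assoc, Nat.add_sub_cancel]
  refine mul_le_mul_of_nonneg_right ?_ (sq_nonneg _)
  have e : momWeight (k + 2 : ℝ≥0) n = ((n : ℝ) + 1) ^ ((k : ℝ) / 2) * (n + 1) := by
    rw [momWeight, ← Real.rpow_add_one (by positivity)]
    push_cast
    congr 1
    ring
  rw [e, momWeight, ← mul_assoc, ← Real.mul_rpow (by norm_num) (by positivity)]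
  push_cast
  gcongr
  linarith

theorem IsFormalAdjoint.unique {A B B' : Module.End ℂ (finVec b)} (h : IsFormalAdjoint b A B)
    (h' : IsFormalAdjoint b A B') : B = B' :=
  LinearMap.ext fun v => ext_inner_fock fun n => by rw [← h, ← h']

/-- In the induction an explicit adjoint is built along with the polynomial; uniqueness identifies
it with the chosen one. -/
theorem isOrderBounded_ladderPoly (p : FreeAlgebra ℂ (Fin 2)) :
    IsOrderBounded (ladderPoly b p) ∧ IsOrderBounded (formalAdjoint b (ladderPoly b p)) := by
  suffices IsOrderBounded (ladderPoly b p) ∧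
      ∃ B, IsFormalAdjoint b (ladderPoly b p) B ∧ IsOrderBounded B by
    obtain ⟨h, B, hB, hB'⟩ := this
    rw [← hB.unique (isFormalAdjoint_ladderPoly b p)]
    exact ⟨h, hB'⟩
  induction p using FreeAlgebra.induction with
  | grade0 c =>
    have e : ladderPoly b (algebraMap ℂ _ c) = c • 1 := by
      rw [ladderPoly, AlgHom.commutes, Algebra.algebraMap_eq_smul_one]
    rw [e]
    refine ⟨isOrderBounded_smul_one c, (starRingEnd ℂ c) • 1, fun u v => ?_,
      isOrderBounded_smul_one _⟩
    simp [mul_comm]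
  | grade1 i =>
    fin_cases i
    · simp only [ladderPoly, FreeAlgebra.lift_ι_apply]
      exact ⟨isOrderBounded_annihilation, creation b, isFormalAdjoint_annihilation b,
        isOrderBounded_creation⟩
    · simp only [ladderPoly, FreeAlgebra.lift_ι_apply]
      exact ⟨isOrderBounded_creation, annihilation b, (isFormalAdjoint_annihilation b).symm,
        isOrderBounded_annihilation⟩
  | mul p q hp hq =>
    obtain ⟨h, B, hB, hB'⟩ := hp
    obtain ⟨h', C, hC, hC'⟩ := hq
    have e : ladderPoly b (p * q) = ladderPoly b p * ladderPoly b q := map_mul _ _ _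
    rw [e]
    refine ⟨h.mul h', C * B, fun u v => ?_, hC'.mul hB'⟩
    rw [Module.End.mul_apply, Module.End.mul_apply, hB, hC]
  | add p q hp hq =>
    obtain ⟨h, B, hB, hB'⟩ := hp
    obtain ⟨h', C, hC, hC'⟩ := hq
    have e : ladderPoly b (p + q) = ladderPoly b p + ladderPoly b q := map_add _ _ _
    rw [e]
    refine ⟨h.add h', B + C, fun u v => ?_, hB'.add hC'⟩
    rw [LinearMap.add_apply, LinearMap.add_apply, inner_add_left, inner_add_right, hB, hC]

end PolynomialBounds

namespace GKSL
variable {H : Type*} [NormedAddCommGroup H] [InnerProductSpace ℂ H] [CompleteSpace H]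
  {b : HilbertBasis ℕ ℂ H} (𝓛 : GKSL b)

theorem isOrderBounded_jump (j) : IsOrderBounded (𝓛.jump j) := (isOrderBounded_ladderPoly _).1

theorem isOrderBounded_drift : IsOrderBounded 𝓛.drift := by
  have h : 𝓛.drift = (-Complex.I) • 𝓛.ham + (-(1 / 2) : ℂ) • ∑ j, 𝓛.jumpAdj j * 𝓛.jump j := by
    rw [drift, sub_eq_add_neg]
    refine LinearMap.ext fun v => ?_
    simp only [LinearMap.add_apply, LinearMap.neg_apply, LinearMap.smul_apply, neg_smul]
  rw [h]
  exact ((isOrderBounded_ladderPoly _).1.smul _).add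
    ((IsOrderBounded.sum _ fun j => (isOrderBounded_ladderPoly _).2.mul
      (𝓛.isOrderBounded_jump j)).smul _)

end GKSL

/-! ### The error made by compressing the generator -/

section Tails
variable {H : Type*} [NormedAddCommGroup H] [InnerProductSpace ℂ H] [CompleteSpace H]
  {b : HilbertBasis ℕ ℂ H}

/-- The projection of `H_f` onto the span of `|0⟩, …, |n - 1⟩`. -/
def headProj (b : HilbertBasis ℕ ℂ H) (n : ℕ) : Module.End ℂ (finVec b) :=
  diag b fun m => if m < n then 1 else 0

/-- The projection of `H_f` onto the span of `|n⟩, |n + 1⟩, …`. -/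
def tailProj (b : HilbertBasis ℕ ℂ H) (n : ℕ) : Module.End ℂ (finVec b) :=
  diag b fun m => if m < n then 0 else 1

theorem headProj_add_tailProj (n : ℕ) (u : finVec b) : headProj b n u + tailProj b n u = u := by
  rw [headProj, tailProj, diag_add]
  convert diag_one u using 3
  ext m
  split_ifs <;> simp

theorem coe_headProj (n : ℕ) (u : finVec b) : (headProj b n u : H) = cutoff b n u := by
  apply b.repr.injective
  ext l
  have hs := ContinuousLinearMap.isSelfAdjoint_iff_isSymmetric.1 (isSelfAdjoint_cutoff b n) (b l) u
  simp only [ContinuousLinearMap.coe_coe] at hs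
  have h := inner_fock_diag (fun m => if m < n then 1 else 0) l u
  rw [Submodule.coe_inner, Submodule.coe_inner, coe_fock] at h
  rw [b.repr_apply_apply, b.repr_apply_apply, ← hs, cutoff_basis]
  refine h.trans ?_
  split_ifs <;> simp

theorem compress_rk (n : ℕ) (u : finVec b) : compress b n (rk u) = rk (headProj b n u) := by
  refine Subtype.ext (ContinuousLinearMap.ext fun v => ?_)
  have hs := ContinuousLinearMap.isSelfAdjoint_iff_isSymmetric.1 (isSelfAdjoint_cutoff b n) u v
  simp only [ContinuousLinearMap.coe_coe] at hs
  rw [coe_rk_apply, coe_headProj, hs, coe_compress, mul_apply_eq_comp, mul_apply_eq_comp,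
    coe_rk_apply, map_smul]

theorem compress_symRk (n : ℕ) (u v : finVec b) :
    compress b n (symRk u v) = symRk (headProj b n u) (headProj b n v) := by
  rw [symRk, symRk, map_sub, map_sub, compress_rk, compress_rk, compress_rk, map_add]

theorem symRk_add_right (u v w : finVec b) : symRk u (v + w) = symRk u v + symRk u w := by
  refine Subtype.ext (ContinuousLinearMap.ext fun x => ?_)
  rw [Submodule.coe_add, add_apply, coe_symRk_apply, coe_symRk_apply, coe_symRk_apply,
    Submodule.coe_add, inner_add_left, add_smul, smul_add]
  abel

theorem wq_headProj_le (k : ℝ) (n : ℕ) (u : finVec b) :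
    wq (momWeight k) (headProj b n u) ≤ wq (momWeight k) u := by
  rw [headProj, wq_diag]
  refine wq_mono (fun m => ?_) u
  have := momWeight_pos k m
  split_ifs <;> simp [this.le]

/-- Raising `k` by 8 multiplies the weights by (m+1)⁴, at least (n+1)⁴ on the tail. Two of these
four powers are spent on α⁻² in `norm_ofFin_symRk_le`; the other two remain as decay. -/
theorem wq_tailProj_le (k : ℝ) (n : ℕ) (u : finVec b) :
    wq (momWeight k) (tailProj b n u) ≤ ((n : ℝ) + 1)⁻¹ ^ 4 * wq (momWeight (k + 8)) u := by
  rw [tailProj, wq_diag, ← wq_const_mul]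
  refine wq_mono (fun m => ?_) u
  have h8 : momWeight (k + 8) m = momWeight k m * ((m : ℝ) + 1) ^ 4 := by
    rw [momWeight, momWeight, add_div, Real.rpow_add (by positivity)]
    norm_num
  have hpos := momWeight_pos k m
  split_ifs with h
  · have := momWeight_pos (k + 8) m
    simp only [ne_eq, OfNat.ofNat_ne_zero, not_false_eq_true, zero_pow, mul_zero]
    positivity
  · rw [h8, one_pow, mul_one, inv_pow, mul_left_comm]
    refine le_mul_of_one_le_right hpos.le ?_
    rw [inv_mul_eq_div, one_le_div (by positivity)]
    have : (n : ℝ) ≤ m := by exact_mod_cast not_lt.1 h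
    gcongr

end Tails

namespace GKSL
variable {H : Type*} [NormedAddCommGroup H] [InnerProductSpace ℂ H] [CompleteSpace H]
  {b : HilbertBasis ℕ ℂ H} (𝓛 : GKSL b)

local instance (k : ℝ≥0) : Norm (Sobolev b k) := NormedAddCommGroup.toNorm

open Bosonic.Sobolev (ofFin)

theorem norm_gen_rk_sub_compress_le (k : ℝ≥0) (n : ℕ) {u : finVec b} (hu : headProj b n u = u) :
    ‖ofFin k (𝓛.gen (rk u) - compress b n (𝓛.gen (rk u)))‖ ≤ ((n : ℝ) + 1)⁻¹ ^ 2 *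
      (wq (momWeight k) u + wq (momWeight (k + 8)) (𝓛.drift u) +
        ∑ j, 3 * wq (momWeight (k + 8)) (𝓛.jump j u)) := by
  set ε : ℝ := ((n : ℝ) + 1)⁻¹ with hε
  have hε0 : 0 < ε := by positivity
  have hε1 : ε ≤ 1 := inv_le_one_of_one_le₀ (by simp)
  -- Because `u` lies in the block, every term of the difference contains a tail: of the drift of
  -- `u`, or of a jump applied to `u`.
  have e : 𝓛.gen (rk u) - compress b n (𝓛.gen (rk u)) = symRk u (tailProj b n (𝓛.drift u)) +
      ∑ j, (symRk (headProj b n (𝓛.jump j u)) (tailProj b n (𝓛.jump j u)) +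
        rk (tailProj b n (𝓛.jump j u))) := by
    have h1 : symRk u (𝓛.drift u) = symRk u (headProj b n (𝓛.drift u)) +
        symRk u (tailProj b n (𝓛.drift u)) := by
      rw [← symRk_add_right, headProj_add_tailProj]
    rw [gen_rk, map_add, map_sum, compress_symRk, hu, h1]
    simp only [compress_rk, symRk, headProj_add_tailProj, sub_add_cancel, Finset.sum_sub_distrib]
    abel
  have hs : ∀ v w : finVec b, ‖ofFin k (symRk v (tailProj b n w))‖ ≤
      ε ^ 2 * (wq (momWeight k) v + wq (momWeight (k + 8)) w) := fun v w => by
    -- The choice α = ε = 1/(n+1) balances the terms: the first is of order ε², the second ε⁻² ε⁴.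
    refine (norm_ofFin_symRk_le k v _ hε0.ne').trans ?_
    have h1 := mul_le_mul_of_nonneg_left (wq_tailProj_le k n w) (sq_nonneg ε⁻¹)
    rw [← hε, ← mul_assoc] at h1
    have h2 : ε⁻¹ ^ 2 * ε ^ 4 = ε ^ 2 := by field_simp
    rw [h2] at h1
    linarith
  have hr : ∀ w : finVec b, ‖ofFin k (rk (tailProj b n w))‖ ≤ ε ^ 2 * wq (momWeight (k + 8)) w :=
    fun w => by
      rw [norm_ofFin_rk]
      refine (wq_tailProj_le k n w).trans ?_
      refine mul_le_mul_of_nonneg_right ?_ (wq_momWeight_nonneg _ _)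
      exact pow_le_pow_of_le_one hε0.le hε1 (by norm_num)
  rw [e, map_add, map_sum]
  refine (norm_add_le _ _).trans ?_
  rw [mul_add, Finset.mul_sum]
  refine add_le_add (hs _ _) ((norm_sum_le _ _).trans (Finset.sum_le_sum fun j _ => ?_))
  rw [map_add]
  refine (norm_add_le _ _).trans ((add_le_add (hs _ _) (hr _)).trans ?_)
  rw [← mul_add]
  gcongr
  have h1 := wq_headProj_le k n (𝓛.jump j u)
  have h2 := wq_mono (momWeight_mono (by linarith : (k : ℝ) ≤ k + 8)) (𝓛.jump j u)
  linarith

/-- The error of the compression of the generator. -/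
theorem exists_norm_gen_sub_compress_le (k : ℝ≥0) : ∃ C d : ℝ≥0, ∀ k' ≥ d, ∀ n, ∀ x ∈ block b n,
    ‖ofFin k (𝓛.gen x - compress b n (𝓛.gen x))‖ ≤ ((n : ℝ) + 1)⁻¹ ^ 2 * (C * ‖ofFin k' x‖) := by
  -- A single moment, independent of n, controls all the terms of the rank-one estimate.
  have h : IsMomentBounded fun u => wq (momWeight k) u + wq (momWeight (k + 8)) (𝓛.drift u) +
        ∑ j, 3 * wq (momWeight (k + 8)) (𝓛.jump j u) :=
    ((isMomentBounded_wq k).add (𝓛.isOrderBounded_drift (k + 8))).add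
      (IsMomentBounded.sum _ fun j => ((𝓛.isOrderBounded_jump j) (k + 8)).const_mul 3)
  obtain ⟨C, d, h⟩ := h
  refine ⟨C, d, fun k' hk' n x hx => ?_⟩
  have hpos : ∀ p ∈ block b n, 0 ≤ (p : H →L[ℂ] H) →
      ‖ofFin k (𝓛.gen p - compress b n (𝓛.gen p))‖ ≤
        ((n : ℝ) + 1)⁻¹ ^ 2 * (C * mom (momWeight k') p) := by
    intro p hp hp0
    obtain ⟨ψ, -, hψ, e⟩ := exists_sum_rk_eq hp0 hp
    have hhead : ∀ m, headProj b n (ψ m) = ψ m := fun m => ext_inner_fock fun l => by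
      rw [headProj, inner_fock_diag]
      split_ifs with hl
      · simp
      · rw [hψ m l (not_lt.1 hl), mul_zero]
    rw [e]
    simp only [map_sum, ← Finset.sum_sub_distrib, mom_rk, Finset.mul_sum]
    refine (norm_sum_le _ _).trans (Finset.sum_le_sum fun m _ => ?_)
    refine (𝓛.norm_gen_rk_sub_compress_le k n (hhead m)).trans ?_
    gcongr
    refine (h _).trans ?_
    gcongr
    exact wq_mono (momWeight_mono (by exact_mod_cast hk')) _
  obtain ⟨p, hp, q, hq, hp0, hq0, rfl, hnorm⟩ := exists_sub_eq_norm k' hx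
  have e : 𝓛.gen (p - q) - compress b n (𝓛.gen (p - q)) =
      (𝓛.gen p - compress b n (𝓛.gen p)) - (𝓛.gen q - compress b n (𝓛.gen q)) := by
    rw [map_sub, map_sub]
    abel
  rw [e, map_sub, hnorm]
  refine (norm_sub_le _ _).trans ((add_le_add (hpos p hp hp0) (hpos q hq hq0)).trans_eq ?_)
  ring

end GKSL

/-! ### Dissipativity, dense range and resolvents on W^{k,1} -/

namespace GKSL
variable {H : Type*} [NormedAddCommGroup H] [InnerProductSpace ℂ H] [CompleteSpace H]
  {b : HilbertBasis ℕ ℂ H} (𝓛 : GKSL b)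

local instance (k : ℝ≥0) : Norm (Sobolev b k) := NormedAddCommGroup.toNorm

open Bosonic.Sobolev (ofFin)

/-- The moment inequality with exponent `k` and rate `ω`, for operators of rank one. -/
def HasMomentRate (k ω : ℝ) : Prop :=
  ∀ u, mom (momWeight k) (𝓛.gen (rk u)) ≤ ω * wq (momWeight k) u

theorem mom_one_gen_rk (u : finVec b) : mom (fun _ => 1) (𝓛.gen (rk u)) = 0 := by
  rw [mom_gen_rk, diag_one]
  simp only [wq_one]
  exact 𝓛.two_mul_re_inner_drift u

theorem mom_one_gen (x : finOpSA b) : mom (fun _ => 1) (𝓛.gen x) = 0 := by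
  obtain ⟨n, hn⟩ := (eventually_mem_block x).exists
  obtain ⟨p, hp, q, hq, hp0, hq0, rfl, -⟩ := exists_sub_eq_norm 0 hn
  obtain ⟨ψ, -, -, rfl⟩ := exists_sum_rk_eq hp0 hp
  obtain ⟨φ, -, -, rfl⟩ := exists_sum_rk_eq hq0 hq
  simp only [map_sub, map_sum, mom_one_gen_rk, Finset.sum_const_zero, sub_zero]

/-- The moment of exponent 0 is the trace. This is the extra endpoint of the interpolation, and the
source of contractivity for k = 0. -/
theorem hasMomentRate_zero : 𝓛.HasMomentRate 0 0 := fun u => by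
  have : momWeight 0 = fun _ => 1 := by
    ext n
    simp [momWeight]
  rw [this, mom_one_gen_rk, zero_mul]

theorem opTrace_gen (x : finOpSA b) : opTrace b (𝓛.gen x : H →L[ℂ] H) = 0 := by
  have h := 𝓛.mom_one_gen x
  rw [mom_apply] at h
  have e : ∀ n, ⟪b n, (𝓛.gen x : H →L[ℂ] H) (b n)⟫_ℂ =
      ((1 * (⟪b n, (𝓛.gen x : H →L[ℂ] H) (b n)⟫_ℂ).re : ℝ) : ℂ) := fun n => by
    have hs := ContinuousLinearMap.isSelfAdjoint_iff_isSymmetric.1 (𝓛.gen x).2.1 (b n) (b n)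
    simp only [ContinuousLinearMap.coe_coe] at hs
    rw [one_mul]
    refine (Complex.conj_eq_iff_re.1 ?_).symm
    rw [inner_conj_symm, hs]
  rw [opTrace, tsum_congr e, ← Complex.ofReal_tsum, h, Complex.ofReal_zero]

theorem eq_zero_of_compress {n : ℕ} {x : finOpSA b} (hn : x ∈ block b n) {c : ℝ} (hc : 0 < c)
    (h : c • x - compress b n (𝓛.gen x) = 0) : x = 0 := by
  have h1 : 0 ≤ (x : H →L[ℂ] H) := 𝓛.nonneg_of_compress_nonneg hn hc (by rw [h]; exact le_rfl)
  have h2 : 0 ≤ ((-x : finOpSA b) : H →L[ℂ] H) := by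
    refine 𝓛.nonneg_of_compress_nonneg (neg_mem hn) hc ?_
    have : c • (-x) - compress b n (𝓛.gen (-x)) = 0 := by
      rw [map_neg, map_neg, smul_neg, ← neg_sub', h, neg_zero]
    rw [this]
    exact le_rfl
  exact Subtype.ext (le_antisymm (neg_nonneg.1 h2) h1)

/-- The right-hand side splits into positive operators without loss of norm. Each has a positive
solution, whose norm is a moment and obeys the moment inequality; by uniqueness `x` is the
difference of the two solutions. -/
theorem norm_le_norm_compress {k : ℝ≥0} {ω c : ℝ} (hm : 𝓛.HasMomentRate k ω) (hc : 0 < c)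
    (hω : ω < c) {n : ℕ} {x : finOpSA b} (hn : x ∈ block b n) :
    (c - ω) * ‖ofFin k x‖ ≤ ‖ofFin k (c • x - compress b n (𝓛.gen x))‖ := by
  have hz : c • x - compress b n (𝓛.gen x) ∈ block b n :=
    sub_mem (Submodule.smul_mem _ _ hn) (compress_mem_block n _)
  obtain ⟨p, hp, q, hq, hp0, hq0, e, hnorm⟩ := exists_sub_eq_norm k hz
  obtain ⟨y, hy, hyp⟩ := 𝓛.exists_compress_resolvent hp hc
  obtain ⟨z, hz, hzq⟩ := 𝓛.exists_compress_resolvent hq hc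
  have hy0 := 𝓛.nonneg_of_compress_nonneg hy hc (hyp ▸ hp0)
  have hz0 := 𝓛.nonneg_of_compress_nonneg hz hc (hzq ▸ hq0)
  have hx : x = y - z := by
    rw [← sub_eq_zero]
    refine 𝓛.eq_zero_of_compress (sub_mem hn (sub_mem hy hz)) hc ?_
    have : c • (x - (y - z)) - compress b n (𝓛.gen (x - (y - z))) =
        (c • x - compress b n (𝓛.gen x)) - ((c • y - compress b n (𝓛.gen y)) -
          (c • z - compress b n (𝓛.gen z))) := by
      simp only [map_sub, smul_sub]
      abel
    rw [this, e, hyp, hzq, sub_self]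
  have h1 := 𝓛.mom_compress_resolvent_le (c := c) (fun n => (momWeight_pos k n).le) hm hy0 hy
  have h2 := 𝓛.mom_compress_resolvent_le (c := c) (fun n => (momWeight_pos k n).le) hm hz0 hz
  rw [hyp] at h1
  rw [hzq] at h2
  rw [hnorm]
  refine le_trans ?_ (add_le_add h1 h2)
  rw [← mul_add, hx, map_sub]
  refine mul_le_mul_of_nonneg_left ?_ (sub_nonneg.2 hω.le)
  rw [← norm_ofFin_of_nonneg k hy0, ← norm_ofFin_of_nonneg k hz0]
  exact norm_sub_le _ _

/-- The generator is quasi-dissipative on `T_f`. -/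
theorem norm_le_norm_shift {k : ℝ≥0} {ω c : ℝ} (hm : 𝓛.HasMomentRate k ω) (hc : 0 < c)
    (hω : ω < c) (x : finOpSA b) : (c - ω) * ‖ofFin k x‖ ≤ ‖ofFin k (c • x - 𝓛.gen x)‖ := by
  -- In a block that contains both `x` and its image, the compression does nothing.
  obtain ⟨n, hn, hn'⟩ := ((eventually_mem_block x).and (eventually_mem_block (𝓛.gen x))).exists
  have := 𝓛.norm_le_norm_compress hm hc hω hn
  rwa [mem_block.1 hn'] at this

/-- The resolvent equation is approximately solvable in `T_f`. -/
theorem exists_tendsto_shift (k : ℝ≥0)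
    (hr : ∀ d : ℝ≥0, ∃ k' ≥ d, ∃ ω, 𝓛.HasMomentRate k' ω) :
    ∃ l : ℝ, ∀ c > l, ∀ z : finOpSA b, ∃ x : ℕ → finOpSA b,
      Tendsto (fun n => ofFin k (c • x n - 𝓛.gen (x n))) atTop (𝓝 (ofFin k z)) ∧
      (0 ≤ (z : H →L[ℂ] H) → ∀ n, 0 ≤ (x n : H →L[ℂ] H)) := by
  obtain ⟨C, d, hC⟩ := 𝓛.exists_norm_gen_sub_compress_le k
  -- A large exponent with a known rate: the solutions are bounded in W^{k',1} uniformly in n, which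
  -- the defect estimate in W^{k,1} requires.
  obtain ⟨k', hk', ω, hm⟩ := hr d
  refine ⟨max 0 ω, fun c hc z => ?_⟩
  have hc0 : 0 < c := (le_max_left _ _).trans_lt hc
  have hcω : ω < c := (le_max_right _ _).trans_lt hc
  choose x hx hxz using fun n => 𝓛.exists_compress_resolvent (compress_mem_block n z) hc0
  refine ⟨x, ?_, fun hz n => ?_⟩
  · rw [tendsto_iff_norm_sub_tendsto_zero]
    have hlim : Tendsto (fun n : ℕ => ((n : ℝ) + 1)⁻¹ ^ 2 * (C * ((c - ω)⁻¹ * ‖ofFin k' z‖)))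
        atTop (𝓝 0) := by
      have h1 : Tendsto (fun n : ℕ => ((n : ℝ) + 1)⁻¹) atTop (𝓝 0) := by
        simpa using tendsto_one_div_add_atTop_nhds_zero_nat (𝕜 := ℝ)
      simpa using (h1.pow 2).mul_const (C * ((c - ω)⁻¹ * ‖ofFin k' z‖))
    refine squeeze_zero' (Eventually.of_forall fun n => norm_nonneg _) ?_ hlim
    -- Once `z` lies in the block, the residual is exactly the compression error.
    filter_upwards [eventually_mem_block z] with n hn
    have hxn := hxz n
    rw [mem_block.1 hn] at hxn
    have e : c • x n - 𝓛.gen (x n) - z = -(𝓛.gen (x n) - compress b n (𝓛.gen (x n))) := by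
      rw [← hxn]
      abel
    rw [← map_sub, e, map_neg, norm_neg]
    refine (hC k' hk' n (x n) (hx n)).trans ?_
    gcongr
    rw [le_inv_mul_iff₀ (sub_pos.2 hcω), ← hxn]
    exact 𝓛.norm_le_norm_compress hm hc0 hcω (hx n)
  · refine 𝓛.nonneg_of_compress_nonneg (hx n) hc0 ?_
    rw [hxz n]
    exact conj_nonneg_of_isSelfAdjoint hz (isSelfAdjoint_cutoff b n)

/-- An operator of `T_f`, as an element of the domain of the generator on `W^{k,1}`. -/
def toDomain (k : ℝ≥0) (x : finOpSA b) : (𝓛.onSobolev k).domain := ⟨ofFin k x, x.2⟩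

theorem coe_toDomain (k : ℝ≥0) (x : finOpSA b) :
    ((𝓛.toDomain k x : (𝓛.onSobolev k).domain) : Sobolev b k) = ofFin k x := rfl

theorem exists_toDomain {k : ℝ≥0} (x : (𝓛.onSobolev k).domain) : ∃ z, 𝓛.toDomain k z = x :=
  ⟨⟨(x : Sobolev b k).op, x.2⟩, rfl⟩

theorem shiftSub_toDomain (k : ℝ≥0) (c : ℝ) (x : finOpSA b) :
    shiftSub (𝓛.onSobolev k) c (𝓛.toDomain k x) = ofFin k (c • x - 𝓛.gen x) := by
  rw [map_sub, map_smul]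
  rfl

theorem norm_le_norm_shiftSub {k : ℝ≥0} {ω c : ℝ} (hm : 𝓛.HasMomentRate k ω) (hc : 0 < c)
    (hω : ω < c) (x : (𝓛.onSobolev k).domain) :
    (c - ω) * ‖(x : Sobolev b k)‖ ≤ ‖shiftSub (𝓛.onSobolev k) c x‖ := by
  obtain ⟨z, rfl⟩ := 𝓛.exists_toDomain x
  rw [shiftSub_toDomain]
  exact 𝓛.norm_le_norm_shift hm hc hω z

/-- The approximate solutions of positive data are positive, and the resolvent maps their right-hand
sides back to them. Since the positive cone is closed and truncation preserves it, the resolvent is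
positive. -/
theorem exists_isQuasiDissipative (k : ℝ≥0) {ω : ℝ} (hω : 0 ≤ ω) (hm : 𝓛.HasMomentRate k ω)
    (hr : ∀ d : ℝ≥0, ∃ k' ≥ d, ∃ ω, 𝓛.HasMomentRate k' ω) :
    ∃ l : ℝ, IsQuasiDissipative (𝓛.onSobolev k) l ω ∧
      ∀ c > l, ∀ x : Sobolev b k, 0 ≤ x.op → 0 ≤ (resolventExt (𝓛.onSobolev k) c x).op := by
  obtain ⟨l, hl⟩ := 𝓛.exists_tendsto_shift k hr
  have hqd : IsQuasiDissipative (𝓛.onSobolev k) (max l ω) ω :=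
    { nonneg := hω
      le := le_max_right _ _
      dense := (Sobolev.denseRange_ofFin (b := b) k).mono (by
        rintro _ ⟨z, rfl⟩
        exact z.2)
      lower := fun c hc x => by
        have h := (le_max_right _ _).trans_lt hc
        exact 𝓛.norm_le_norm_shiftSub hm (hω.trans_lt h) h x
      denseRange := fun c hc => by
        have h := (le_max_left _ _).trans_lt hc
        refine dense_closure.1 ((Sobolev.denseRange_ofFin (b := b) k).mono ?_)
        rintro _ ⟨z, rfl⟩
        obtain ⟨x, hx, -⟩ := hl c h z
        exact mem_closure_of_tendsto hx
          (Eventually.of_forall fun n => ⟨𝓛.toDomain k (x n), 𝓛.shiftSub_toDomain k c (x n)⟩) }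
  refine ⟨max l ω, hqd, fun c hc x hx => ?_⟩
  have h := (le_max_left _ _).trans_lt hc
  have hfin : ∀ z : finOpSA b, 0 ≤ (z : H →L[ℂ] H) →
      0 ≤ (resolventExt (𝓛.onSobolev k) c (ofFin k z)).op := fun z hz => by
    obtain ⟨y, hy, hy0⟩ := hl c h z
    refine Sobolev.isClosed_setOf_nonneg.mem_of_tendsto
      (((resolventExt (𝓛.onSobolev k) c).continuous.tendsto _).comp hy)
      (Eventually.of_forall fun n => ?_)
    rw [Function.comp_apply, ← shiftSub_toDomain, hqd.resolventExt_shiftSub hc]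
    exact hy0 hz n
  exact Sobolev.isClosed_setOf_nonneg.mem_of_tendsto
    (((resolventExt (𝓛.onSobolev k) c).continuous.tendsto _).comp (Sobolev.tendsto_truncate x))
    (Eventually.of_forall fun n => hfin _ (Sobolev.truncate_nonneg n hx))

theorem inclusion_ofFin {k k' : ℝ≥0} (h : k ≤ k') (z : finOpSA b) :
    Sobolev.inclusion h (ofFin k' z) = ofFin k z :=
  Sobolev.op_injective (by rw [Sobolev.op_inclusion, Sobolev.op_ofFin, Sobolev.op_ofFin])

/-- On (c - 𝓛) T_f, which is dense in W^{k',1}, both resolvents return the same element of `T_f`. -/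
theorem inclusion_resolventExt {k k' : ℝ≥0} (h : k ≤ k') {l l' ω ω' c : ℝ}
    (hk : IsQuasiDissipative (𝓛.onSobolev k) l ω) (hk' : IsQuasiDissipative (𝓛.onSobolev k') l' ω')
    (hc : l < c) (hc' : l' < c) (x : Sobolev b k') :
    Sobolev.inclusion h (resolventExt (𝓛.onSobolev k') c x) =
      resolventExt (𝓛.onSobolev k) c (Sobolev.inclusion h x) := by
  refine hk'.resolventExt_induction hc' (p := fun x => Sobolev.inclusion h
    (resolventExt (𝓛.onSobolev k') c x) = resolventExt (𝓛.onSobolev k) c (Sobolev.inclusion h x))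
    (isClosed_eq (by fun_prop) (by fun_prop)) (fun y => ?_) x
  obtain ⟨z, rfl⟩ := 𝓛.exists_toDomain y
  rw [hk'.resolventExt_shiftSub hc', shiftSub_toDomain, inclusion_ofFin, ← shiftSub_toDomain,
    hk.resolventExt_shiftSub hc, coe_toDomain, coe_toDomain, inclusion_ofFin]

/-- On `T_f` the trace of (c - 𝓛) z is c tr z, as 𝓛(z) is traceless; the rest is density. -/
theorem traceL_resolventExt {l ω c : ℝ} (h : IsQuasiDissipative (𝓛.onSobolev 0) l ω) (hc : l < c)
    (x : Sobolev b 0) :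
    Sobolev.traceL b (resolventExt (𝓛.onSobolev 0) c x) = c⁻¹ • Sobolev.traceL b x := by
  have hc0 : c ≠ 0 := ((h.nonneg.trans h.le).trans_lt hc).ne'
  refine h.resolventExt_induction hc (p := fun x => Sobolev.traceL b
    (resolventExt (𝓛.onSobolev 0) c x) = c⁻¹ • Sobolev.traceL b x)
    (isClosed_eq (by fun_prop) (by fun_prop)) (fun y => ?_) x
  obtain ⟨z, rfl⟩ := 𝓛.exists_toDomain y
  have hg : Sobolev.traceL b (ofFin 0 (𝓛.gen z)) = 0 := 𝓛.opTrace_gen z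
  rw [h.resolventExt_shiftSub hc, shiftSub_toDomain, map_sub, map_sub, map_smul, map_smul, hg,
    sub_zero, smul_smul, inv_mul_cancel₀ hc0, one_smul]
  rfl

/-- Any moment rate known at k bounds the resolvents, even if the semigroup was built with another
rate. -/
theorem norm_le_of_hasMomentRate {k : ℝ≥0} {l ω ω' : ℝ}
    (h : IsQuasiDissipative (𝓛.onSobolev k) l ω) {P : ℝ≥0 → Sobolev b k →L[ℝ] Sobolev b k}
    (hP : IsYosidaLimit (resolventExt (𝓛.onSobolev k)) P) (hm : 𝓛.HasMomentRate k ω') (t : ℝ≥0) :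
    ‖P t‖ ≤ Real.exp (ω' * t) := by
  refine h.isResolventFamily.norm_le hP ?_ t
  filter_upwards [eventually_gt_atTop l, eventually_gt_atTop ω',
    eventually_gt_atTop 0] with c h1 h2 h3
  exact h.norm_resolventExt_le h1 h2 (𝓛.norm_le_norm_shiftSub hm h3 h2)

end GKSL

/-! ### Construction of the semigroups and conclusion -/

namespace GKSL
variable {H : Type*} [NormedAddCommGroup H] [InnerProductSpace ℂ H] [CompleteSpace H]
  {b : HilbertBasis ℕ ℂ H} (𝓛 : GKSL b)

theorem hasMomentRate_interpRate {κ₀ κ₁ ω₀ ω₁ k : ℝ} (hm0 : 𝓛.HasMomentRate κ₀ ω₀)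
    (hm1 : 𝓛.HasMomentRate κ₁ ω₁) (h0 : κ₀ ≤ k) (h1 : k < κ₁) :
    𝓛.HasMomentRate k (interpRate κ₀ ω₀ κ₁ ω₁ k) :=
  𝓛.mom_gen_rk_interpRate hm0 hm1 h0 h1

theorem exists_isYosidaLimit {κ ω : ℕ → ℝ≥0} (hκ : Tendsto κ atTop atTop)
    (hm : ∀ r, 𝓛.HasMomentRate (κ r) (ω r)) (k : ℝ≥0) :
    ∃ P l ω', IsQuasiDissipative (𝓛.onSobolev k) l ω' ∧
      IsYosidaLimit (resolventExt (𝓛.onSobolev k)) P ∧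
      ∀ c > l, ∀ x : Sobolev b k, 0 ≤ x.op → 0 ≤ (resolventExt (𝓛.onSobolev k) c x).op := by
  obtain ⟨r, hr⟩ := (hκ.eventually_gt_atTop k).exists
  have hk : (k : ℝ) < κ r := by exact_mod_cast hr
  -- Interpolation from exponent 0 covers every k, also below all members of the sequence, and its
  -- rate is nonnegative.
  have hrate := 𝓛.hasMomentRate_interpRate 𝓛.hasMomentRate_zero (hm r) k.2 hk
  have hnn : 0 ≤ interpRate 0 0 (κ r) (ω r) k := by
    rw [interpRate, mul_zero, zero_add, sub_zero, sub_zero]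
    positivity
  obtain ⟨l, h, hpos⟩ := 𝓛.exists_isQuasiDissipative k hnn hrate fun d => by
    obtain ⟨r', hr'⟩ := (hκ.eventually_ge_atTop d).exists
    exact ⟨κ r', hr', ω r', hm r'⟩
  obtain ⟨P, hP⟩ := h.isResolventFamily.exists_isYosidaLimit
  exact ⟨P, l, _, h, hP, hpos⟩

end GKSL

end
end Bosonic

theorem theorem3p3 {H : Type*} [NormedAddCommGroup H] [InnerProductSpace ℂ H] [CompleteSpace H]
    (b : HilbertBasis ℕ ℂ H) (𝓛 : GKSL b) (κ ω : ℕ → ℝ≥0) (hκ : Tendsto κ atTop atTop)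
    (hmom : ∀ r, ∀ x : finOpSA b, 0 ≤ (x : H →L[ℂ] H) →
      moment b (κ r / 2) (𝓛.gen x) ≤ ω r * moment b (κ r / 2) x) :
    ∃ P : ∀ k : ℝ≥0, ℝ≥0 → Sobolev b k →L[ℝ] Sobolev b k,
      -- the semigroups on the different spaces are one and the same evolution
      (∀ k k' t, ∀ (x : Sobolev b k) (x' : Sobolev b k'),
        x.op = x'.op → (P k t x).op = (P k' t x').op) ∧
      (∀ k,
        -- the closure of `(𝓛, T_f)` generates a strongly continuous semigroup on `W^{k,1}`
        IsC0Semigroup (P k) ∧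
        (𝓛.onSobolev k).IsClosable ∧ IsGenerator (𝓛.onSobolev k).closure (P k) ∧
        -- it is positivity preserving
        (∀ t, ∀ x : Sobolev b k, 0 ≤ x.op → 0 ≤ (P k t x).op) ∧
        -- norm bound, interpolating between two members of the sequence
        (∀ r₀ r₁, κ r₀ ≤ k → k < κ r₁ → ∀ t : ℝ≥0,
          ‖P k t‖ ≤ Real.exp (interpRate (κ r₀) (ω r₀) (κ r₁) (ω r₁) k * t)) ∧
        -- norm bound, interpolating between `0`, with rate `0`, and a member of the sequence
        (∀ r₁, k < κ r₁ → ∀ t : ℝ≥0,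
          ‖P k t‖ ≤ Real.exp (interpRate 0 0 (κ r₁) (ω r₁) k * t))) ∧
      -- for `k = 0` it is contractive and trace preserving
      (∀ t, ‖P 0 t‖ ≤ 1) ∧
      (∀ t, ∀ x : Sobolev b 0, opTrace b (P 0 t x).op = opTrace b x.op) := by
  -- The assumption is needed only for rank-one operators.
  have hm : ∀ r, 𝓛.HasMomentRate (κ r) (ω r) := fun r u => by
    have h := hmom r (rk u) (rk_nonneg u)
    rwa [moment_eq_mom, moment_eq_mom, mom_rk] at h
  choose P l ω' hqd hP hpos using 𝓛.exists_isYosidaLimit hκ hm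
  have hmono : ∀ {k k' : ℝ≥0} (h : k ≤ k') t (x : Sobolev b k'),
      Sobolev.inclusion h (P k' t x) = P k t (Sobolev.inclusion h x) := fun {k k'} h t x => by
    refine (hP k').intertwine (hP k) (Sobolev.inclusion h) ?_ t x
    filter_upwards [eventually_gt_atTop (l k), eventually_gt_atTop (l k')] with c h1 h2
    exact 𝓛.inclusion_resolventExt h (hqd k) (hqd k') h1 h2
  have hcons : ∀ {k k' : ℝ≥0}, k ≤ k' → ∀ t (x : Sobolev b k) (x' : Sobolev b k'),
      x.op = x'.op → (P k t x).op = (P k' t x').op := fun h t x x' hx => by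
    -- An operator that belongs to both spaces is the embedded image of its version in the smaller
    -- one, so agreement reduces to `hmono`.
    have : x = Sobolev.inclusion h x' :=
      Sobolev.op_injective (hx.trans (Sobolev.op_inclusion h x').symm)
    rw [this, ← hmono, Sobolev.op_inclusion]
  refine ⟨P, fun k k' t x x' hx => ?_, fun k => ⟨(hqd k).isResolventFamily.isC0Semigroup (hP k),
    (hqd k).isClosable, (hqd k).isGenerator_closure (hP k), fun t x hx => ?_,
    fun r₀ r₁ h0 h1 t => ?_, fun r₁ h1 t => ?_⟩, fun t => ?_, fun t x => ?_⟩
  · rcases le_total k k' with h | h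
    · exact hcons h t x x' hx
    · exact (hcons h t x' x hx.symm).symm
  -- The positive operators form a closed convex cone that is invariant under the resolvents.
  · refine (hP k).apply_mem (s := {x | 0 ≤ x.op}) Sobolev.isClosed_setOf_nonneg ?_ ?_ ?_ ?_ t hx
    · exact (map_zero (Sobolev.op (b := b) (k := k))).ge
    · intro x hx y hy
      exact (add_nonneg hx hy).trans_eq (map_add Sobolev.op x y).symm
    · intro c hc x hx
      exact (smul_nonneg hc hx).trans_eq (map_smul Sobolev.op c x).symm
    · filter_upwards [eventually_gt_atTop (l k)] with c hc
      exact hpos k c hc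
  · exact 𝓛.norm_le_of_hasMomentRate (hqd k) (hP k) (𝓛.hasMomentRate_interpRate (hm r₀) (hm r₁)
      (by exact_mod_cast h0) (by exact_mod_cast h1)) t
  · exact 𝓛.norm_le_of_hasMomentRate (hqd k) (hP k)
      (𝓛.hasMomentRate_interpRate 𝓛.hasMomentRate_zero (hm r₁) k.2 (by exact_mod_cast h1)) t
  · simpa using 𝓛.norm_le_of_hasMomentRate (ω' := 0) (hqd 0) (hP 0)
      (by simpa using 𝓛.hasMomentRate_zero) t
  -- The trace intertwines the evolution with the constant semigroup on ℂ.
  · have h := (hP 0).intertwine isYosidaLimit_inv_smul_one (Sobolev.traceL b)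
      (by
        filter_upwards [eventually_gt_atTop (l 0)] with c hc x
        exact 𝓛.traceL_resolventExt (hqd 0) hc x) t x
    exact h
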